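/- **Theorem 2.1, parts (i)–(iii).** For $\alpha,\beta>0$, $\gamma\ge 0$ let $$I(u,f)=\int_0^\infty\Big\{2(u')^2+\frac{(1-u^2)^2}{r^2}+\alpha\big[r^2(f')^2+\beta f^2u^2\big]+\frac{\alpha\gamma}{2}\,r^2(f^2-1)^2\Big\}\,dr,$$ and let $X$ be the set of pairs $(u,f)$ of real functions on $(0,\infty)$ that are absolutely continuous on every compact subinterval of $(0,\infty)$, have $I(u,f)<\infty$, and satisfy the boundary conditions (as limits) $$f(0)=0,\quad u(0)=1,\quad f(\infty)=1,\quad u(\infty)=0.\qquad (\ast)$$ (i) For all $\alpha,\beta>0$ and $\gamma\ge0$, $I$ attains its minimum over $X$. Every minimizer $(u,f)$ is a classical solution on $(0,\infty)$ of $$u''=\frac{\alpha\beta}{2}f^2u+\frac{u(u^2-1)}{r^2},\qquad f''=-\frac2r f'+\frac{\beta}{r^2}fu^2+\gamma f(f^2-1),\qquad(\mathrm{EL})$$ and satisfies $0<u(r)<1$ and $0<f(r)<1$ for all $r>0$. Moreover, for every $\varepsilon\in(0,1)$, $$u(r)=O\big(e^{-\sqrt{\alpha\beta/2}\,(1-\varepsilon)r}\big)\quad(r\to\infty),$$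 $$1-f(r)=O\big(e^{-\sqrt2\min\{\sqrt\gamma,\sqrt{\alpha\beta}\}(1-\varepsilon)r}\big)\quad(r\to\infty)\quad\text{if }\gamma>0,$$ $$1-u(r)=O\big(r^{2(1-\varepsilon)}\big),\qquad f(r)=O\big(r^{\sigma(1-\varepsilon)}\big)\quad(r\to0),\qquad \sigma=\sqrt{\tfrac14+\beta}-\tfrac12,$$ while for $\gamma=0$ one has $1-f(r)=O(1/r)$ as $r\to\infty$. (ii) Let $\gamma=0$, $\beta=2$, $\alpha>0$. For pairs $(u,f)$ with $I(u,f)<\infty$ satisfying $(\ast)$, the system (EL) is equivalent to the first-order BPS system $$u'+\sqrt\alpha\,fu=0,\qquad \sqrt\alpha\,rf'-\frac{1-u^2}{r}=0\qquad(r>0).$$ The BPS system has exactly one solution on $(0,\infty)$ satisfying $(\ast)$, namely $$u(r)=\frac{\sqrt\alpha\,r}{\sinh(\sqrt\alpha\,r)},\qquad f(r)=\coth(\sqrt\alpha\,r)-\frac1{\sqrt\alpha\,r}.$$ This pair minimizes $I$ over $X$, and its energy is $2\sqrt\alpha$. (iii) Let $\gamma=0$ and let $\alpha,\beta>0$ be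 arbitrary. For every minimizer $(u,f)$ of $I$ over $X$, $u$ is strictly decreasing and $f$ is strictly increasing on $(0,\infty)$, and $$\sqrt\alpha\,\min\{\sqrt{2\beta},2\}\le I(u,f)\le\frac{\sqrt\alpha}{3}\Big(8-\frac{\pi^2}{3}+\Big[\frac{\pi^2}{6}-1\Big]\beta\Big).$$ Both inequalities are equalities for $\beta=2$, and both are strict for $\beta\ne2$. -/

import Mathlib

open MeasureTheory Set Filter Topology Asymptotics

noncomputable section

namespace DarkMonopole

/-- The energy density at radius `r` of a pair of profile functions `(u, f)`. -/
def energyDensity (α β γ : ℝ) (u f : ℝ → ℝ) (r : ℝ) : ℝ :=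
  2 * (deriv u r) ^ 2 + (1 - u r ^ 2) ^ 2 / r ^ 2
    + α * (r ^ 2 * (deriv f r) ^ 2 + β * f r ^ 2 * u r ^ 2)
    + α * γ / 2 * r ^ 2 * (f r ^ 2 - 1) ^ 2

/-- The radial energy `I(u, f)`, the integral over `(0, ∞)` of the (nonnegative) energy density,
with values in `[0, ∞]`. The profile functions are total functions on `ℝ`, but only their
restrictions to `(0, ∞)` matter. -/
def energy (α β γ : ℝ) (u f : ℝ → ℝ) : ENNReal :=
  ∫⁻ r in Ioi (0 : ℝ), ENNReal.ofReal (energyDensity α β γ u f r)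

/-- The boundary conditions `f(0) = 0`, `u(0) = 1`, `f(∞) = 1`, `u(∞) = 0`, as limits. -/
structure BoundaryConditions (u f : ℝ → ℝ) : Prop where
  f_zero : Tendsto f (𝓝[>] 0) (𝓝 0)
  u_zero : Tendsto u (𝓝[>] 0) (𝓝 1)
  f_infty : Tendsto f atTop (𝓝 1)
  u_infty : Tendsto u atTop (𝓝 0)

/-- The admissible class: pairs of finite energy, absolutely continuous on every compact
subinterval of `(0, ∞)`, that satisfy the boundary conditions. -/
structure Admissible (α β γ : ℝ) (u f : ℝ → ℝ) : Prop where
  finite_energy : energy α β γ u f < ⊤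
  ac_u : ∀ a b : ℝ, 0 < a → a ≤ b → AbsolutelyContinuousOnInterval u a b
  ac_f : ∀ a b : ℝ, 0 < a → a ≤ b → AbsolutelyContinuousOnInterval f a b
  boundary : BoundaryConditions u f

/-- `(u, f)` minimizes the energy over the admissible class. -/
def IsMinimizer (α β γ : ℝ) (u f : ℝ → ℝ) : Prop :=
  Admissible α β γ u f ∧
    ∀ v g : ℝ → ℝ, Admissible α β γ v g → energy α β γ u f ≤ energy α β γ v g

/-- `(u, f)` is a classical (twice differentiable) solution on `(0, ∞)` of the Euler-Lagrange
equations `u'' = (α β / 2) f² u + u (u² - 1) / r²` and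
`f'' = -(2 / r) f' + (β / r²) f u² + γ f (f² - 1)`. -/
def SolvesEulerLagrange (α β γ : ℝ) (u f : ℝ → ℝ) : Prop :=
  ∀ r : ℝ, 0 < r →
    DifferentiableAt ℝ u r ∧ DifferentiableAt ℝ f r ∧
    HasDerivAt (deriv u) (α * β / 2 * f r ^ 2 * u r + u r * (u r ^ 2 - 1) / r ^ 2) r ∧
    HasDerivAt (deriv f)
      (-(2 / r) * deriv f r + β / r ^ 2 * f r * u r ^ 2 + γ * f r * (f r ^ 2 - 1)) r

/-- `(u, f)` is a differentiable solution on `(0, ∞)` of the first-order BPS equations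
`u' + √α f u = 0` and `√α r f' - (1 - u²) / r = 0`. -/
def SolvesBPS (α : ℝ) (u f : ℝ → ℝ) : Prop :=
  ∀ r : ℝ, 0 < r →
    DifferentiableAt ℝ u r ∧ DifferentiableAt ℝ f r ∧
    deriv u r + √α * f r * u r = 0 ∧
    √α * r * deriv f r - (1 - u r ^ 2) / r = 0

/-- `u(r) = √α r / sinh (√α r)`. -/
def uBPS (α : ℝ) (r : ℝ) : ℝ :=
  √α * r / Real.sinh (√α * r)

/-- `f(r) = coth (√α r) - 1 / (√α r)`. -/
def fBPS (α : ℝ) (r : ℝ) : ℝ :=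
  Real.cosh (√α * r) / Real.sinh (√α * r) - 1 / (√α * r)

end DarkMonopole

end

/-! Existence is the direct method in a larger class that keeps only u(0) = 1 and f(∞) = 1. These
two conditions survive weak limits: along a minimizing sequence u' and r f' are bounded in L²(0, ∞),
and u(r) = 1 + ∫₀^r u' and f(r) = 1 - ∫_r^∞ (s f') s⁻¹ are pairings of these functions with fixed
elements of L². Weak convergence of derivatives is therefore pointwise convergence of profiles; the
kinetic part is weakly lower semicontinuous and the potential part passes to the limit by Fatou
(`exists_relaxed_minimizer`). Truncation does not raise the energy, and compactly supported
variations with the du Bois-Reymond argument (`euler_lagrange_of_minimal`) give (EL). The equations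
together with finite energy force the two dropped conditions f(0) = 0 and u(∞) = 0, so the truncated
relaxed minimizer is admissible and minimizes over X.

Strict bounds come from uniqueness for linear second-order equations (no double zeros) and from the
second derivative test at the value 1. The decay rates come from a maximum principle
(`le_of_second_deriv_pos`) with power or exponential barriers, whose exponents are slightly worse
than those of the linearised equations; this is the role of ε. For γ = 0 the bound on 1 - f comes
from boundedness of the flux r² f'.

In the BPS case put P = u' + √α f u and R = √α r² f' - (1 - u²). The energy density is 2P² + (R/r)²
plus the derivative of 2√α f (1 - u²), so the energy is 2√α + ∫ (2P² + (R/r)²). For a solution of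
(EL) the virial identity and the flux equation also give the energy as 2αC, where C is the limit of
r² f' at infinity. Hence the integral of squares is 2√α L with L = √α C - 1 = R(∞). Since R(0) = 0
and R is strictly convex wherever it is positive, L ≤ 0, and P = R = 0. The first-order system is
integrated through w = f + 1/(√α r), which satisfies a Riccati equation. That the explicit pair is a
minimizer follows from existence: some minimizer exists, and it must be this pair.

For γ = 0 the flux r² f' increases from 0, so f' > 0. Monotonicity of u follows by comparing (EL) at
a local minimum and a later local maximum. With both signs known, the completed square for general β
has remainders of definite sign, which is the lower bound. The upper bound is the energy of the BPS
pair used as a competitor; the extra integral of f² u² reduces to ∫ u², hence to ζ(2). -/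

namespace DarkMonopole

/-! ### Calculus on the half-line -/

section

/-- Sequential weak compactness of bounded sequences in a separable Hilbert space. -/
theorem exists_subseq_tendsto_inner {H : Type*} [NormedAddCommGroup H] [InnerProductSpace ℝ H]
    [CompleteSpace H] [TopologicalSpace.SeparableSpace H] {x : ℕ → H} {C : ℝ}
    (hx : ∀ n, ‖x n‖ ≤ C) :
    ∃ (y : H) (φ : ℕ → ℕ), StrictMono φ ∧
      ∀ v : H, Tendsto (fun n => inner ℝ (x (φ n)) v) atTop (𝓝 (inner ℝ y v)) := by
  have hc := WeakDual.isSeqCompact_closedBall ℝ H 0 C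
  obtain ⟨y, -, φ, hφ, hy⟩ := hc
    (x := fun n => WeakDual.toStrongDual.symm (InnerProductSpace.toDual ℝ H (x n))) (by
      intro n
      simpa using hx n)
  refine ⟨(InnerProductSpace.toDual ℝ H).symm (WeakDual.toStrongDual y), φ, hφ, fun v => ?_⟩
  have h := (tendsto_iff_forall_eval_tendsto_topDualPairing.1 hy) v
  have e1 : inner ℝ ((InnerProductSpace.toDual ℝ H).symm (WeakDual.toStrongDual y)) v
      = topDualPairing ℝ H y v := by
    rw [InnerProductSpace.toDual_symm_apply]
    rfl
  rw [e1]
  refine h.congr fun n => ?_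
  rfl

/-- A derivative cannot be integrable at infinity against a primitive of size `r * h` with `h`
integrable unless the primitive tends to zero. -/
theorem eq_zero_of_tendsto_atTop_of_abs_le_mul {G h : ℝ → ℝ} {L : ℝ}
    (hG : Tendsto G atTop (𝓝 L)) (hh : IntegrableOn h (Ioi 1))
    (hle : ∀ᶠ r in atTop, |G r| ≤ r * h r) : L = 0 := by
  by_contra hL
  have hL' : 0 < |L| / 2 := by positivity
  have h1 : ∀ᶠ r in atTop, |L| / 2 < |G r| :=
    hG.abs.eventually_const_lt (by linarith)
  obtain ⟨a, ha⟩ := (eventually_atTop.1 (h1.and hle))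
  set b := max a 1 with hb
  have hb1 : 1 ≤ b := le_max_right _ _
  have hi : IntegrableOn h (Ioi b) := hh.mono_set (Ioi_subset_Ioi hb1)
  -- A nonzero limit would make `h` dominate a multiple of 1/r, which is not integrable at infinity.
  have : IntegrableOn (fun r : ℝ => |L| / 2 * r⁻¹) (Ioi b) := by
    refine Integrable.mono' hi (by fun_prop) ?_
    filter_upwards [self_mem_ae_restrict measurableSet_Ioi] with r hr
    have hr' : b < r := hr
    have hr0 : 0 < r := by linarith
    obtain ⟨h2, h3⟩ := ha r ((le_max_left a 1).trans hr'.le)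
    rw [Real.norm_of_nonneg (by positivity), ← div_eq_mul_inv, div_le_iff₀ hr0]
    linarith
  have h4 : IntegrableOn (fun r : ℝ => r⁻¹) (Ioi b) :=
    (integrable_const_mul_iff (IsUnit.mk0 _ hL'.ne') _).1 this
  exact not_integrableOn_Ioi_inv h4

/-- The analogue at the origin. -/
theorem eq_zero_of_tendsto_nhdsGT_of_abs_le_mul {G h : ℝ → ℝ} {L : ℝ}
    (hG : Tendsto G (𝓝[>] 0) (𝓝 L)) (hh : IntegrableOn h (Ioc 0 1))
    (hle : ∀ᶠ r in 𝓝[>] (0 : ℝ), |G r| ≤ r * h r) : L = 0 := by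
  by_contra hL
  have hL' : 0 < |L| / 2 := by positivity
  have h1 : ∀ᶠ r in 𝓝[>] (0 : ℝ), |L| / 2 < |G r| :=
    hG.abs.eventually_const_lt (by linarith)
  obtain ⟨a, ha0, ha⟩ := (mem_nhdsGT_iff_exists_Ioo_subset.1 (h1.and hle))
  have ha0' : 0 < a := ha0
  set b := min (a / 2) 1 with hb
  have hb1 : b ≤ 1 := min_le_right _ _
  have hb2 : b ≤ a / 2 := min_le_left _ _
  have hb0 : 0 < b := by positivity
  have hi : IntegrableOn h (Ioc 0 b) := hh.mono_set (Ioc_subset_Ioc_right hb1)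
  have : IntegrableOn (fun r : ℝ => |L| / 2 * r⁻¹) (Ioc 0 b) := by
    refine Integrable.mono' hi (by fun_prop) ?_
    filter_upwards [self_mem_ae_restrict measurableSet_Ioc] with r hr
    have hr0 : 0 < r := hr.1
    obtain ⟨h2, h3⟩ := ha ⟨hr.1, by linarith [hr.2]⟩
    rw [Real.norm_of_nonneg (by positivity), ← div_eq_mul_inv, div_le_iff₀ hr0]
    linarith
  have h4 : IntegrableOn (fun r : ℝ => r⁻¹) (Ioc 0 b) :=
    (integrable_const_mul_iff (IsUnit.mk0 _ hL'.ne') _).1 this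
  rw [← intervalIntegrable_iff_integrableOn_Ioc_of_le hb0.le, intervalIntegrable_inv_iff] at h4
  rcases h4 with h4 | h4
  · exact hb0.ne h4
  · exact h4 left_mem_uIcc

theorem exists_tendsto_atTop_of_integrable_deriv {G g : ℝ → ℝ} {a : ℝ}
    (hd : ∀ r ∈ Ioi a, HasDerivAt G (g r) r) (hg : IntegrableOn g (Ioi a)) :
    ∃ L, Tendsto G atTop (𝓝 L) :=
  ⟨_, tendsto_limUnder_of_hasDerivAt_of_integrableOn_Ioi hd hg⟩

theorem exists_tendsto_nhdsGT_of_integrable_deriv {G g : ℝ → ℝ} {b : ℝ} (hb : 0 < b)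
    (hd : ∀ r ∈ Ioc 0 b, HasDerivAt G (g r) r) (hg : IntegrableOn g (Ioc 0 b)) :
    ∃ L, Tendsto G (𝓝[>] 0) (𝓝 L) := by
  refine ⟨G b - ∫ s in (0 : ℝ)..b, g s, ?_⟩
  have hii : IntervalIntegrable g volume 0 b := by
    rwa [intervalIntegrable_iff_integrableOn_Ioc_of_le hb.le]
  have h1 : Tendsto (fun r => ∫ s in b..r, g s) (𝓝[>] 0) (𝓝 (∫ s in b..0, g s)) := by
    have hc := intervalIntegral.continuousOn_primitive_interval' hii (a := b) right_mem_uIcc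
    have := hc 0 left_mem_uIcc
    refine this.mono_left ?_
    rw [uIcc_of_le hb.le]
    exact nhdsWithin_le_of_mem (Icc_mem_nhdsGT hb)
  have h2 : Tendsto (fun r => G b + ∫ s in b..r, g s) (𝓝[>] 0)
      (𝓝 (G b - ∫ s in (0 : ℝ)..b, g s)) := by
    rw [intervalIntegral.integral_symm] at h1
    simpa [sub_eq_add_neg] using h1.const_add (G b)
  refine h2.congr' ?_
  filter_upwards [Ioc_mem_nhdsGT hb] with r hr
  rw [intervalIntegral.integral_symm, intervalIntegral.integral_eq_sub_of_hasDerivAt (f := G)]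
  · ring
  · intro x hx
    rw [uIcc_of_le hr.2] at hx
    exact hd x ⟨hr.1.trans_le hx.1, hx.2⟩
  · refine hii.mono_set ?_
    rw [uIcc_of_le hr.2, uIcc_of_le hb.le]
    exact Icc_subset_Icc_left hr.1.le

/-- The fundamental theorem of calculus on `(0, ∞)` in terms of the limits at both ends. -/
theorem integral_Ioi_zero_of_hasDerivAt {G g : ℝ → ℝ} {m n : ℝ}
    (hd : ∀ r ∈ Ioi (0 : ℝ), HasDerivAt G (g r) r) (hg : IntegrableOn g (Ioi 0))
    (hm : Tendsto G (𝓝[>] 0) (𝓝 m)) (hn : Tendsto G atTop (𝓝 n)) :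
    ∫ r in Ioi (0 : ℝ), g r = n - m := by
  -- The value of `G` at 0 is arbitrary; replacing it by the limit `m` makes the function continuous
  -- up to the left endpoint.
  have := integral_Ioi_of_hasDerivAt_of_tendsto (a := 0) (f := Function.update G 0 m) (f' := g)
    (m := n) ?_ ?_ hg ?_
  · simpa using this
  · rw [continuousWithinAt_update_same]
    refine hm.mono_left (nhdsWithin_mono _ ?_)
    intro x hx
    exact lt_of_le_of_ne hx.1 (Ne.symm hx.2)
  · intro x hx
    refine (hd x hx).congr_of_eventuallyEq ?_
    filter_upwards [isOpen_Ioi.mem_nhds hx] with y hy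
    rw [Function.update_of_ne (ne_of_gt hy)]
  · refine hn.congr' ?_
    filter_upwards [eventually_gt_atTop 0] with y hy
    rw [Function.update_of_ne (ne_of_gt hy)]

/-- If `G` has the integrable derivative `g` on `(0, ∞)` and `|G r| ≤ r h r` with `h` integrable,
then `g` has integral zero. -/
theorem integral_Ioi_eq_zero_of_abs_le_mul {G g h : ℝ → ℝ}
    (hd : ∀ r ∈ Ioi (0 : ℝ), HasDerivAt G (g r) r) (hg : IntegrableOn g (Ioi 0))
    (hh : IntegrableOn h (Ioi 0)) (hle : ∀ r, 0 < r → |G r| ≤ r * h r) :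
    ∫ r in Ioi (0 : ℝ), g r = 0 := by
  obtain ⟨L, hL⟩ := exists_tendsto_atTop_of_integrable_deriv hd hg
  obtain ⟨M, hM⟩ := exists_tendsto_nhdsGT_of_integrable_deriv one_pos
    (fun r hr => hd r hr.1) (hg.mono_set Ioc_subset_Ioi_self)
  have hL0 := eq_zero_of_tendsto_atTop_of_abs_le_mul hL
    (hh.mono_set (Ioi_subset_Ioi zero_le_one))
    (by filter_upwards [eventually_gt_atTop 0] with r hr using hle r hr)
  have hM0 := eq_zero_of_tendsto_nhdsGT_of_abs_le_mul hM (hh.mono_set Ioc_subset_Ioi_self)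
    (by filter_upwards [self_mem_nhdsWithin] with r hr using hle r hr)
  rw [integral_Ioi_zero_of_hasDerivAt hd hg hM hL, hL0, hM0, sub_zero]

/-- Maximum principle: a function with positive second derivative at positive critical points is
bounded by any nonnegative bound of its boundary values. -/
theorem le_of_second_deriv_pos {w w' : ℝ → ℝ} {a b m : ℝ} (hab : a ≤ b)
    (hc : ContinuousOn w (Icc a b)) (hd : ∀ x ∈ Ioo a b, HasDerivAt w (w' x) x)
    (hdd : ∀ x ∈ Ioo a b, 0 < w x → w' x = 0 → ∃ k, 0 < k ∧ HasDerivAt w' k x)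
    (hm : 0 ≤ m) (ha : w a ≤ m) (hb : w b ≤ m) : ∀ x ∈ Icc a b, w x ≤ m := by
  by_contra! hcon
  obtain ⟨x₀, hx₀, hlt⟩ := hcon
  obtain ⟨x, hx, hmax⟩ := isCompact_Icc.exists_isMaxOn ⟨a, left_mem_Icc.2 hab⟩ hc
  have hxm : m < w x := hlt.trans_le (hmax hx₀)
  have hxa : x ≠ a := fun h => by rw [h] at hxm; linarith
  have hxb : x ≠ b := fun h => by rw [h] at hxm; linarith
  have hxI : x ∈ Ioo a b := ⟨lt_of_le_of_ne hx.1 hxa.symm, lt_of_le_of_ne hx.2 hxb⟩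
  have hloc : IsLocalMax w x := hmax.isLocalMax (Icc_mem_nhds hxI.1 hxI.2)
  have hw0 : w' x = 0 := hloc.hasDerivAt_eq_zero (hd x hxI)
  obtain ⟨k, hk, hkd⟩ := hdd x hxI (hm.trans_lt hxm) hw0
  -- A maximum above `m` is interior, hence critical. There `w'` vanishes with positive derivative,
  -- so `w` increases strictly just to the right of its maximum.
  have hev : ∀ᶠ y in 𝓝[>] x, 0 < w' y := by
    have hs := (hasDerivAt_iff_tendsto_slope.1 hkd).eventually_const_lt hk
    have hs' : ∀ᶠ y in 𝓝[>] x, 0 < slope w' x y :=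
      hs.filter_mono (nhdsWithin_mono _ fun y hy => ne_of_gt hy)
    filter_upwards [hs', self_mem_nhdsWithin] with y hy hxy
    rw [slope_def_field, hw0, sub_zero] at hy
    have : 0 < y - x := sub_pos.2 hxy
    exact (div_pos_iff_of_pos_right this).1 hy
  obtain ⟨c, hc1, hc2⟩ := mem_nhdsGT_iff_exists_Ioo_subset.1
    (hev.and (Ioo_mem_nhdsGT hxI.2))
  have hxc : x < c := hc1
  set d := (x + c) / 2
  have hxd : x < d := by simp only [d]; linarith
  have hdc : d < c := by simp only [d]; linarith
  have hdb : d < b := (hc2 ⟨hxd, hdc⟩).2.2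
  have hmono : StrictMonoOn w (Icc x d) := by
    refine strictMonoOn_of_deriv_pos (convex_Icc x d)
      (hc.mono (Icc_subset_Icc hx.1 hdb.le)) ?_
    intro y hy
    rw [interior_Icc] at hy
    have h1 := hc2 ⟨hy.1, hy.2.trans hdc⟩
    rw [(hd y ⟨hxI.1.trans hy.1, h1.2.2⟩).deriv]
    exact h1.1
  have h1 := hmono (left_mem_Icc.2 hxd.le) (right_mem_Icc.2 hxd.le) hxd
  have h2 : w d ≤ w x := hmax ⟨hx.1.trans hxd.le, hdb.le⟩
  linarith

/-- At an interior local maximum the second derivative is nonpositive. -/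
theorem second_deriv_nonpos_of_isLocalMax {w : ℝ → ℝ} {x k : ℝ}
    (hd : ∀ᶠ y in 𝓝 x, DifferentiableAt ℝ w y) (hmax : IsLocalMax w x)
    (hk : HasDerivAt (deriv w) k x) : k ≤ 0 := by
  by_contra! hpos
  have h0 := hmax.deriv_eq_zero
  -- If `k` were positive, the point would be a local minimum as well as a maximum, so `w` would be
  -- locally constant and `k` zero.
  have hmin : IsLocalMin w x := by
    refine isLocalMin_of_deriv_deriv_pos ?_ h0 hd.self_of_nhds.continuousAt
    rwa [hk.deriv]
  have heq : ∀ᶠ y in 𝓝 x, w y = w x := by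
    filter_upwards [hmax, hmin] with y h1 h2 using le_antisymm h1 h2
  have h1 : deriv w =ᶠ[𝓝 x] fun _ => 0 := by
    have : w =ᶠ[𝓝 x] fun _ => w x := heq
    simpa using this.deriv
  have h2 := h1.deriv_eq
  rw [hk.deriv, deriv_const] at h2
  linarith

theorem second_deriv_nonneg_of_isLocalMin {w : ℝ → ℝ} {x k : ℝ}
    (hd : ∀ᶠ y in 𝓝 x, DifferentiableAt ℝ w y) (hmin : IsLocalMin w x)
    (hk : HasDerivAt (deriv w) k x) : 0 ≤ k := by
  have hneg : deriv (fun y => -w y) = fun y => -deriv w y := by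
    ext y; exact deriv.fun_neg
  have := second_deriv_nonpos_of_isLocalMax (w := fun y => -w y) (x := x) (k := -k)
    (hd.mono fun y hy => hy.neg) hmin.neg (by rw [hneg]; exact hk.neg)
  linarith

end

/-! ### Absolutely continuous functions and the fundamental lemma -/

section

/-- This is the first variation: the polynomial has a minimum at t = 0, where its derivative is `A`.
Degree four suffices because the potentials are quartic. -/
theorem linear_coeff_eq_zero_of_nonneg {A B C D : ℝ}
    (h : ∀ t : ℝ, 0 ≤ t * A + t ^ 2 * B + t ^ 3 * C + t ^ 4 * D) : A = 0 := by
  have hmin : IsLocalMin (fun t : ℝ => t * A + t ^ 2 * B + t ^ 3 * C + t ^ 4 * D) 0 :=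
    Filter.Eventually.of_forall fun t => by simpa using h t
  have hd : HasDerivAt (fun t : ℝ => t * A + t ^ 2 * B + t ^ 3 * C + t ^ 4 * D)
      (1 * A + (((2 : ℕ) : ℝ) * 0 ^ 1 * 1) * B + (((3 : ℕ) : ℝ) * 0 ^ 2 * 1) * C
        + (((4 : ℕ) : ℝ) * 0 ^ 3 * 1) * D) 0 :=
    ((((hasDerivAt_id (0 : ℝ)).mul_const A).add (((hasDerivAt_id (0 : ℝ)).pow 2).mul_const B)).add
      (((hasDerivAt_id (0 : ℝ)).pow 3).mul_const C)).add
      (((hasDerivAt_id (0 : ℝ)).pow 4).mul_const D)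
  have := hmin.hasDerivAt_eq_zero hd
  simpa using this

theorem hasDerivAt_primitive {q : ℝ → ℝ} {a b : ℝ} (hq : ContinuousOn q (Icc a b)) {x : ℝ}
    (hx : x ∈ Ioo a b) : HasDerivAt (fun r => ∫ s in a..r, q s) (q x) x := by
  refine intervalIntegral.integral_hasDerivAt_right ?_ ?_ ?_
  · refine ContinuousOn.intervalIntegrable ?_
    rw [uIcc_of_le hx.1.le]
    exact hq.mono (Icc_subset_Icc_right hx.2.le)
  · exact ContinuousOn.stronglyMeasurableAtFilter isOpen_Ioo (hq.mono Ioo_subset_Icc_self) x hx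
  · exact hq.continuousAt (Icc_mem_nhds hx.1 hx.2)

theorem ae_eq_deriv_primitive {h : ℝ → ℝ} {a b c : ℝ} (hab : a ≤ b) (hc : c ∈ Icc a b)
    (hh : IntervalIntegrable h volume a b) :
    ∀ᵐ x, x ∈ Icc a b → HasDerivAt (fun r => ∫ s in c..r, h s) (h x) x := by
  rw [← uIcc_of_le hab] at hc ⊢
  filter_upwards [hh.ae_hasDerivAt_integral] with x hx hm using hx hm c hc

theorem AbsolutelyContinuousOnInterval_congr {f g : ℝ → ℝ} {a b : ℝ}
    (hf : AbsolutelyContinuousOnInterval f a b) (h : EqOn f g (uIcc a b)) :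
    AbsolutelyContinuousOnInterval g a b := by
  rw [absolutelyContinuousOnInterval_iff] at hf ⊢
  intro ε hε
  obtain ⟨δ, hδ, H⟩ := hf ε hε
  refine ⟨δ, hδ, fun E hE hlt => ?_⟩
  refine lt_of_eq_of_lt (Finset.sum_congr rfl fun i hi => ?_) (H E hE hlt)
  rw [h (hE.1 i hi).1, h (hE.1 i hi).2]

theorem AbsolutelyContinuousOnInterval_lipschitz_comp {T f : ℝ → ℝ} {a b : ℝ}
    (hT : LipschitzWith 1 T) (hf : AbsolutelyContinuousOnInterval f a b) :
    AbsolutelyContinuousOnInterval (fun x => T (f x)) a b := by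
  rw [absolutelyContinuousOnInterval_iff] at hf ⊢
  intro ε hε
  obtain ⟨δ, hδ, H⟩ := hf ε hε
  refine ⟨δ, hδ, fun E hE hlt => (Finset.sum_le_sum fun i _ => ?_).trans_lt (H E hE hlt)⟩
  simpa using hT.dist_le_mul (f (E.2 i).1) (f (E.2 i).2)

theorem abs_deriv_lipschitz_comp_le {T f : ℝ → ℝ} {x : ℝ} (hT : LipschitzWith 1 T)
    (hf : DifferentiableAt ℝ f x) : |deriv (fun y => T (f y)) x| ≤ |deriv f x| := by
  by_cases hd : DifferentiableAt ℝ (fun y => T (f y)) x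
  · have h1 := (hasDerivAt_iff_tendsto_slope.1 hd.hasDerivAt).abs
    have h2 := (hasDerivAt_iff_tendsto_slope.1 hf.hasDerivAt).abs
    refine le_of_tendsto_of_tendsto' h1 h2 fun y => ?_
    rw [slope_def_field, slope_def_field, abs_div, abs_div]
    have := hT.dist_le_mul (f y) (f x)
    rw [Real.dist_eq, Real.dist_eq] at this
    refine div_le_div_of_nonneg_right ?_ (abs_nonneg _)
    simpa using this
  -- Where the composition is not differentiable, its `deriv` is 0 by convention and the bound is
  -- trivial.
  · rw [deriv_zero_of_not_differentiableAt hd]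
    simp

/-- First variation and regularity for the one-dimensional functional
`∫ p g'² + c₁ g² + c₂ g⁴`: a minimizer among its perturbations with support in `[a, b]` is a
classical solution of `(p g')' = c₁ g + 2 c₂ g³` in the interior. -/
theorem euler_lagrange_of_minimal {p c₁ c₂ g : ℝ → ℝ} {a b : ℝ} (hab : a < b)
    (hp : ContinuousOn p (Icc a b)) (hp0 : ∀ x ∈ Icc a b, 0 < p x)
    (hc₁ : ContinuousOn c₁ (Icc a b)) (hc₂ : ContinuousOn c₂ (Icc a b))
    (hg : AbsolutelyContinuousOnInterval g a b)
    (hint : IntervalIntegrable (fun r => p r * deriv g r ^ 2) volume a b)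
    (hmin : ∀ φ : ℝ → ℝ, (∀ x, x ∉ Ioo a b → φ x = 0) →
      (∀ c d, AbsolutelyContinuousOnInterval φ c d) →
      IntervalIntegrable (fun r => p r * ((deriv g r + deriv φ r) ^ 2 - deriv g r ^ 2)
        + c₁ r * ((g r + φ r) ^ 2 - g r ^ 2) + c₂ r * ((g r + φ r) ^ 4 - g r ^ 4)) volume a b →
      0 ≤ ∫ r in a..b, (p r * ((deriv g r + deriv φ r) ^ 2 - deriv g r ^ 2)
        + c₁ r * ((g r + φ r) ^ 2 - g r ^ 2) + c₂ r * ((g r + φ r) ^ 4 - g r ^ 4))) :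
    ∀ r ∈ Ioo a b, DifferentiableAt ℝ g r ∧
      HasDerivAt (fun r => p r * deriv g r) (c₁ r * g r + 2 * c₂ r * g r ^ 3) r := by
  have hu : uIcc a b = Icc a b := uIcc_of_le hab.le
  have hgc : ContinuousOn g (Icc a b) := by simpa [hu] using hg.continuousOn
  set q : ℝ → ℝ := fun r => c₁ r * g r + 2 * c₂ r * g r ^ 3 with hq
  have hqc : ContinuousOn q (Icc a b) := by fun_prop
  set Q : ℝ → ℝ := fun r => ∫ s in a..r, q s with hQ
  have hqi : IntervalIntegrable q volume a b := (hu ▸ hqc).intervalIntegrable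
  have hQac : AbsolutelyContinuousOnInterval Q a b :=
    hqi.absolutelyContinuousOnInterval_intervalIntegral left_mem_uIcc
  have hQc : ContinuousOn Q (Icc a b) := by simpa [hu] using hQac.continuousOn
  have hQd : ∀ x ∈ Ioo a b, HasDerivAt Q (q x) x := fun x hx => hasDerivAt_primitive hqc hx
  have hgi : IntervalIntegrable (deriv g) volume a b := hg.intervalIntegrable_deriv
  have hpu : ContinuousOn p (uIcc a b) := hu ▸ hp
  have hpgi : IntervalIntegrable (fun r => p r * deriv g r) volume a b :=
    hgi.continuousOn_mul hpu
  have hQi : IntervalIntegrable Q volume a b := (hu ▸ hQc).intervalIntegrable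
  -- Du Bois-Reymond: `c` is the mean of p g' - Q, so `h` = p g' - Q - c has mean zero and its
  -- primitive vanishes at both ends. That primitive is the test function.
  set c : ℝ := (∫ r in a..b, (p r * deriv g r - Q r)) / (b - a) with hc
  set k : ℝ → ℝ := fun r => Q r + c with hk
  have hkc : ContinuousOn k (uIcc a b) := hu ▸ (hQc.add continuousOn_const)
  set h : ℝ → ℝ := fun r => p r * deriv g r - k r with hh
  have hhi : IntervalIntegrable h volume a b := hpgi.sub hkc.intervalIntegrable
  have hmean : ∫ r in a..b, h r = 0 := by
    have e : h = fun r => (p r * deriv g r - Q r) - c := by ext r; simp [hh, hk]; ring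
    rw [e, intervalIntegral.integral_sub (hpgi.sub hQi) intervalIntegrable_const,
      intervalIntegral.integral_const, hc, smul_eq_mul]
    field_simp [sub_ne_zero.2 hab.ne']
    ring
  -- Cutting `h` off outside the interval makes its primitive `φ` globally defined and zero outside
  -- (a, b).
  set H : ℝ → ℝ := (Ioc a b).indicator h with hH
  have hHint : Integrable H := by
    rw [hH, integrable_indicator_iff measurableSet_Ioc]
    exact (intervalIntegrable_iff_integrableOn_Ioc_of_le hab.le).1 hhi
  set φ : ℝ → ℝ := fun r => ∫ s in a..r, H s with hφ
  have hφac : ∀ c d, AbsolutelyContinuousOnInterval φ c d := by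
    intro c d
    have h1 : AbsolutelyContinuousOnInterval φ (min a (min c d)) (max a (max c d)) :=
      hHint.intervalIntegrable.absolutelyContinuousOnInterval_intervalIntegral (by
        rw [uIcc_of_le ((min_le_left _ _).trans (le_max_left _ _))]
        exact ⟨min_le_left _ _, le_max_left _ _⟩)
    refine h1.mono ?_
    rw [uIcc_of_le (a := min a _) ((min_le_left _ _).trans (le_max_left _ _))]
    exact Icc_subset_Icc (min_le_right _ _) (le_max_right _ _)
  have hHh : ∀ r ∈ Ioc a b, H r = h r := fun r hr => indicator_of_mem hr h
  have hφb : φ b = 0 := by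
    rw [← hmean]
    refine intervalIntegral.integral_congr_ae (Eventually.of_forall fun x hx => ?_)
    rw [uIoc_of_le hab.le] at hx
    exact hHh x hx
  have hφ0 : ∀ x, x ∉ Ioo a b → φ x = 0 := by
    intro x hx
    rcases le_or_gt x a with hxa | hxa
    · refine intervalIntegral.integral_zero_ae (Eventually.of_forall fun y hy => ?_)
      rw [uIoc_comm, uIoc_of_le hxa] at hy
      exact indicator_of_notMem (fun h' => by linarith [hy.2, h'.1]) _
    · have hbx : b ≤ x := by by_contra! h'; exact hx ⟨hxa, h'⟩
      have : φ x = φ b + ∫ s in b..x, H s :=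
        (intervalIntegral.integral_add_adjacent_intervals hHint.intervalIntegrable
          hHint.intervalIntegrable).symm
      rw [this, hφb, zero_add]
      refine intervalIntegral.integral_zero_ae (Eventually.of_forall fun y hy => ?_)
      rw [uIoc_of_le hbx] at hy
      exact indicator_of_notMem (fun h' => by linarith [hy.1, h'.2]) _
  have hφd : ∀ᵐ x, x ∈ uIoc a b → deriv φ x = h x := by
    filter_upwards [ae_eq_deriv_primitive hab.le (left_mem_Icc.2 hab.le)
      hHint.intervalIntegrable (h := H)] with x hx hxm
    rw [uIoc_of_le hab.le] at hxm
    rw [(hx (Ioc_subset_Icc_self hxm)).deriv, hHh x hxm]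
  have hφc : ContinuousOn φ (uIcc a b) := (hφac a b).continuousOn
  -- integrability of the quadratic expressions in `h`
  have hppg : IntervalIntegrable (fun r => p r * (p r * deriv g r ^ 2)) volume a b :=
    hint.continuousOn_mul hpu
  have hpkg : IntervalIntegrable (fun r => p r * k r * deriv g r) volume a b :=
    hgi.continuousOn_mul (hpu.mul hkc)
  have hpgh : IntervalIntegrable (fun r => p r * deriv g r * h r) volume a b := by
    refine (hppg.sub hpkg).congr_ae ?_
    refine Eventually.of_forall fun r => ?_
    simp only [hh]; ring
  have hph2 : IntervalIntegrable (fun r => p r * h r ^ 2) volume a b := by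
    have h1 : IntervalIntegrable (fun r => p r ^ 2 * (p r * deriv g r ^ 2)) volume a b :=
      hint.continuousOn_mul (hpu.pow 2)
    have h2 : IntervalIntegrable (fun r => (2 * p r ^ 2 * k r) * deriv g r) volume a b :=
      hgi.continuousOn_mul ((continuousOn_const.mul (hpu.pow 2)).mul hkc)
    have h3 : IntervalIntegrable (fun r => p r * k r ^ 2) volume a b :=
      (hpu.mul (hkc.pow 2)).intervalIntegrable
    refine ((h1.sub h2).add h3).congr_ae ?_
    refine Eventually.of_forall fun r => ?_
    simp only [hh]; ring
  have hφd' : ∀ᵐ x ∂volume.restrict (uIoc a b), deriv φ x = h x :=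
    (ae_restrict_iff' measurableSet_uIoc).2 hφd
  have hgu : ContinuousOn g (uIcc a b) := hu ▸ hgc
  have hc₁u : ContinuousOn c₁ (uIcc a b) := hu ▸ hc₁
  have hc₂u : ContinuousOn c₂ (uIcc a b) := hu ▸ hc₂
  have hqu : ContinuousOn q (uIcc a b) := hu ▸ hqc
  -- The energy difference along `t * φ` is a quartic in t without constant term. Its linear
  -- coefficient, the first variation in the direction `φ`, must vanish.
  have hlin : (∫ r in a..b, (2 * (p r * deriv g r * h r) + 2 * (q r * φ r))) = 0 := by
    have hA : IntervalIntegrable (fun r => 2 * (p r * deriv g r * h r) + 2 * (q r * φ r))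
        volume a b := (hpgh.const_mul 2).add ((hqu.mul hφc).intervalIntegrable.const_mul 2)
    have hB : IntervalIntegrable
        (fun r => p r * h r ^ 2 + (c₁ r + 6 * c₂ r * g r ^ 2) * φ r ^ 2) volume a b :=
      hph2.add (ContinuousOn.intervalIntegrable (by fun_prop))
    have hC : IntervalIntegrable (fun r => 4 * c₂ r * g r * φ r ^ 3) volume a b :=
      ContinuousOn.intervalIntegrable (by fun_prop)
    have hD : IntervalIntegrable (fun r => c₂ r * φ r ^ 4) volume a b :=
      ContinuousOn.intervalIntegrable (by fun_prop)
    refine linear_coeff_eq_zero_of_nonneg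
      (B := ∫ r in a..b, (p r * h r ^ 2 + (c₁ r + 6 * c₂ r * g r ^ 2) * φ r ^ 2))
      (C := ∫ r in a..b, 4 * c₂ r * g r * φ r ^ 3) (D := ∫ r in a..b, c₂ r * φ r ^ 4) fun t => ?_
    have hdt : deriv (fun x => t * φ x) = fun x => t * deriv φ x := by
      ext x; exact deriv_const_mul_field t
    have hsum := (((hA.const_mul t).add (hB.const_mul (t ^ 2))).add (hC.const_mul (t ^ 3))).add
      (hD.const_mul (t ^ 4))
    have hexp : (fun r => t * (2 * (p r * deriv g r * h r) + 2 * (q r * φ r))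
          + t ^ 2 * (p r * h r ^ 2 + (c₁ r + 6 * c₂ r * g r ^ 2) * φ r ^ 2)
          + t ^ 3 * (4 * c₂ r * g r * φ r ^ 3) + t ^ 4 * (c₂ r * φ r ^ 4))
        =ᵐ[volume.restrict (uIoc a b)] fun r =>
        p r * ((deriv g r + deriv (fun x => t * φ x) r) ^ 2 - deriv g r ^ 2)
          + c₁ r * ((g r + t * φ r) ^ 2 - g r ^ 2) + c₂ r * ((g r + t * φ r) ^ 4 - g r ^ 4) := by
      filter_upwards [hφd'] with r hr
      rw [hdt]
      simp only [hr, hq]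
      ring
    have h0 := hmin (fun x => t * φ x) (fun x hx => by simp [hφ0 x hx])
      (fun c d => (hφac c d).const_mul t) (hsum.congr_ae hexp)
    rw [intervalIntegral.integral_congr_ae_restrict hexp.symm] at h0
    refine h0.trans_eq ?_
    rw [← intervalIntegral.integral_const_mul, ← intervalIntegral.integral_const_mul,
      ← intervalIntegral.integral_const_mul, ← intervalIntegral.integral_const_mul,
      ← intervalIntegral.integral_add (hA.const_mul t) (hB.const_mul _),
      ← intervalIntegral.integral_add ((hA.const_mul t).add (hB.const_mul _)) (hC.const_mul _),
      ← intervalIntegral.integral_add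
        (((hA.const_mul t).add (hB.const_mul _)).add (hC.const_mul _)) (hD.const_mul _)]
  have hparts : ∫ r in a..b, q r * φ r = -∫ r in a..b, Q r * h r := by
    have h1 := hQac.integral_mul_deriv_eq_deriv_mul (hφac a b)
    rw [hφb, hφ0 a (fun h' => lt_irrefl _ h'.1)] at h1
    have h2 : ∫ r in a..b, Q r * deriv φ r = ∫ r in a..b, Q r * h r :=
      intervalIntegral.integral_congr_ae (by
        filter_upwards [hφd] with r hr hrm; rw [hr hrm])
    have h3 : ∫ r in a..b, deriv Q r * φ r = ∫ r in a..b, q r * φ r := by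
      refine intervalIntegral.integral_congr_ae ?_
      have hb' : ∀ᵐ r : ℝ, r ≠ b := by simp [ae_iff]
      filter_upwards [hb'] with r hr hrm
      rw [uIoc_of_le hab.le] at hrm
      rw [(hQd r ⟨hrm.1, lt_of_le_of_ne hrm.2 hr⟩).deriv]
    rw [h2, h3] at h1
    linarith
  have hQh : IntervalIntegrable (fun r => Q r * h r) volume a b :=
    hhi.continuousOn_mul (hu ▸ hQc)
  -- After integration by parts the first variation reads ∫ (p g' - Q) h = 0, and the constant `c`
  -- may be subtracted from the first factor because `h` has mean zero.
  have hsq : ∫ r in a..b, h r ^ 2 = 0 := by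
    have hqφ : IntervalIntegrable (fun r => q r * φ r) volume a b :=
      (hqu.mul hφc).intervalIntegrable
    rw [intervalIntegral.integral_add (hpgh.const_mul 2) (hqφ.const_mul 2), intervalIntegral.integral_const_mul,
      intervalIntegral.integral_const_mul, hparts] at hlin
    have e : (fun r => h r ^ 2) = fun r => (p r * deriv g r * h r - Q r * h r) - c * h r := by
      ext r; simp only [hh, hk]; ring
    rw [e, intervalIntegral.integral_sub (hpgh.sub hQh) (hhi.const_mul c),
      intervalIntegral.integral_sub hpgh hQh, intervalIntegral.integral_const_mul, hmean]
    linarith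
  have hh2i : IntervalIntegrable (fun r => h r ^ 2) volume a b := by
    have h1 : IntervalIntegrable (fun r => (p r)⁻¹ * (p r * h r ^ 2)) volume a b :=
      hph2.continuousOn_mul (hpu.inv₀ fun x hx => (hp0 x (hu ▸ hx)).ne')
    refine h1.congr_ae ?_
    filter_upwards [ae_restrict_mem measurableSet_uIoc] with r hr
    rw [uIoc_of_le hab.le] at hr
    rw [← mul_assoc, inv_mul_cancel₀ (hp0 r (Ioc_subset_Icc_self hr)).ne', one_mul]
  have hae : ∀ᵐ r ∂volume.restrict (Ioc a b), h r = 0 := by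
    rw [intervalIntegral.integral_of_le hab.le] at hsq
    have := (integral_eq_zero_iff_of_nonneg (fun r => sq_nonneg (h r))
      ((intervalIntegrable_iff_integrableOn_Ioc_of_le hab.le).1 hh2i)).1 hsq
    filter_upwards [this] with r hr
    simpa using hr
  -- Regularity: g' equals the continuous function (Q + c)/p almost everywhere. Hence g is its
  -- primitive, and p g' = Q + c holds everywhere inside, with derivative `q`.
  set d : ℝ → ℝ := fun r => k r / p r with hd
  have hdc : ContinuousOn d (Icc a b) := by
    rw [← hu]
    exact hkc.div hpu fun x hx => (hp0 x (hu ▸ hx)).ne'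
  have hgd : ∀ r ∈ Icc a b, g r = g a + ∫ s in a..r, d s := by
    intro r hr
    have h1 := (hg.mono (c := a) (d := r) (by
      rw [hu, uIcc_of_le hr.1]; exact Icc_subset_Icc_right hr.2)).integral_deriv_eq_sub
    have h2 : ∫ s in a..r, deriv g s = ∫ s in a..r, d s := by
      refine intervalIntegral.integral_congr_ae ?_
      filter_upwards [(ae_restrict_iff' measurableSet_Ioc).1 hae] with s hs hsm
      rw [uIoc_of_le hr.1] at hsm
      have hs1 : s ∈ Ioc a b := ⟨hsm.1, hsm.2.trans hr.2⟩
      have := hs hs1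
      have hps := hp0 s (Ioc_subset_Icc_self hs1)
      simp only [hd]
      rw [eq_div_iff hps.ne']
      simp only [hh] at this
      linarith
    linarith
  have hgder : ∀ r ∈ Ioo a b, HasDerivAt g (d r) r := by
    intro r hr
    refine ((hasDerivAt_primitive hdc hr).const_add (g a)).congr_of_eventuallyEq ?_
    filter_upwards [Icc_mem_nhds hr.1 hr.2] with s hs using hgd s hs
  intro r hr
  refine ⟨(hgder r hr).differentiableAt, ?_⟩
  refine ((hQd r hr).add_const c).congr_of_eventuallyEq ?_
  filter_upwards [isOpen_Ioo.mem_nhds hr] with s hs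
  rw [(hgder s hs).deriv]
  simp only [hd]
  rw [mul_div_cancel₀ _ (hp0 s (Ioo_subset_Icc_self hs)).ne']

end

/-! ### The energy and its Euler-Lagrange equations -/

section

/-- Absolute continuity on every compact subinterval of `(0, ∞)`. -/
def LocallyAC (u : ℝ → ℝ) : Prop :=
  ∀ a b : ℝ, 0 < a → a ≤ b → AbsolutelyContinuousOnInterval u a b

theorem LocallyAC.continuousOn {u : ℝ → ℝ} (hu : LocallyAC u) : ContinuousOn u (Ioi 0) := by
  intro x hx
  have hx0 : (0 : ℝ) < x := hx
  have h := (hu (x / 2) (2 * x) (by linarith) (by linarith)).continuousOn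
  rw [uIcc_of_le (by linarith)] at h
  exact (h.continuousAt (Icc_mem_nhds (by linarith) (by linarith))).continuousWithinAt

/-- The half-line is the countable union of the intervals [1/(n+1), n+1]. -/
theorem ae_restrict_Ioi_of_forall_Icc {P : ℝ → Prop}
    (h : ∀ a b : ℝ, 0 < a → a ≤ b → ∀ᵐ r : ℝ, r ∈ Icc a b → P r) :
    ∀ᵐ r ∂volume.restrict (Ioi (0 : ℝ)), P r := by
  have h' : ∀ n : ℕ, ∀ᵐ r : ℝ, r ∈ Icc (1 / ((n : ℝ) + 1)) (n + 1) → P r := by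
    intro n
    refine h _ _ (by positivity) ?_
    rw [div_le_iff₀ (by positivity)]
    nlinarith [(Nat.cast_nonneg n : (0 : ℝ) ≤ n)]
  rw [ae_restrict_iff' measurableSet_Ioi]
  filter_upwards [ae_all_iff.2 h'] with r hr hr0
  have hr0' : (0 : ℝ) < r := hr0
  obtain ⟨n, hn⟩ := exists_nat_gt (max r (1 / r))
  refine hr n ⟨?_, ?_⟩
  · rw [div_le_comm₀ (by positivity) hr0']
    linarith [le_max_right r (1 / r)]
  · linarith [le_max_left r (1 / r)]

theorem LocallyAC.ae_differentiableAt {u : ℝ → ℝ} (hu : LocallyAC u) :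
    ∀ᵐ r ∂volume.restrict (Ioi (0 : ℝ)), DifferentiableAt ℝ u r :=
  ae_restrict_Ioi_of_forall_Icc fun a b ha hab => by
    have := (hu a b ha hab).ae_differentiableAt
    rwa [uIcc_of_le hab] at this

theorem LocallyAC.add {u v : ℝ → ℝ} (hu : LocallyAC u) (hv : LocallyAC v) :
    LocallyAC (fun r => u r + v r) := fun a b ha hab => (hu a b ha hab).fun_add (hv a b ha hab)

theorem LocallyAC.lipschitz_comp {T u : ℝ → ℝ} (hT : LipschitzWith 1 T) (hu : LocallyAC u) :
    LocallyAC (fun r => T (u r)) :=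
  fun a b ha hab => AbsolutelyContinuousOnInterval_lipschitz_comp hT (hu a b ha hab)

theorem energyDensity_nonneg {α β γ : ℝ} (hα : 0 ≤ α) (hβ : 0 ≤ β) (hγ : 0 ≤ γ) (u f : ℝ → ℝ)
    (r : ℝ) : 0 ≤ energyDensity α β γ u f r := by
  unfold energyDensity
  positivity

theorem aemeasurable_energyDensity {α β γ : ℝ} {u f : ℝ → ℝ} (hu : LocallyAC u)
    (hf : LocallyAC f) :
    AEMeasurable (energyDensity α β γ u f) (volume.restrict (Ioi 0)) := by
  have h1 : AEMeasurable u (volume.restrict (Ioi 0)) := hu.continuousOn.aemeasurable measurableSet_Ioi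
  have h2 : AEMeasurable f (volume.restrict (Ioi 0)) := hf.continuousOn.aemeasurable measurableSet_Ioi
  have h3 : Measurable (deriv u) := measurable_deriv u
  have h4 : Measurable (deriv f) := measurable_deriv f
  unfold energyDensity
  fun_prop

theorem integrableOn_energyDensity {α β γ : ℝ} {u f : ℝ → ℝ} (hα : 0 ≤ α) (hβ : 0 ≤ β)
    (hγ : 0 ≤ γ) (hu : LocallyAC u) (hf : LocallyAC f) (h : energy α β γ u f < ⊤) :
    IntegrableOn (energyDensity α β γ u f) (Ioi 0) := by
  refine ⟨(aemeasurable_energyDensity hu hf).aestronglyMeasurable, ?_⟩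
  rw [hasFiniteIntegral_iff_ofReal
    (Eventually.of_forall fun r => energyDensity_nonneg hα hβ hγ u f r)]
  exact h

theorem energy_eq_ofReal_integral {α β γ : ℝ} {u f : ℝ → ℝ} (hα : 0 ≤ α) (hβ : 0 ≤ β)
    (hγ : 0 ≤ γ) (h : IntegrableOn (energyDensity α β γ u f) (Ioi 0)) :
    energy α β γ u f = ENNReal.ofReal (∫ r in Ioi (0 : ℝ), energyDensity α β γ u f r) :=
  (ofReal_integral_eq_lintegral_ofReal h
    (Eventually.of_forall fun r => energyDensity_nonneg hα hβ hγ u f r)).symm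

/-- The individual terms of an energy density of finite energy are integrable. -/
theorem integrableOn_energy_terms {α β γ : ℝ} {u f : ℝ → ℝ} (hα : 0 < α) (hβ : 0 < β)
    (hγ : 0 ≤ γ) (hu : ContinuousOn u (Ioi 0)) (hf : ContinuousOn f (Ioi 0))
    (h : energy α β γ u f < ⊤) :
    IntegrableOn (fun r => deriv u r ^ 2) (Ioi 0) ∧
    IntegrableOn (fun r => (1 - u r ^ 2) ^ 2 / r ^ 2) (Ioi 0) ∧
    IntegrableOn (fun r => r ^ 2 * deriv f r ^ 2) (Ioi 0) ∧
    IntegrableOn (fun r => f r ^ 2 * u r ^ 2) (Ioi 0) := by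
  have h1 : AEMeasurable u (volume.restrict (Ioi 0)) := hu.aemeasurable measurableSet_Ioi
  have h2 : AEMeasurable f (volume.restrict (Ioi 0)) := hf.aemeasurable measurableSet_Ioi
  have h3 : Measurable (deriv u) := measurable_deriv u
  have h4 : Measurable (deriv f) := measurable_deriv f
  have hm : AEMeasurable (energyDensity α β γ u f) (volume.restrict (Ioi 0)) := by
    unfold energyDensity
    fun_prop
  have hi : IntegrableOn (energyDensity α β γ u f) (Ioi 0) := by
    refine ⟨hm.aestronglyMeasurable, ?_⟩
    rw [hasFiniteIntegral_iff_ofReal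
      (Eventually.of_forall fun r => energyDensity_nonneg hα.le hβ.le hγ u f r)]
    exact h
  have key : ∀ (F : ℝ → ℝ) (C : ℝ), 0 < C → AEMeasurable F (volume.restrict (Ioi 0)) →
      (∀ r, 0 ≤ F r ∧ C * F r ≤ energyDensity α β γ u f r) → IntegrableOn F (Ioi 0) := by
    intro F C hC hF hle
    refine Integrable.mono' (g := fun r => C⁻¹ * energyDensity α β γ u f r)
      (Integrable.const_mul hi C⁻¹) hF.aestronglyMeasurable ?_
    refine Eventually.of_forall fun r => ?_
    rw [Real.norm_of_nonneg (hle r).1, ← div_eq_inv_mul, le_div_iff₀ hC, mul_comm]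
    exact (hle r).2
  have hpos : ∀ r : ℝ, 0 ≤ 2 * deriv u r ^ 2 ∧ 0 ≤ (1 - u r ^ 2) ^ 2 / r ^ 2 ∧
      0 ≤ α * (r ^ 2 * deriv f r ^ 2) ∧ 0 ≤ α * (β * f r ^ 2 * u r ^ 2) ∧
      0 ≤ α * γ / 2 * r ^ 2 * (f r ^ 2 - 1) ^ 2 := fun r =>
    ⟨by positivity, by positivity, by positivity, by positivity, by positivity⟩
  refine ⟨key _ 2 two_pos (by fun_prop) fun r => ⟨by positivity, ?_⟩,
    key _ 1 one_pos (by fun_prop) fun r => ⟨by positivity, ?_⟩,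
    key _ α hα (by fun_prop) fun r => ⟨by positivity, ?_⟩,
    key _ (α * β) (by positivity) (by fun_prop) fun r => ⟨by positivity, ?_⟩⟩ <;>
  · obtain ⟨p1, p2, p3, p4, p5⟩ := hpos r
    unfold energyDensity
    linarith

/-- Energies are compared as extended nonnegative numbers, whereas the first variation needs a real
difference. As the densities agree off [a, b] and `e₀` is integrable, so is `e₁`, and subtraction is
legitimate. -/
theorem integral_diff_nonneg {e₀ e₁ : ℝ → ℝ} {a b : ℝ} (ha : 0 < a) (hab : a ≤ b)
    (h0 : ∀ r, 0 ≤ e₀ r) (h1 : ∀ r, 0 ≤ e₁ r) (hi : IntegrableOn e₀ (Ioi 0))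
    (hle : ∫⁻ r in Ioi (0 : ℝ), ENNReal.ofReal (e₀ r) ≤ ∫⁻ r in Ioi (0 : ℝ), ENNReal.ofReal (e₁ r))
    (hoff : ∀ r, r ∉ Icc a b → e₁ r = e₀ r)
    (hd : IntervalIntegrable (fun r => e₁ r - e₀ r) volume a b) :
    0 ≤ ∫ r in a..b, (e₁ r - e₀ r) := by
  have hd' : IntegrableOn (fun r => e₁ r - e₀ r) (Icc a b) := by
    rw [integrableOn_Icc_iff_integrableOn_Ioc]
    exact (intervalIntegrable_iff_integrableOn_Ioc_of_le hab).1 hd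
  have hind : (fun r => e₁ r - e₀ r) = (Icc a b).indicator (fun r => e₁ r - e₀ r) := by
    ext r
    by_cases hr : r ∈ Icc a b
    · rw [indicator_of_mem hr]
    · rw [indicator_of_notMem hr, hoff r hr, sub_self]
  have hdI : Integrable (fun r => e₁ r - e₀ r) := by
    rw [hind, integrable_indicator_iff measurableSet_Icc]
    exact hd'
  have hi1 : IntegrableOn e₁ (Ioi 0) := by
    have := hi.add hdI.integrableOn
    refine this.congr (Eventually.of_forall fun r => ?_)
    simp
  rw [← ofReal_integral_eq_lintegral_ofReal hi (Eventually.of_forall h0),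
    ← ofReal_integral_eq_lintegral_ofReal hi1 (Eventually.of_forall h1),
    ENNReal.ofReal_le_ofReal_iff (integral_nonneg h1)] at hle
  have h2 : ∫ r in Ioi (0 : ℝ), (e₁ r - e₀ r) = ∫ r in a..b, (e₁ r - e₀ r) := by
    rw [intervalIntegral.integral_of_le hab, ← integral_Icc_eq_integral_Ioc]
    rw [hind, setIntegral_indicator measurableSet_Icc, inter_eq_right.2, ← hind]
    exact fun r hr => ha.trans_le hr.1
  rw [integral_sub hi1 hi] at h2
  linarith

/-- Pairs of finite energy that minimize the energy among their compactly supported absolutely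
continuous perturbations. -/
structure IsCompactlyMinimal (α β γ : ℝ) (u f : ℝ → ℝ) : Prop where
  finite_energy : energy α β γ u f < ⊤
  ac_u : LocallyAC u
  ac_f : LocallyAC f
  le_energy : ∀ (φ ψ : ℝ → ℝ) (a b : ℝ), 0 < a → a < b → (∀ x, x ∉ Ioo a b → φ x = 0) →
    (∀ x, x ∉ Ioo a b → ψ x = 0) → (∀ c d, AbsolutelyContinuousOnInterval φ c d) →
    (∀ c d, AbsolutelyContinuousOnInterval ψ c d) →
    energy α β γ u f ≤ energy α β γ (fun r => u r + φ r) (fun r => f r + ψ r)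

theorem deriv_add_of_support {v φ : ℝ → ℝ} {a b r : ℝ} (h : ∀ x, x ∉ Ioo a b → φ x = 0)
    (hr : r ∉ Icc a b) : deriv (fun x => v x + φ x) r = deriv v r := by
  refine Filter.EventuallyEq.deriv_eq ?_
  filter_upwards [isClosed_Icc.isOpen_compl.mem_nhds hr] with x hx
  rw [h x fun hx' => hx (Ioo_subset_Icc_self hx'), add_zero]

theorem ae_deriv_add {v φ : ℝ → ℝ} (hv : LocallyAC v)
    (hφ : ∀ c d, AbsolutelyContinuousOnInterval φ c d) :
    ∀ᵐ r ∂volume.restrict (Ioi (0 : ℝ)), deriv (fun x => v x + φ x) r = deriv v r + deriv φ r := by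
  have hφ' : LocallyAC φ := fun a b _ _ => hφ a b
  filter_upwards [hv.ae_differentiableAt, hφ'.ae_differentiableAt] with r h1 h2
  exact deriv_fun_add h1 h2

/-- With the other profile frozen, the energy is of the form ∫ p g'² + c₁ g² + c₂ g⁴ up to terms
independent of g. It has p = 2 and c₂ = 1/r² for u, and p = α r² and c₂ = αγ r²/2 for f. -/
theorem IsCompactlyMinimal.solvesEulerLagrange {α β γ : ℝ} {u f : ℝ → ℝ} (hα : 0 < α)
    (hβ : 0 < β) (hγ : 0 ≤ γ) (h : IsCompactlyMinimal α β γ u f) :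
    SolvesEulerLagrange α β γ u f := by
  obtain ⟨hu2, -, hf2, -⟩ := integrableOn_energy_terms hα hβ hγ h.ac_u.continuousOn
    h.ac_f.continuousOn h.finite_energy
  have hi := integrableOn_energyDensity hα.le hβ.le hγ h.ac_u h.ac_f h.finite_energy
  have hcu := h.ac_u.continuousOn
  have hcf := h.ac_f.continuousOn
  have hAC0 : ∀ c d : ℝ, AbsolutelyContinuousOnInterval (fun _ => (0 : ℝ)) c d := fun c d =>
    (LipschitzWith.const (0 : ℝ)).lipschitzOnWith.absolutelyContinuousOnInterval
  have key : ∀ a b : ℝ, 0 < a → a < b → ∀ r ∈ Ioo a b,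
      (DifferentiableAt ℝ u r ∧ HasDerivAt (fun r => 2 * deriv u r)
        ((α * β * f r ^ 2 - 2 / r ^ 2) * u r + 2 * (1 / r ^ 2) * u r ^ 3) r) ∧
      (DifferentiableAt ℝ f r ∧ HasDerivAt (fun r => α * r ^ 2 * deriv f r)
        ((α * β * u r ^ 2 - α * γ * r ^ 2) * f r + 2 * (α * γ / 2 * r ^ 2) * f r ^ 3) r) := by
    intro a b ha hab r hr
    have hsub : Icc a b ⊆ Ioi 0 := fun x hx => ha.trans_le hx.1
    have hsub' : uIoc a b ⊆ Ioi 0 := by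
      rw [uIoc_of_le hab.le]; exact Ioc_subset_Icc_self.trans hsub
    have hcu' := hcu.mono hsub
    have hcf' := hcf.mono hsub
    have hne : ∀ x ∈ Icc a b, x ^ 2 ≠ 0 := fun x hx => (pow_pos (hsub hx) 2).ne'
    have hii : ∀ F : ℝ → ℝ, IntegrableOn F (Ioi 0) → IntervalIntegrable F volume a b := by
      intro F hF
      rw [intervalIntegrable_iff]
      exact hF.mono_set hsub'
    constructor
    · refine euler_lagrange_of_minimal (p := fun _ => 2) (c₂ := fun r => 1 / r ^ 2)
        (c₁ := fun r => α * β * f r ^ 2 - 2 / r ^ 2) hab continuousOn_const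
        (fun _ _ => two_pos) (by fun_prop (disch := assumption))
        (by fun_prop (disch := assumption)) (h.ac_u a b ha hab.le)
        ((hii _ hu2).const_mul 2) ?_ r hr
      intro φ hφ0 hφ hint
      have hle := h.le_energy φ (fun _ => 0) a b ha hab hφ0 (fun _ _ => rfl) hφ hAC0
      have hae : (fun r => 2 * ((deriv u r + deriv φ r) ^ 2 - deriv u r ^ 2)
          + (α * β * f r ^ 2 - 2 / r ^ 2) * ((u r + φ r) ^ 2 - u r ^ 2)
          + 1 / r ^ 2 * ((u r + φ r) ^ 4 - u r ^ 4)) =ᵐ[volume.restrict (uIoc a b)] fun r =>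
          energyDensity α β γ (fun r => u r + φ r) (fun r => f r + 0) r
            - energyDensity α β γ u f r := by
        filter_upwards [ae_restrict_of_ae_restrict_of_subset hsub' (ae_deriv_add h.ac_u hφ)]
          with r h1
        unfold energyDensity
        rw [h1]
        simp only [add_zero]
        ring
      rw [intervalIntegral.integral_congr_ae_restrict hae]
      refine integral_diff_nonneg ha hab.le (fun r => energyDensity_nonneg hα.le hβ.le hγ _ _ r)
        (fun r => energyDensity_nonneg hα.le hβ.le hγ _ _ r) hi hle ?_ (hint.congr_ae hae)
      intro r hr
      unfold energyDensity
      rw [deriv_add_of_support hφ0 hr]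
      simp [hφ0 r fun hx => hr (Ioo_subset_Icc_self hx)]
    · refine euler_lagrange_of_minimal (p := fun r => α * r ^ 2)
        (c₂ := fun r => α * γ / 2 * r ^ 2)
        (c₁ := fun r => α * β * u r ^ 2 - α * γ * r ^ 2) hab (by fun_prop)
        (fun x hx => mul_pos hα (pow_pos (hsub hx) 2)) (by fun_prop) (by fun_prop)
        (h.ac_f a b ha hab.le)
        (((hii _ hf2).const_mul α).congr_ae (Eventually.of_forall fun r => by
          simp only; ring)) ?_ r hr
      intro φ hφ0 hφ hint
      have hle := h.le_energy (fun _ => 0) φ a b ha hab (fun _ _ => rfl) hφ0 hAC0 hφ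
      have hae : (fun r => α * r ^ 2 * ((deriv f r + deriv φ r) ^ 2 - deriv f r ^ 2)
          + (α * β * u r ^ 2 - α * γ * r ^ 2) * ((f r + φ r) ^ 2 - f r ^ 2)
          + α * γ / 2 * r ^ 2 * ((f r + φ r) ^ 4 - f r ^ 4))
          =ᵐ[volume.restrict (uIoc a b)] fun r =>
          energyDensity α β γ (fun r => u r + 0) (fun r => f r + φ r) r
            - energyDensity α β γ u f r := by
        filter_upwards [ae_restrict_of_ae_restrict_of_subset hsub' (ae_deriv_add h.ac_f hφ)]
          with r h1
        unfold energyDensity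
        rw [h1]
        simp only [add_zero]
        ring
      rw [intervalIntegral.integral_congr_ae_restrict hae]
      refine integral_diff_nonneg ha hab.le (fun r => energyDensity_nonneg hα.le hβ.le hγ _ _ r)
        (fun r => energyDensity_nonneg hα.le hβ.le hγ _ _ r) hi hle ?_ (hint.congr_ae hae)
      intro r hr
      unfold energyDensity
      rw [deriv_add_of_support hφ0 hr]
      simp [hφ0 r fun hx => hr (Ioo_subset_Icc_self hx)]
  intro r hr
  obtain ⟨⟨h1, h2⟩, h3, h4⟩ := key (r / 2) (2 * r) (by linarith) (by linarith) r
    ⟨by linarith, by linarith⟩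
  have hr0 : r ≠ 0 := hr.ne'
  refine ⟨h1, h3, ?_, ?_⟩
  · refine ((h2.const_mul (1 / 2)).congr_of_eventuallyEq
      (Eventually.of_forall fun x => ?_)).congr_deriv ?_
    · simp only; ring
    · field_simp; ring
  -- The equation for f is known in divergence form; f'' is recovered by differentiating (α r²)⁻¹ ·
  -- (α r² f').
  · have h5 : HasDerivAt (fun x : ℝ => (α * x ^ 2)⁻¹) (-(α * (2 * r)) / (α * r ^ 2) ^ 2) r := by
      refine ((((hasDerivAt_id r).pow 2).const_mul α).fun_inv (by simp [hα.ne', hr0])).congr_deriv ?_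
      simp
    refine ((h5.mul h4).congr_of_eventuallyEq ?_).congr_deriv ?_
    · filter_upwards [isOpen_Ioi.mem_nhds hr] with x hx
      have hx0 : x ≠ 0 := ne_of_gt hx
      simp only [Pi.mul_apply]
      field_simp
    · field_simp
      ring

theorem tendsto_nhdsGT_zero_add_of_support {v χ : ℝ → ℝ} {a b l : ℝ} (ha : 0 < a)
    (hχ : ∀ x, x ∉ Ioo a b → χ x = 0) (hl : Tendsto v (𝓝[>] 0) (𝓝 l)) :
    Tendsto (fun r => v r + χ r) (𝓝[>] 0) (𝓝 l) := by
  refine hl.congr' ?_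
  filter_upwards [Ioc_mem_nhdsGT ha] with r hr
  rw [hχ r fun hx => not_lt.2 hr.2 hx.1, add_zero]

theorem tendsto_atTop_add_of_support {v χ : ℝ → ℝ} {a b l : ℝ}
    (hχ : ∀ x, x ∉ Ioo a b → χ x = 0) (hl : Tendsto v atTop (𝓝 l)) :
    Tendsto (fun r => v r + χ r) atTop (𝓝 l) := by
  refine hl.congr' ?_
  filter_upwards [eventually_gt_atTop b] with r hr
  rw [hχ r fun hx => not_lt.2 hr.le hx.2, add_zero]

/-- A perturbation supported away from 0 and ∞ keeps the boundary limits. If its energy is infinite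
there is nothing to compare. -/
theorem IsMinimizer.isCompactlyMinimal {α β γ : ℝ} {u f : ℝ → ℝ} (h : IsMinimizer α β γ u f) :
    IsCompactlyMinimal α β γ u f := by
  refine ⟨h.1.finite_energy, h.1.ac_u, h.1.ac_f, ?_⟩
  intro φ ψ a b ha hab hφ0 hψ0 hφ hψ
  by_cases hfin : energy α β γ (fun r => u r + φ r) (fun r => f r + ψ r) < ⊤
  · obtain ⟨b1, b2, b3, b4⟩ := h.1.boundary
    exact h.2 _ _ ⟨hfin, LocallyAC.add h.1.ac_u fun c d _ _ => hφ c d,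
      LocallyAC.add h.1.ac_f fun c d _ _ => hψ c d,
      ⟨tendsto_nhdsGT_zero_add_of_support ha hψ0 b1,
        tendsto_nhdsGT_zero_add_of_support ha hφ0 b2,
        tendsto_atTop_add_of_support hψ0 b3, tendsto_atTop_add_of_support hφ0 b4⟩⟩
  · rw [not_lt, top_le_iff] at hfin
    rw [hfin]
    exact le_top

/-- The truncation of a real number to `[0, 1]` in absolute value. -/
def trunc (x : ℝ) : ℝ := min |x| 1

theorem lipschitzWith_trunc : LipschitzWith 1 trunc := by
  refine LipschitzWith.of_dist_le_mul fun x y => ?_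
  rw [Real.dist_eq, Real.dist_eq, NNReal.coe_one, one_mul]
  unfold trunc
  exact (abs_min_sub_min_le_max |x| 1 |y| 1).trans (by
    simp [abs_abs_sub_abs_le_abs_sub x y])

theorem trunc_nonneg (x : ℝ) : 0 ≤ trunc x := le_min (abs_nonneg x) zero_le_one

theorem trunc_le_one (x : ℝ) : trunc x ≤ 1 := min_le_right _ _

theorem sq_trunc (x : ℝ) : trunc x ^ 2 = min (x ^ 2) 1 := by
  unfold trunc
  rcases le_total |x| 1 with h | h
  · rw [min_eq_left h, sq_abs, min_eq_left]
    rw [← sq_abs]; nlinarith [abs_nonneg x]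
  · rw [min_eq_right h, min_eq_right, one_pow]
    rw [← sq_abs]; nlinarith [abs_nonneg x]

theorem sq_one_sub_sq_trunc_le (x : ℝ) : (1 - trunc x ^ 2) ^ 2 ≤ (1 - x ^ 2) ^ 2 := by
  rw [sq_trunc]
  rcases le_total (x ^ 2) 1 with h | h
  · rw [min_eq_left h]
  · rw [min_eq_right h]; nlinarith [sq_nonneg (1 - x ^ 2)]

/-- The truncation is 1-Lipschitz, so derivatives shrink almost everywhere. The potential terms
depend only on u² and f², and none of them grows when these are capped at 1. -/
theorem energy_trunc_le {α β γ : ℝ} {u f : ℝ → ℝ} (hα : 0 ≤ α) (hβ : 0 ≤ β) (hγ : 0 ≤ γ)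
    (hu : LocallyAC u) (hf : LocallyAC f) :
    energy α β γ (fun r => trunc (u r)) (fun r => trunc (f r)) ≤ energy α β γ u f := by
  refine lintegral_mono_ae ?_
  filter_upwards [hu.ae_differentiableAt, hf.ae_differentiableAt] with r h1 h2
  refine ENNReal.ofReal_le_ofReal ?_
  unfold energyDensity
  have e1 : deriv (fun r => trunc (u r)) r ^ 2 ≤ deriv u r ^ 2 :=
    sq_le_sq.2 (abs_deriv_lipschitz_comp_le lipschitzWith_trunc h1)
  have e2 : deriv (fun r => trunc (f r)) r ^ 2 ≤ deriv f r ^ 2 :=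
    sq_le_sq.2 (abs_deriv_lipschitz_comp_le lipschitzWith_trunc h2)
  have e3 := sq_one_sub_sq_trunc_le (u r)
  have e4 : (trunc (f r) ^ 2 - 1) ^ 2 ≤ (f r ^ 2 - 1) ^ 2 := by
    have := sq_one_sub_sq_trunc_le (f r)
    nlinarith
  have e5 : trunc (f r) ^ 2 ≤ f r ^ 2 := by rw [sq_trunc]; exact min_le_left _ _
  have e6 : trunc (u r) ^ 2 ≤ u r ^ 2 := by rw [sq_trunc]; exact min_le_left _ _
  gcongr

end

/-! ### Qualitative properties of solutions -/

section

/-- Uniqueness for the linear equation `y'' = q y` on `(0, ∞)`. -/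
theorem eq_zero_of_linear_second_order {y y' q : ℝ → ℝ} (hq : ContinuousOn q (Ioi 0))
    (h1 : ∀ r, 0 < r → HasDerivAt y (y' r) r) (h2 : ∀ r, 0 < r → HasDerivAt y' (q r * y r) r)
    {r₀ : ℝ} (hr₀ : 0 < r₀) (hy : y r₀ = 0) (hy' : y' r₀ = 0) : ∀ r, 0 < r → y r = 0 := by
  set E : ℝ → ℝ := fun r => y r ^ 2 + y' r ^ 2 with hE
  have hEd : ∀ r, 0 < r → HasDerivAt E (2 * y r * y' r + 2 * y' r * (q r * y r)) r := by
    intro r hr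
    refine (((h1 r hr).pow 2).add ((h2 r hr).pow 2)).congr_deriv ?_
    simp
  have hE0 : E r₀ = 0 := by simp [hE, hy, hy']
  -- Gronwall: |E'| ≤ K E on compact intervals, so E times e^{-Kx} decreases to the right of `r₀`
  -- and E times e^{Kx} increases to its left, both vanishing at `r₀`.
  have hbound : ∀ a b : ℝ, 0 < a → ∃ K : ℝ, ∀ r ∈ Icc a b,
      |2 * y r * y' r + 2 * y' r * (q r * y r)| ≤ K * E r := by
    intro a b ha
    obtain ⟨K, hK⟩ := isCompact_Icc.exists_bound_of_continuousOn
      (hq.mono fun x (hx : x ∈ Icc a b) => ha.trans_le hx.1)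
    refine ⟨1 + K, fun r hr => ?_⟩
    have hqr : |q r| ≤ K := by simpa using hK r hr
    have e1 : 2 * y r * y' r + 2 * y' r * (q r * y r) = (2 * y r * y' r) * (1 + q r) := by ring
    rw [e1, abs_mul]
    have e2 : |2 * y r * y' r| ≤ E r := by
      simp only [hE]
      rw [abs_le]
      constructor <;> nlinarith [sq_nonneg (y r + y' r), sq_nonneg (y r - y' r)]
    have e3 : |1 + q r| ≤ 1 + K := (abs_add_le _ _).trans (by simpa using hqr)
    rw [mul_comm (1 + K)]
    exact mul_le_mul e2 e3 (abs_nonneg _) (by simp only [hE]; positivity)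
  have hexp : ∀ (K r : ℝ), 0 < r → HasDerivAt (fun x => E x * Real.exp (K * x))
      ((2 * y r * y' r + 2 * y' r * (q r * y r) + K * E r) * Real.exp (K * r)) r := by
    intro K r hr
    refine ((hEd r hr).mul (((hasDerivAt_id r).const_mul K).exp)).congr_deriv ?_
    simp; ring
  have hEz : ∀ r, 0 < r → E r ≤ 0 := by
    intro r hr
    rcases le_total r₀ r with hle | hle
    · obtain ⟨K, hK⟩ := hbound r₀ r hr₀
      have hanti : AntitoneOn (fun x => E x * Real.exp (-K * x)) (Icc r₀ r) := by
        refine antitoneOn_of_deriv_nonpos (convex_Icc _ _) ?_ ?_ ?_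
        · exact fun x hx => (hexp _ x (hr₀.trans_le hx.1)).continuousAt.continuousWithinAt
        · intro x hx
          rw [interior_Icc] at hx
          exact (hexp _ x (hr₀.trans hx.1)).differentiableAt.differentiableWithinAt
        · intro x hx
          rw [interior_Icc] at hx
          rw [(hexp _ x (hr₀.trans hx.1)).deriv]
          have := (abs_le.1 (hK x (Ioo_subset_Icc_self hx))).2
          exact mul_nonpos_of_nonpos_of_nonneg (by linarith) (Real.exp_pos _).le
      have := hanti (left_mem_Icc.2 hle) (right_mem_Icc.2 hle) hle
      simp only [hE0, zero_mul] at this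
      exact nonpos_of_mul_nonpos_left this (Real.exp_pos _)
    · obtain ⟨K, hK⟩ := hbound r r₀ hr
      have hmono : MonotoneOn (fun x => E x * Real.exp (K * x)) (Icc r r₀) := by
        refine monotoneOn_of_deriv_nonneg (convex_Icc _ _) ?_ ?_ ?_
        · exact fun x hx => (hexp _ x (hr.trans_le hx.1)).continuousAt.continuousWithinAt
        · intro x hx
          rw [interior_Icc] at hx
          exact (hexp _ x (hr.trans hx.1)).differentiableAt.differentiableWithinAt
        · intro x hx
          rw [interior_Icc] at hx
          rw [(hexp _ x (hr.trans hx.1)).deriv]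
          have := (abs_le.1 (hK x (Ioo_subset_Icc_self hx))).1
          exact mul_nonneg (by linarith) (Real.exp_pos _).le
      have := hmono (left_mem_Icc.2 hle) (right_mem_Icc.2 hle) hle
      simp only [hE0, zero_mul] at this
      exact nonpos_of_mul_nonpos_left this (Real.exp_pos _)
  intro r hr
  have := hEz r hr
  simp only [hE] at this
  nlinarith [sq_nonneg (y r), sq_nonneg (y' r)]

section EulerLagrange

variable {α β γ : ℝ} {u f : ℝ → ℝ}

theorem SolvesEulerLagrange.hasDerivAt_u (h : SolvesEulerLagrange α β γ u f) {r : ℝ}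
    (hr : 0 < r) : HasDerivAt u (deriv u r) r := (h r hr).1.hasDerivAt

theorem SolvesEulerLagrange.hasDerivAt_f (h : SolvesEulerLagrange α β γ u f) {r : ℝ}
    (hr : 0 < r) : HasDerivAt f (deriv f r) r := (h r hr).2.1.hasDerivAt

theorem SolvesEulerLagrange.continuousOn_u (h : SolvesEulerLagrange α β γ u f) :
    ContinuousOn u (Ioi 0) :=
  fun _ hr => (h.hasDerivAt_u hr).continuousAt.continuousWithinAt

theorem SolvesEulerLagrange.continuousOn_f (h : SolvesEulerLagrange α β γ u f) :
    ContinuousOn f (Ioi 0) :=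
  fun _ hr => (h.hasDerivAt_f hr).continuousAt.continuousWithinAt

theorem SolvesEulerLagrange.continuousOn_deriv_u (h : SolvesEulerLagrange α β γ u f) :
    ContinuousOn (deriv u) (Ioi 0) :=
  fun r hr => (h r hr).2.2.1.continuousAt.continuousWithinAt

theorem SolvesEulerLagrange.continuousOn_deriv_f (h : SolvesEulerLagrange α β γ u f) :
    ContinuousOn (deriv f) (Ioi 0) :=
  fun r hr => (h r hr).2.2.2.continuousAt.continuousWithinAt

/-- The equation for `f` in divergence form. -/
theorem SolvesEulerLagrange.hasDerivAt_sq_mul_deriv_f (h : SolvesEulerLagrange α β γ u f)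
    {r : ℝ} (hr : 0 < r) : HasDerivAt (fun r => r ^ 2 * deriv f r)
      (β * f r * u r ^ 2 + γ * r ^ 2 * f r * (f r ^ 2 - 1)) r := by
  refine (((hasDerivAt_id r).pow 2).mul (h r hr).2.2.2).congr_deriv ?_
  simp only [id, Pi.pow_apply]
  field_simp
  ring

/-- The component `u` of a solution cannot have a double zero unless it vanishes. -/
theorem SolvesEulerLagrange.u_ne_zero_or (h : SolvesEulerLagrange α β γ u f)
    (hl : Tendsto u (𝓝[>] 0) (𝓝 1)) {r : ℝ} (hr : 0 < r) : u r ≠ 0 ∨ deriv u r ≠ 0 := by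
  by_contra! hz
  have hcu := h.continuousOn_u
  have hcf := h.continuousOn_f
  have hzero := eq_zero_of_linear_second_order
    (q := fun r => α * β / 2 * f r ^ 2 + (u r ^ 2 - 1) / r ^ 2)
    (by
      have : ∀ x ∈ Ioi (0 : ℝ), x ^ 2 ≠ 0 := fun x hx => (pow_pos hx 2).ne'
      fun_prop (disch := assumption))
    (fun r hr => h.hasDerivAt_u hr)
    (fun r hr => (h r hr).2.2.1.congr_deriv (by ring)) hr hz.1 hz.2
  have : Tendsto u (𝓝[>] 0) (𝓝 0) := by
    refine tendsto_const_nhds.congr' ?_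
    filter_upwards [self_mem_nhdsWithin] with x hx using (hzero x hx).symm
  exact one_ne_zero (tendsto_nhds_unique hl this)

/-- A zero of a nonnegative function is a minimum, hence a double zero, and a double zero would make
u vanish identically, against u(0) = 1. -/
theorem SolvesEulerLagrange.u_pos (h : SolvesEulerLagrange α β γ u f)
    (h0 : ∀ r, 0 < r → 0 ≤ u r) (hl : Tendsto u (𝓝[>] 0) (𝓝 1)) : ∀ r, 0 < r → 0 < u r := by
  intro r hr
  refine lt_of_le_of_ne (h0 r hr) fun hz => ?_
  have hmin : IsLocalMin u r := by
    filter_upwards [isOpen_Ioi.mem_nhds hr] with x hx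
    rw [← hz]; exact h0 x hx
  exact (h.u_ne_zero_or hl hr).elim (fun h' => h' hz.symm) fun h' => h' hmin.deriv_eq_zero

/-- The double-zero argument applies to y = r f: this substitution removes the first-order term and
leaves an equation y'' = q y. -/
theorem SolvesEulerLagrange.f_pos (h : SolvesEulerLagrange α β γ u f)
    (h0 : ∀ r, 0 < r → 0 ≤ f r) (hl : Tendsto f atTop (𝓝 1)) : ∀ r, 0 < r → 0 < f r := by
  intro r hr
  refine lt_of_le_of_ne (h0 r hr) fun hz => ?_
  have hmin : IsLocalMin f r := by
    filter_upwards [isOpen_Ioi.mem_nhds hr] with x hx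
    rw [← hz]; exact h0 x hx
  have hcu := h.continuousOn_u
  have hcf := h.continuousOn_f
  have hzero := eq_zero_of_linear_second_order
    (q := fun r => β * u r ^ 2 / r ^ 2 + γ * (f r ^ 2 - 1)) (y := fun r => r * f r)
    (y' := fun r => 1 * f r + r * deriv f r)
    (by
      have : ∀ x ∈ Ioi (0 : ℝ), x ^ 2 ≠ 0 := fun x hx => (pow_pos hx 2).ne'
      fun_prop (disch := assumption))
    (fun r hr => (hasDerivAt_id r).mul (h.hasDerivAt_f hr))
    (fun r hr => (((h.hasDerivAt_f hr).const_mul 1).add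
      ((hasDerivAt_id r).mul (h r hr).2.2.2)).congr_deriv (by
        simp only [id]; field_simp; ring)) hr
    (by simp [← hz]) (by simp [← hz, hmin.deriv_eq_zero])
  have : Tendsto f atTop (𝓝 0) := by
    refine tendsto_const_nhds.congr' ?_
    filter_upwards [eventually_gt_atTop 0] with x hx
    exact ((mul_eq_zero.1 (hzero x hx)).resolve_left hx.ne').symm
  exact one_ne_zero (tendsto_nhds_unique hl this)

/-- Touching the value 1 would be a local maximum, but there the equation gives u'' = (αβ/2) f² > 0.
The argument for f is the same with the roles exchanged, which is why positivity of both profiles is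
established beforehand. -/
theorem SolvesEulerLagrange.u_lt_one (h : SolvesEulerLagrange α β γ u f) (hα : 0 < α)
    (hβ : 0 < β) (h1 : ∀ r, 0 < r → u r ≤ 1) (hf : ∀ r, 0 < r → 0 < f r) :
    ∀ r, 0 < r → u r < 1 := by
  intro r hr
  refine lt_of_le_of_ne (h1 r hr) fun hz => ?_
  have hmax : IsLocalMax u r := by
    filter_upwards [isOpen_Ioi.mem_nhds hr] with x hx
    rw [hz]; exact h1 x hx
  have := second_deriv_nonpos_of_isLocalMax
    (by filter_upwards [isOpen_Ioi.mem_nhds hr] with x hx using (h x hx).1) hmax (h r hr).2.2.1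
  rw [hz] at this
  have hfr := hf r hr
  have : 0 < α * β / 2 * f r ^ 2 := by positivity
  simp at *
  linarith

theorem SolvesEulerLagrange.f_lt_one (h : SolvesEulerLagrange α β γ u f)
    (hβ : 0 < β) (h1 : ∀ r, 0 < r → f r ≤ 1) (hu : ∀ r, 0 < r → 0 < u r) :
    ∀ r, 0 < r → f r < 1 := by
  intro r hr
  refine lt_of_le_of_ne (h1 r hr) fun hz => ?_
  have hmax : IsLocalMax f r := by
    filter_upwards [isOpen_Ioi.mem_nhds hr] with x hx
    rw [hz]; exact h1 x hx
  have := second_deriv_nonpos_of_isLocalMax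
    (by filter_upwards [isOpen_Ioi.mem_nhds hr] with x hx using (h x hx).2.1) hmax (h r hr).2.2.2
  rw [hz, hmax.deriv_eq_zero] at this
  have hur := hu r hr
  have : 0 < β / r ^ 2 * 1 * u r ^ 2 := by positivity
  simp at *
  linarith

/-- Since f → 1, integrability of f² u² gives that of u² near infinity. Then (u²)' = 2 u u' is
integrable too, so u² has a limit, which can only be 0. -/
theorem SolvesEulerLagrange.tendsto_u_atTop (h : SolvesEulerLagrange α β γ u f)
    (hfl : Tendsto f atTop (𝓝 1)) (hu2 : IntegrableOn (fun r => deriv u r ^ 2) (Ioi 0))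
    (hfu : IntegrableOn (fun r => f r ^ 2 * u r ^ 2) (Ioi 0)) : Tendsto u atTop (𝓝 0) := by
  have hev : ∀ᶠ r in atTop, 1 / 2 < f r := hfl.eventually_const_lt (by norm_num)
  obtain ⟨a, ha⟩ := eventually_atTop.1 hev
  set R := max a 1 with hR
  have hR0 : 0 < R := lt_max_of_lt_right one_pos
  have hsub : Ioi R ⊆ Ioi 0 := Ioi_subset_Ioi hR0.le
  have hmu : AEStronglyMeasurable u (volume.restrict (Ioi R)) :=
    (h.continuousOn_u.mono hsub).aestronglyMeasurable measurableSet_Ioi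
  have hud : Measurable (deriv u) := measurable_deriv u
  have hu2i : IntegrableOn (fun r => u r ^ 2) (Ioi R) := by
    refine Integrable.mono' ((hfu.mono_set hsub).const_mul 4) (hmu.pow 2) ?_
    filter_upwards [self_mem_ae_restrict measurableSet_Ioi] with r hr
    have := ha r ((le_max_left a 1).trans (le_of_lt hr))
    rw [Real.norm_of_nonneg (sq_nonneg _)]
    nlinarith [mul_nonneg (by nlinarith : (0 : ℝ) ≤ 4 * f r ^ 2 - 1) (sq_nonneg (u r))]
  have hgi : IntegrableOn (fun r => 2 * u r * deriv u r) (Ioi R) := by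
    refine Integrable.mono' (hu2i.add (hu2.mono_set hsub))
      ((hmu.const_mul 2).mul hud.aestronglyMeasurable) ?_
    refine Eventually.of_forall fun r => ?_
    simp only [Pi.add_apply, Real.norm_eq_abs]
    rw [abs_le]
    constructor <;> nlinarith [sq_nonneg (u r + deriv u r), sq_nonneg (u r - deriv u r)]
  obtain ⟨L, hL⟩ := exists_tendsto_atTop_of_integrable_deriv (G := fun r => u r ^ 2)
    (g := fun r => 2 * u r * deriv u r) (fun r hr =>
      ((h.hasDerivAt_u (hsub hr)).pow 2).congr_deriv (by simp)) hgi
  set χ : ℝ → ℝ := (Ioi R).indicator fun r => u r ^ 2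
  have hL0 := eq_zero_of_tendsto_atTop_of_abs_le_mul hL (h := χ)
    (((integrable_indicator_iff measurableSet_Ioi).2 hu2i).integrableOn) (by
      filter_upwards [eventually_gt_atTop R] with r hr
      have h1 : 1 ≤ r := (le_max_right a 1).trans hr.le
      simp only [χ]
      rw [indicator_of_mem (show r ∈ Ioi R from hr), abs_of_nonneg (sq_nonneg _)]
      nlinarith [sq_nonneg (u r)])
  rw [hL0] at hL
  have := hL.sqrt
  simp only [Real.sqrt_sq_eq_abs, Real.sqrt_zero] at this
  exact (tendsto_zero_iff_abs_tendsto_zero u).2 this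

/-- The flux `r² f'` of a solution bounded near the origin vanishes at the origin. -/
theorem SolvesEulerLagrange.tendsto_sq_mul_deriv_f (h : SolvesEulerLagrange α β γ u f) {C : ℝ}
    (hu : ∀ᶠ r in 𝓝[>] (0 : ℝ), |u r| ≤ C) (hf : ∀ᶠ r in 𝓝[>] (0 : ℝ), |f r| ≤ C)
    (hf2 : IntegrableOn (fun r => r ^ 2 * deriv f r ^ 2) (Ioi 0)) :
    Tendsto (fun r => r ^ 2 * deriv f r) (𝓝[>] 0) (𝓝 0) := by
  obtain ⟨b, hb0, hb⟩ := mem_nhdsGT_iff_exists_Ioc_subset.1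
    ((hu.and hf).and (Ioc_mem_nhdsGT one_pos))
  have hb0' : 0 < b := hb0
  have hsub : Ioc 0 b ⊆ Ioi (0 : ℝ) := Ioc_subset_Ioi_self
  have hcu := h.continuousOn_u.mono hsub
  have hcf := h.continuousOn_f.mono hsub
  have hC : 0 ≤ C := (abs_nonneg _).trans (hb ⟨hb0', le_rfl⟩).1.1
  have hgi : IntegrableOn (fun r => β * f r * u r ^ 2 + γ * r ^ 2 * f r * (f r ^ 2 - 1))
      (Ioc 0 b) := by
    refine Integrable.mono' (g := fun _ => |β| * C * C ^ 2 + |γ| * 1 * C * (C ^ 2 + 1))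
      (integrableOn_const (by simp)) (ContinuousOn.aestronglyMeasurable (by fun_prop)
        measurableSet_Ioc) ?_
    filter_upwards [self_mem_ae_restrict measurableSet_Ioc] with r hr
    obtain ⟨⟨h1, h2⟩, h3, h4⟩ := hb hr
    rw [Real.norm_eq_abs]
    refine (abs_add_le _ _).trans ?_
    rw [abs_mul, abs_mul, abs_mul, abs_mul, abs_mul, abs_pow, abs_pow]
    have h5 : |f r ^ 2 - 1| ≤ C ^ 2 + 1 := by
      have h6 : f r ^ 2 ≤ C ^ 2 := sq_le_sq.2 (by rwa [abs_of_nonneg hC])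
      rw [abs_le]; constructor <;> nlinarith [sq_nonneg (f r)]
    have h7 : |r| ^ 2 ≤ 1 := by
      rw [abs_of_pos h3]; nlinarith
    gcongr
  obtain ⟨L, hL⟩ := exists_tendsto_nhdsGT_of_integrable_deriv hb0'
    (fun r hr => h.hasDerivAt_sq_mul_deriv_f hr.1) hgi
  -- The flux has a limit because its derivative is bounded near 0. For r ≤ 1 its square is at most
  -- r · (r² f'²), with an integrable second factor, so the limit is 0.
  have hL2 : Tendsto (fun r => (r ^ 2 * deriv f r) ^ 2) (𝓝[>] 0) (𝓝 (L ^ 2)) := hL.pow 2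
  have h0 := eq_zero_of_tendsto_nhdsGT_of_abs_le_mul hL2 (hf2.mono_set Ioc_subset_Ioi_self) (by
    filter_upwards [Ioc_mem_nhdsGT one_pos] with r hr
    rw [abs_of_nonneg (sq_nonneg _)]
    have h1 : 0 ≤ r ^ 3 * deriv f r ^ 2 := by have := hr.1; positivity
    nlinarith [mul_nonneg h1 (sub_nonneg.2 hr.2)])
  rw [pow_eq_zero_iff two_ne_zero] at h0
  rwa [h0] at hL

/-- Near 0 the flux r² f' starts from 0 and grows at rate at least (β/2) f, because u → 1. So f is
increasing there and has a limit l. If l > 0, then f' ≥ c/r with c > 0, and f would fall below every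
bound logarithmically. -/
theorem SolvesEulerLagrange.tendsto_f_zero (h : SolvesEulerLagrange α β γ u f) (hβ : 0 < β)
    (hγ : 0 ≤ γ) (hu1 : Tendsto u (𝓝[>] 0) (𝓝 1))
    (hf : ∀ r, 0 < r → 0 < f r ∧ f r < 1)
    (hf2 : IntegrableOn (fun r => r ^ 2 * deriv f r ^ 2) (Ioi 0)) :
    Tendsto f (𝓝[>] 0) (𝓝 0) := by
  have hG := h.tendsto_sq_mul_deriv_f (C := 2)
    (hu1.abs.eventually_le_const (by norm_num))
    (by
      filter_upwards [self_mem_nhdsWithin] with r hr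
      rw [abs_of_pos (hf r hr).1]; linarith [(hf r hr).2]) hf2
  have hcoef : Tendsto (fun r => β * u r ^ 2 - γ * r ^ 2) (𝓝[>] 0) (𝓝 (β * 1 ^ 2 - γ * 0 ^ 2)) := by
    refine ((hu1.pow 2).const_mul β).sub (Tendsto.const_mul γ ?_)
    exact ((continuous_pow 2).tendsto (0 : ℝ)).mono_left nhdsWithin_le_nhds
  obtain ⟨b, hb0, hb⟩ := mem_nhdsGT_iff_exists_Ioo_subset.1
    (hcoef.eventually_const_lt (show β / 2 < β * 1 ^ 2 - γ * 0 ^ 2 by linarith))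
  have hb0' : 0 < b := hb0
  have hg : ∀ r ∈ Ioo 0 b, β / 2 * f r ≤ β * f r * u r ^ 2 + γ * r ^ 2 * f r * (f r ^ 2 - 1) := by
    intro r hr
    have h1 : β / 2 < β * u r ^ 2 - γ * r ^ 2 := hb hr
    have h2 := (hf r hr.1).1
    have h3 : 0 ≤ γ * r ^ 2 * f r * f r ^ 2 := by positivity
    nlinarith
  -- Used twice: with c = 0 for monotonicity of f, and with c = β l / 2 to exclude a positive limit
  -- l.
  have hlow : ∀ c : ℝ, (∀ r ∈ Ioo 0 b, c ≤ β / 2 * f r) → ∀ r ∈ Ioo 0 b,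
      c * r ≤ r ^ 2 * deriv f r := by
    intro c hc r hr
    have hmono : MonotoneOn (fun s => s ^ 2 * deriv f s - c * s) (Ioo 0 b) := by
      have hdd : ∀ s ∈ Ioo 0 b, HasDerivAt (fun s => s ^ 2 * deriv f s - c * s)
          (β * f s * u s ^ 2 + γ * s ^ 2 * f s * (f s ^ 2 - 1) - c * 1) s := fun s hs =>
        (h.hasDerivAt_sq_mul_deriv_f hs.1).sub ((hasDerivAt_id s).const_mul c)
      refine monotoneOn_of_deriv_nonneg (convex_Ioo _ _)
        (fun s hs => (hdd s hs).continuousAt.continuousWithinAt) ?_ ?_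
      · rw [interior_Ioo]
        exact fun s hs => (hdd s hs).differentiableAt.differentiableWithinAt
      · rw [interior_Ioo]
        intro s hs
        rw [(hdd s hs).deriv]
        linarith [hc s hs, hg s hs]
    have hlim : Tendsto (fun s => s ^ 2 * deriv f s - c * s) (𝓝[>] 0) (𝓝 (0 - c * 0)) :=
      hG.sub (Tendsto.const_mul c (tendsto_id.mono_left nhdsWithin_le_nhds))
    have := le_of_tendsto hlim (b := r ^ 2 * deriv f r - c * r) (by
      filter_upwards [Ioo_mem_nhdsGT hr.1] with s hs
      exact hmono ⟨hs.1, hs.2.trans hr.2⟩ hr hs.2.le)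
    linarith
  have hfd : ∀ r ∈ Ioo 0 b, 0 ≤ deriv f r := by
    intro r hr
    have := hlow 0 (fun s hs => by have := (hf s hs.1).1; positivity) r hr
    rw [zero_mul] at this
    exact nonneg_of_mul_nonneg_right this (pow_pos hr.1 2)
  have hfm : MonotoneOn f (Ioo 0 b) := by
    refine monotoneOn_of_deriv_nonneg (convex_Ioo _ _)
      (h.continuousOn_f.mono Ioo_subset_Ioi_self) ?_ ?_
    · rw [interior_Ioo]
      exact fun s hs => (h.hasDerivAt_f hs.1).differentiableAt.differentiableWithinAt
    · rw [interior_Ioo]; exact hfd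
  have hbdd : BddBelow (f '' Ioo 0 b) := ⟨0, by
    rintro _ ⟨s, hs, rfl⟩; exact (hf s hs.1).1.le⟩
  have hlim := MonotoneOn.tendsto_nhdsWithin_Ioo_right (nonempty_Ioo.2 hb0') hfm hbdd
  set l := sInf (f '' Ioo 0 b) with hl
  have hl0 : 0 ≤ l := Real.sInf_nonneg (by
    rintro _ ⟨s, hs, rfl⟩; exact (hf s hs.1).1.le)
  rcases hl0.eq_or_lt with h0 | hpos
  · rwa [← h0] at hlim
  exfalso
  set c := β / 2 * l with hc
  have hcpos : 0 < c := by positivity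
  have hc' := hlow c fun s hs => by
    have : l ≤ f s := csInf_le hbdd ⟨s, hs, rfl⟩
    simp only [hc]; gcongr
  have hdd : ∀ s ∈ Ioo 0 b, HasDerivAt (fun s => f s - c * Real.log s)
      (deriv f s - c * s⁻¹) s := fun s hs =>
    (h.hasDerivAt_f hs.1).sub ((Real.hasDerivAt_log hs.1.ne').const_mul c)
  have hmono : MonotoneOn (fun s => f s - c * Real.log s) (Ioo 0 b) := by
    refine monotoneOn_of_deriv_nonneg (convex_Ioo _ _)
      (fun s hs => (hdd s hs).continuousAt.continuousWithinAt) ?_ ?_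
    · rw [interior_Ioo]
      exact fun s hs => (hdd s hs).differentiableAt.differentiableWithinAt
    · rw [interior_Ioo]
      intro s hs
      rw [(hdd s hs).deriv, sub_nonneg, ← div_eq_mul_inv, div_le_iff₀ hs.1]
      have h1 := hc' s hs
      have h2 : 0 < s := hs.1
      by_contra! hcon
      nlinarith [mul_lt_mul_of_pos_left hcon h2]
  have hb2 : b / 2 ∈ Ioo 0 b := ⟨by linarith, by linarith⟩
  have htop : Tendsto (fun s => -c * Real.log s) (𝓝[>] 0) atTop :=
    Real.tendsto_log_nhdsGT_zero.const_mul_atBot_of_neg (by linarith)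
  obtain ⟨s, hs1, hs2⟩ := ((htop.eventually_gt_atTop
    (f (b / 2) - c * Real.log (b / 2))).and (Ioo_mem_nhdsGT hb2.1)).exists
  have h1 := hmono ⟨hs2.1, hs2.2.trans hb2.2⟩ hb2 hs2.2.le
  have h2 := (hf s hs2.1).1
  simp only at h1
  linarith

end EulerLagrange

end

/-! ### Decay of profiles -/

section

/-- The maximum principle is applied on [a, δ] with boundary bound m > 0, where a is so small that
w(a) ≤ m; m is arbitrary. The version at infinity cuts off at a large b instead. -/
theorem nonpos_of_second_deriv_pos_near_zero {w w' : ℝ → ℝ} {δ : ℝ}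
    (hd : ∀ x ∈ Ioc 0 δ, HasDerivAt w (w' x) x)
    (hdd : ∀ x ∈ Ioo 0 δ, 0 < w x → w' x = 0 → ∃ k, 0 < k ∧ HasDerivAt w' k x)
    (h0 : Tendsto w (𝓝[>] 0) (𝓝 0)) (hδ : w δ ≤ 0) : ∀ x ∈ Ioc 0 δ, w x ≤ 0 := by
  intro x hx
  refine le_of_forall_pos_le_add fun m hm => ?_
  rw [zero_add]
  obtain ⟨a, ha1, ha2⟩ := ((h0.eventually_le_const hm).and (Ioc_mem_nhdsGT hx.1)).exists
  have hsub : ∀ y ∈ Icc a δ, y ∈ Ioc 0 δ := fun y hy => ⟨ha2.1.trans_le hy.1, hy.2⟩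
  exact le_of_second_deriv_pos (ha2.2.trans hx.2)
    (fun y hy => (hd y (hsub y hy)).continuousAt.continuousWithinAt)
    (fun y hy => hd y (hsub y (Ioo_subset_Icc_self hy)))
    (fun y hy => hdd y ⟨ha2.1.trans hy.1, hy.2⟩) hm.le ha1 (hδ.trans hm.le) x ⟨ha2.2, hx.2⟩

theorem nonpos_of_second_deriv_pos_near_infty {w w' : ℝ → ℝ} {R : ℝ}
    (hd : ∀ x ∈ Ici R, HasDerivAt w (w' x) x)
    (hdd : ∀ x ∈ Ioi R, 0 < w x → w' x = 0 → ∃ k, 0 < k ∧ HasDerivAt w' k x)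
    (h0 : Tendsto w atTop (𝓝 0)) (hR : w R ≤ 0) : ∀ x ∈ Ici R, w x ≤ 0 := by
  intro x hx
  refine le_of_forall_pos_le_add fun m hm => ?_
  rw [zero_add]
  obtain ⟨b, hb1, hb2⟩ := ((h0.eventually_le_const hm).and (eventually_ge_atTop x)).exists
  exact le_of_second_deriv_pos (le_trans hx hb2)
    (fun y hy => (hd y hy.1).continuousAt.continuousWithinAt)
    (fun y hy => hd y hy.1.le) (fun y hy => hdd y hy.1) hm.le (hR.trans hm.le) hb1 x ⟨hx, hb2⟩

/-- Writing the derivative as x^τ / x keeps a single power of x in all barrier computations, so that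
they become rational identities. -/
theorem hasDerivAt_rpow_div (τ : ℝ) {x : ℝ} (hx : 0 < x) :
    HasDerivAt (fun y : ℝ => y ^ τ) (τ * x ^ τ / x) x := by
  refine (Real.hasDerivAt_rpow_const (Or.inl hx.ne')).congr_deriv ?_
  rw [Real.rpow_sub_one hx.ne']
  ring

theorem hasDerivAt_rpow_div_deriv (τ : ℝ) {x : ℝ} (hx : 0 < x) :
    HasDerivAt (fun y : ℝ => τ * y ^ τ / y) (τ * (τ - 1) * x ^ τ / x ^ 2) x := by
  refine (((hasDerivAt_rpow_div τ hx).const_mul τ).div (hasDerivAt_id x) hx.ne').congr_deriv ?_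
  simp only [id]
  field_simp

theorem tendsto_rpow_nhdsGT_zero {τ : ℝ} (hτ : 0 < τ) :
    Tendsto (fun x : ℝ => x ^ τ) (𝓝[>] 0) (𝓝 0) := by
  have := (Real.continuousAt_rpow_const 0 τ (Or.inr hτ.le)).tendsto
  rw [Real.zero_rpow hτ.ne'] at this
  exact this.mono_left nhdsWithin_le_nhds

theorem hasDerivAt_exp_neg_mul (κ x : ℝ) :
    HasDerivAt (fun y : ℝ => Real.exp (-(κ * y))) (-κ * Real.exp (-(κ * x))) x := by
  refine (((hasDerivAt_id x).const_mul κ).neg.exp).congr_deriv ?_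
  simp; ring

theorem tendsto_exp_neg_mul_atTop {κ : ℝ} (hκ : 0 < κ) :
    Tendsto (fun x : ℝ => Real.exp (-(κ * x))) atTop (𝓝 0) :=
  Real.tendsto_exp_atBot.comp (tendsto_neg_atTop_atBot.comp (tendsto_id.const_mul_atTop hκ))

/-- Solutions of the Euler-Lagrange equations with values in `(0, 1)` and the boundary behaviour
of the monopole. -/
structure IsProfile (α β γ : ℝ) (u f : ℝ → ℝ) : Prop where
  el : SolvesEulerLagrange α β γ u f
  bounds : ∀ r : ℝ, 0 < r → 0 < u r ∧ u r < 1 ∧ 0 < f r ∧ f r < 1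
  boundary : BoundaryConditions u f

variable {α β γ : ℝ} {u f : ℝ → ℝ}

/-- The linearised equation at 0 is r² f'' + 2 r f' = β f, with critical exponent given by τ(τ + 1)
= β. A smaller τ makes A r^τ a barrier: at a critical point where f - A r^τ is positive, its second
derivative is positive. A is fitted at δ. -/
theorem IsProfile.f_isBigO_zero (h : IsProfile α β γ u f) {τ : ℝ} (hτ : 0 < τ)
    (hτβ : τ * (τ + 1) < β) : f =O[𝓝[>] 0] fun r : ℝ => r ^ τ := by
  have hlim : Tendsto (fun r => β * u r ^ 2 - γ * r ^ 2 * (1 - f r ^ 2)) (𝓝[>] 0)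
      (𝓝 (β * 1 ^ 2 - γ * 0 ^ 2 * (1 - 0 ^ 2))) := by
    refine ((h.boundary.u_zero.pow 2).const_mul β).sub (Tendsto.mul (Tendsto.const_mul γ ?_)
      ((h.boundary.f_zero.pow 2).const_sub 1))
    exact ((continuous_pow 2).tendsto (0 : ℝ)).mono_left nhdsWithin_le_nhds
  obtain ⟨δ, hδ, hsub⟩ := mem_nhdsGT_iff_exists_Ioc_subset.1
    (hlim.eventually_const_lt (show τ * (τ + 1) < _ by simpa using hτβ))
  have hδ0 : 0 < δ := hδ
  set A := f δ / δ ^ τ with hA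
  have hδτ : 0 < δ ^ τ := Real.rpow_pos_of_pos hδ0 τ
  have hA0 : 0 < A := div_pos (h.bounds δ hδ0).2.2.1 hδτ
  have hw := nonpos_of_second_deriv_pos_near_zero (δ := δ) (w := fun r => f r - A * r ^ τ)
    (w' := fun r => deriv f r - A * (τ * r ^ τ / r))
    (fun x hx => (h.el.hasDerivAt_f hx.1).sub ((hasDerivAt_rpow_div τ hx.1).const_mul A))
    (by
      intro x hx hpos hz
      refine ⟨_, ?_, (h.el x hx.1).2.2.2.sub ((hasDerivAt_rpow_div_deriv τ hx.1).const_mul A)⟩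
      have hx0 : 0 < x := hx.1
      have hk : τ * (τ + 1) < β * u x ^ 2 - γ * x ^ 2 * (1 - f x ^ 2) := hsub ⟨hx.1, hx.2.le⟩
      have hfd : deriv f x = A * (τ * x ^ τ / x) := by linarith
      have hfx := (h.bounds x hx0).2.2.1
      rw [hfd]
      have e : -(2 / x) * (A * (τ * x ^ τ / x)) + β / x ^ 2 * f x * u x ^ 2
          + γ * f x * (f x ^ 2 - 1) - A * (τ * (τ - 1) * x ^ τ / x ^ 2)
          = ((β * u x ^ 2 - γ * x ^ 2 * (1 - f x ^ 2)) * f x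
            - τ * (τ + 1) * (A * x ^ τ)) / x ^ 2 := by
        field_simp; ring
      rw [e]
      refine div_pos ?_ (pow_pos hx0 2)
      have h1 : τ * (τ + 1) * (A * x ^ τ) ≤ τ * (τ + 1) * f x := by
        refine mul_le_mul_of_nonneg_left (by linarith) (by positivity)
      have h2 := mul_lt_mul_of_pos_right hk hfx
      linarith)
    (by simpa using h.boundary.f_zero.sub ((tendsto_rpow_nhdsGT_zero hτ).const_mul A))
    (by simp only [hA]; rw [div_mul_cancel₀ _ hδτ.ne', sub_self])
  refine IsBigO.of_bound A ?_
  filter_upwards [Ioc_mem_nhdsGT hδ0] with r hr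
  rw [Real.norm_of_nonneg (h.bounds r hr.1).2.2.1.le,
    Real.norm_of_nonneg (Real.rpow_nonneg hr.1.le τ)]
  linarith [hw r hr]

/-- To leading order v = 1 - u satisfies r² v'' = 2v, with critical exponent t(t - 1) = 2, that is t
= 2. The remaining source is of order r² ≤ r^t and is absorbed by a large multiple of the barrier.
-/
theorem IsProfile.one_sub_u_isBigO_zero (h : IsProfile α β γ u f) (hα : 0 < α) (hβ : 0 < β)
    {t : ℝ} (ht : 0 < t) (ht2 : t < 2) : (fun r => 1 - u r) =O[𝓝[>] 0] fun r : ℝ => r ^ t := by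
  -- For t < 1 the coefficient t(t - 1) is negative; clipping it at 0 allows multiplying the
  -- inequality A r^t ≤ 1 - u by it. `η` is half of the gap up to 2 = lim u(1 + u).
  set s := max (t * (t - 1)) 0 with hs
  have hs2 : s < 2 := max_lt (by nlinarith) two_pos
  set η := (2 - s) / 2 with hη
  have hη0 : 0 < η := by simp only [hη]; linarith
  have hlim : Tendsto (fun r => u r * (1 + u r)) (𝓝[>] 0) (𝓝 (1 * (1 + 1))) :=
    h.boundary.u_zero.mul (h.boundary.u_zero.const_add 1)
  obtain ⟨δ, hδ, hsub⟩ := mem_nhdsGT_iff_exists_Ioc_subset.1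
    ((hlim.eventually_const_lt (show s + η < _ by simp only [hη]; linarith)).and
      (Ioc_mem_nhdsGT one_pos))
  have hδ0 : 0 < δ := hδ
  -- The first entry gives the comparison at δ, the second makes `η` times the barrier dominate the
  -- source (αβ/2) f² u r².
  set A := max ((1 - u δ) / δ ^ t) (α * β / 2 / η) with hA
  have hδt : 0 < δ ^ t := Real.rpow_pos_of_pos hδ0 t
  have hA1 : (1 - u δ) / δ ^ t ≤ A := le_max_left _ _
  have hA2 : α * β / 2 / η ≤ A := le_max_right _ _
  have hA0 : 0 < A := lt_of_lt_of_le (by positivity) hA2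
  have hw := nonpos_of_second_deriv_pos_near_zero (δ := δ) (w := fun r => 1 - u r - A * r ^ t)
    (w' := fun r => -deriv u r - A * (t * r ^ t / r))
    (fun x hx => ((h.el.hasDerivAt_u hx.1).const_sub 1).sub
      ((hasDerivAt_rpow_div t hx.1).const_mul A))
    (by
      intro x hx hpos hz
      refine ⟨_, ?_, (h.el x hx.1).2.2.1.neg.sub ((hasDerivAt_rpow_div_deriv t hx.1).const_mul A)⟩
      have hx0 : 0 < x := hx.1
      obtain ⟨hk, -, hx1⟩ := hsub ⟨hx.1, hx.2.le⟩
      obtain ⟨b1, b2, b3, b4⟩ := h.bounds x hx0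
      have hg0 : 0 < A * x ^ t := mul_pos hA0 (Real.rpow_pos_of_pos hx0 t)
      have e : -(α * β / 2 * f x ^ 2 * u x + u x * (u x ^ 2 - 1) / x ^ 2)
          - A * (t * (t - 1) * x ^ t / x ^ 2)
          = (u x * (1 + u x) * (1 - u x) - t * (t - 1) * (A * x ^ t)
            - α * β / 2 * f x ^ 2 * u x * x ^ 2) / x ^ 2 := by
        field_simp; ring
      rw [e]
      refine div_pos ?_ (pow_pos hx0 2)
      have h1 : t * (t - 1) * (A * x ^ t) ≤ s * (A * x ^ t) :=
        mul_le_mul_of_nonneg_right (le_max_left _ _) hg0.le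
      have h2 : s * (A * x ^ t) ≤ s * (1 - u x) :=
        mul_le_mul_of_nonneg_left (by linarith) (le_max_right _ _)
      have h3 : (s + η) * (1 - u x) < u x * (1 + u x) * (1 - u x) :=
        mul_lt_mul_of_pos_right hk (by linarith)
      have h4 : η * (A * x ^ t) < η * (1 - u x) := mul_lt_mul_of_pos_left (by linarith) hη0
      have h5 : x ^ 2 ≤ x ^ t := by
        rw [← Real.rpow_natCast]
        exact Real.rpow_le_rpow_of_exponent_ge hx0 hx1 (by norm_num; exact ht2.le)
      have h6 : α * β / 2 * x ^ 2 ≤ η * (A * x ^ t) := by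
        have : α * β / 2 ≤ η * A := by rw [div_le_iff₀ hη0] at hA2; linarith
        calc α * β / 2 * x ^ 2 ≤ η * A * x ^ t := by gcongr
          _ = η * (A * x ^ t) := by ring
      have h7 : α * β / 2 * f x ^ 2 * u x * x ^ 2 ≤ α * β / 2 * x ^ 2 := by
        have : f x ^ 2 * u x ≤ 1 := by
          have : f x ^ 2 ≤ 1 := by nlinarith
          nlinarith [sq_nonneg (f x)]
        have h8 : 0 ≤ α * β / 2 * x ^ 2 := by positivity
        nlinarith
      nlinarith)
    (by
      have h1 := (h.boundary.u_zero.const_sub 1).sub ((tendsto_rpow_nhdsGT_zero ht).const_mul A)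
      rwa [sub_self, mul_zero, sub_zero] at h1)
    (by rw [div_le_iff₀ hδt] at hA1; linarith)
  refine IsBigO.of_bound A ?_
  filter_upwards [Ioc_mem_nhdsGT hδ0] with r hr
  rw [Real.norm_of_nonneg (by linarith [(h.bounds r hr.1).2.1]),
    Real.norm_of_nonneg (Real.rpow_nonneg hr.1.le t)]
  linarith [hw r hr]

/-- At infinity the coefficient of u in its equation tends to αβ/2, so an exponential with κ² < αβ/2
is a barrier. -/
theorem IsProfile.exists_u_le_exp (h : IsProfile α β γ u f) {κ : ℝ} (hκ : 0 < κ)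
    (hκ2 : κ ^ 2 < α * β / 2) : ∃ A, 0 < A ∧ ∀ᶠ r in atTop, u r ≤ A * Real.exp (-(κ * r)) := by
  have hinv : Tendsto (fun r : ℝ => (r ^ 2)⁻¹) atTop (𝓝 0) :=
    tendsto_inv_atTop_zero.comp (tendsto_pow_atTop two_ne_zero)
  have hlim : Tendsto (fun r => α * β / 2 * f r ^ 2 + (u r ^ 2 - 1) * (r ^ 2)⁻¹) atTop
      (𝓝 (α * β / 2 * 1 ^ 2 + (0 ^ 2 - 1) * 0)) :=
    ((h.boundary.f_infty.pow 2).const_mul _).add (((h.boundary.u_infty.pow 2).sub_const 1).mul hinv)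
  obtain ⟨R₀, hR₀⟩ := eventually_atTop.1
    (hlim.eventually_const_lt (show κ ^ 2 < _ by simpa using hκ2))
  set R := max R₀ 1
  have hR0 : 0 < R := lt_max_of_lt_right one_pos
  have hRk : ∀ r ∈ Ici R, κ ^ 2 < α * β / 2 * f r ^ 2 + (u r ^ 2 - 1) * (r ^ 2)⁻¹ :=
    fun r hr => hR₀ r ((le_max_left _ _).trans hr)
  set A := u R / Real.exp (-(κ * R)) with hA
  have hA0 : 0 < A := div_pos (h.bounds R hR0).1 (Real.exp_pos _)
  have hw := nonpos_of_second_deriv_pos_near_infty (R := R)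
    (w := fun r => u r - A * Real.exp (-(κ * r)))
    (w' := fun r => deriv u r - A * (-κ * Real.exp (-(κ * r))))
    (fun x hx => (h.el.hasDerivAt_u (hR0.trans_le hx)).sub
      ((hasDerivAt_exp_neg_mul κ x).const_mul A))
    (by
      intro x hx hpos hz
      have hx0 : 0 < x := hR0.trans hx
      refine ⟨_, ?_, (h.el x hx0).2.2.1.sub
        (((hasDerivAt_exp_neg_mul κ x).const_mul (-κ)).const_mul A)⟩
      have hk := hRk x (mem_Ici.2 (le_of_lt hx))
      have hu := (h.bounds x hx0).1
      have h1 : κ ^ 2 * (A * Real.exp (-(κ * x))) ≤ κ ^ 2 * u x :=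
        mul_le_mul_of_nonneg_left (by linarith) (sq_nonneg _)
      have h2 := mul_lt_mul_of_pos_right hk hu
      have e : u x * (u x ^ 2 - 1) / x ^ 2 = (u x ^ 2 - 1) * (x ^ 2)⁻¹ * u x := by
        rw [div_eq_mul_inv]; ring
      rw [e]
      linarith)
    (by simpa using h.boundary.u_infty.sub ((tendsto_exp_neg_mul_atTop hκ).const_mul A))
    (by simp only [hA]; rw [div_mul_cancel₀ _ (Real.exp_pos _).ne', sub_self])
  refine ⟨A, hA0, ?_⟩
  filter_upwards [eventually_ge_atTop R] with r hr
  linarith [hw r hr]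

theorem IsProfile.u_isBigO_infty (h : IsProfile α β γ u f) {κ : ℝ} (hκ : 0 < κ)
    (hκ2 : κ ^ 2 < α * β / 2) : u =O[atTop] fun r : ℝ => Real.exp (-(κ * r)) := by
  obtain ⟨A, -, hA⟩ := h.exists_u_le_exp hκ hκ2
  refine IsBigO.of_bound A ?_
  filter_upwards [hA, eventually_gt_atTop 0] with r h1 h2
  rwa [Real.norm_of_nonneg (h.bounds r h2).1.le, Real.norm_of_nonneg (Real.exp_pos _).le]

/-- The linear part of the equation for 1 - f allows rates κ with κ² < 2γ. The source β f u²/r²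
decays like e^{-2κ'r}, which is the second restriction κ ≤ 2κ' and the origin of the minimum in the
final rate. -/
theorem IsProfile.one_sub_f_isBigO_infty_exp (h : IsProfile α β γ u f) (hβ : 0 < β)
    {κ κ' : ℝ} (hκ : 0 < κ) (hκγ : κ ^ 2 < 2 * γ) (hκ' : 0 < κ') (hκκ' : κ ≤ 2 * κ')
    (hκ'2 : κ' ^ 2 < α * β / 2) :
    (fun r => 1 - f r) =O[atTop] fun r : ℝ => Real.exp (-(κ * r)) := by
  obtain ⟨B, hB0, hB⟩ := h.exists_u_le_exp hκ' hκ'2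
  set η := (2 * γ - κ ^ 2) / 2 with hη
  have hη0 : 0 < η := by simp only [hη]; linarith
  have hlim : Tendsto (fun r => γ * f r * (1 + f r)) atTop (𝓝 (γ * 1 * (1 + 1))) :=
    (h.boundary.f_infty.const_mul γ).mul (h.boundary.f_infty.const_add 1)
  obtain ⟨R₀, hR₀⟩ := eventually_atTop.1
    ((hlim.eventually_const_lt (show κ ^ 2 + η < _ by simp only [hη]; linarith)).and hB)
  set R := max R₀ 1
  have hR0 : 0 < R := lt_max_of_lt_right one_pos
  have hR1 : 1 ≤ R := le_max_right _ _
  have hRk : ∀ r ∈ Ici R, κ ^ 2 + η < γ * f r * (1 + f r) ∧ u r ≤ B * Real.exp (-(κ' * r)) :=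
    fun r hr => hR₀ r ((le_max_left _ _).trans hr)
  set A := max ((1 - f R) / Real.exp (-(κ * R))) (β * B ^ 2 / η) with hA
  have hA1 : (1 - f R) / Real.exp (-(κ * R)) ≤ A := le_max_left _ _
  have hA2 : β * B ^ 2 / η ≤ A := le_max_right _ _
  have hA0 : 0 < A := lt_of_lt_of_le (by positivity) hA2
  have hw := nonpos_of_second_deriv_pos_near_infty (R := R)
    (w := fun r => 1 - f r - A * Real.exp (-(κ * r)))
    (w' := fun r => -deriv f r - A * (-κ * Real.exp (-(κ * r))))
    (fun x hx => ((h.el.hasDerivAt_f (hR0.trans_le hx)).const_sub 1).sub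
      ((hasDerivAt_exp_neg_mul κ x).const_mul A))
    (by
      intro x hx hpos hz
      have hx0 : 0 < x := hR0.trans hx
      have hx1 : 1 ≤ x := hR1.trans (le_of_lt hx)
      refine ⟨_, ?_, (h.el x hx0).2.2.2.neg.sub
        (((hasDerivAt_exp_neg_mul κ x).const_mul (-κ)).const_mul A)⟩
      obtain ⟨hk, hux⟩ := hRk x (mem_Ici.2 (le_of_lt hx))
      obtain ⟨b1, b2, b3, b4⟩ := h.bounds x hx0
      have hfd : deriv f x = A * (κ * Real.exp (-(κ * x))) := by linarith
      have hg0 : 0 < A * Real.exp (-(κ * x)) := mul_pos hA0 (Real.exp_pos _)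
      rw [hfd]
      -- At a critical point of the difference f' equals minus the derivative of the barrier, which
      -- is positive; so the first-order term has the favourable sign.
      have h1 : 0 ≤ 2 / x * (A * (κ * Real.exp (-(κ * x)))) := by positivity
      have h2 : (κ ^ 2 + η) * (1 - f x) < γ * f x * (1 + f x) * (1 - f x) :=
        mul_lt_mul_of_pos_right hk (by linarith)
      have h3 : (κ ^ 2 + η) * (A * Real.exp (-(κ * x))) < (κ ^ 2 + η) * (1 - f x) :=
        mul_lt_mul_of_pos_left (by linarith) (by positivity)
      have h4 : β / x ^ 2 * f x * u x ^ 2 ≤ β * u x ^ 2 := by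
        have e1 : β / x ^ 2 ≤ β := div_le_self hβ.le (one_le_pow₀ hx1)
        have e2 : β / x ^ 2 * f x ≤ β := (mul_le_mul e1 b4.le b3.le hβ.le).trans_eq (mul_one β)
        exact mul_le_mul_of_nonneg_right e2 (sq_nonneg _)
      have h5 : u x ^ 2 ≤ B ^ 2 * Real.exp (-(κ * x)) := by
        have e1 : u x ^ 2 ≤ (B * Real.exp (-(κ' * x))) ^ 2 := pow_le_pow_left₀ b1.le hux 2
        have e2 : Real.exp (-(κ' * x)) ^ 2 ≤ Real.exp (-(κ * x)) := by
          rw [← Real.exp_nat_mul]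
          refine Real.exp_le_exp.2 ?_
          push_cast
          nlinarith
        calc u x ^ 2 ≤ B ^ 2 * Real.exp (-(κ' * x)) ^ 2 := by rw [← mul_pow]; exact e1
          _ ≤ B ^ 2 * Real.exp (-(κ * x)) := by gcongr
      have h6 : β * u x ^ 2 ≤ η * (A * Real.exp (-(κ * x))) := by
        have e1 : β * B ^ 2 ≤ η * A := by rw [div_le_iff₀ hη0] at hA2; linarith
        calc β * u x ^ 2 ≤ β * (B ^ 2 * Real.exp (-(κ * x))) := by gcongr
          _ = β * B ^ 2 * Real.exp (-(κ * x)) := by ring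
          _ ≤ η * A * Real.exp (-(κ * x)) := by gcongr
          _ = η * (A * Real.exp (-(κ * x))) := by ring
      have e : γ * f x * (f x ^ 2 - 1) = -(γ * f x * (1 + f x) * (1 - f x)) := by ring
      rw [e]
      linarith)
    (by
      have h1 := (h.boundary.f_infty.const_sub 1).sub ((tendsto_exp_neg_mul_atTop hκ).const_mul A)
      rwa [sub_self, mul_zero, sub_zero] at h1)
    (by rw [div_le_iff₀ (Real.exp_pos _)] at hA1; linarith)
  refine IsBigO.of_bound A ?_
  filter_upwards [eventually_ge_atTop R] with r hr
  rw [Real.norm_of_nonneg (by linarith [(h.bounds r (hR0.trans_le hr)).2.2.2]),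
    Real.norm_of_nonneg (Real.exp_pos _).le]
  linarith [hw r hr]

/-- For γ = 0 the flux r² f' has the exponentially small derivative β f u², so it is bounded above
by a constant C. Integrating f' ≤ C/r² from r to infinity gives 1 - f ≤ C/r. -/
theorem IsProfile.one_sub_f_isBigO_infty_inv (h : IsProfile α β 0 u f) (hα : 0 < α) (hβ : 0 < β) :
    (fun r => 1 - f r) =O[atTop] fun r : ℝ => 1 / r := by
  obtain ⟨B, hB0, hB⟩ := h.exists_u_le_exp (κ := √(α * β / 2) / 2) (by positivity) (by
    rw [div_pow, Real.sq_sqrt (by positivity)]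
    have : 0 < α * β := by positivity
    linarith)
  set κ := √(α * β / 2) / 2 with hκ
  have hκ0 : 0 < κ := by positivity
  obtain ⟨R₀, hR₀⟩ := eventually_atTop.1 hB
  set R := max R₀ 1
  have hR0 : 0 < R := lt_max_of_lt_right one_pos
  have hRk : ∀ r ∈ Ici R, u r ≤ B * Real.exp (-(κ * r)) :=
    fun r hr => hR₀ r ((le_max_left _ _).trans hr)
  -- Chosen so that the derivative of D e^{-κs} is -βB e^{-κs}, which outweighs the growth of the
  -- flux.
  set D := β * B / κ with hD
  have hD0 : 0 < D := by positivity
  set C := R ^ 2 * deriv f R + D * Real.exp (-(κ * R)) with hC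
  have hdd : ∀ s ∈ Ici R, HasDerivAt (fun s => s ^ 2 * deriv f s + D * Real.exp (-(κ * s)))
      (β * f s * u s ^ 2 + 0 * s ^ 2 * f s * (f s ^ 2 - 1)
        + D * (-κ * Real.exp (-(κ * s)))) s := fun s hs =>
    (h.el.hasDerivAt_sq_mul_deriv_f (hR0.trans_le hs)).add
      ((hasDerivAt_exp_neg_mul κ s).const_mul D)
  have hanti : AntitoneOn (fun s => s ^ 2 * deriv f s + D * Real.exp (-(κ * s))) (Ici R) := by
    refine antitoneOn_of_deriv_nonpos (convex_Ici R)
      (fun s hs => (hdd s hs).continuousAt.continuousWithinAt)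
      (fun s hs => (hdd s (interior_subset hs)).differentiableAt.differentiableWithinAt) ?_
    intro s hs
    have hs' := interior_subset hs
    rw [(hdd s hs').deriv]
    obtain ⟨b1, b2, b3, b4⟩ := h.bounds s (hR0.trans_le hs')
    have h1 : β * f s * u s ^ 2 ≤ β * u s := by
      have e1 : β * f s ≤ β := by nlinarith
      have e2 : u s ^ 2 ≤ u s := by nlinarith
      exact mul_le_mul e1 e2 (sq_nonneg _) hβ.le
    have h2 : β * u s ≤ β * (B * Real.exp (-(κ * s))) :=
      mul_le_mul_of_nonneg_left (hRk s hs') hβ.le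
    have h3 : D * κ = β * B := by simp only [hD]; field_simp
    have h4 : D * (-κ * Real.exp (-(κ * s))) = -(β * (B * Real.exp (-(κ * s)))) := by
      rw [← mul_assoc, mul_neg, h3]; ring
    rw [h4]
    linarith
  have hbound : ∀ s ∈ Ici R, s ^ 2 * deriv f s ≤ C := by
    intro s hs
    have := hanti self_mem_Ici hs hs
    have h1 : 0 < D * Real.exp (-(κ * s)) := by positivity
    simp only at this
    linarith
  have hdd2 : ∀ s ∈ Ici R, HasDerivAt (fun s => f s + C * s⁻¹) (deriv f s + C * (-(s ^ 2)⁻¹)) s :=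
    fun s hs => (h.el.hasDerivAt_f (hR0.trans_le hs)).add
      ((hasDerivAt_inv (hR0.trans_le hs).ne').const_mul C)
  have hanti2 : AntitoneOn (fun s => f s + C * s⁻¹) (Ici R) := by
    refine antitoneOn_of_deriv_nonpos (convex_Ici R)
      (fun s hs => (hdd2 s hs).continuousAt.continuousWithinAt)
      (fun s hs => (hdd2 s (interior_subset hs)).differentiableAt.differentiableWithinAt) ?_
    intro s hs
    have hs' := interior_subset hs
    have hs0 : 0 < s := hR0.trans_le hs'
    rw [(hdd2 s hs').deriv]
    have h1 : deriv f s ≤ C * (s ^ 2)⁻¹ := by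
      rw [← div_eq_mul_inv, le_div_iff₀ (pow_pos hs0 2), mul_comm]
      exact hbound s hs'
    linarith
  have hlim : Tendsto (fun s => f s + C * s⁻¹) atTop (𝓝 (1 + C * 0)) :=
    h.boundary.f_infty.add (tendsto_inv_atTop_zero.const_mul C)
  refine IsBigO.of_bound C ?_
  filter_upwards [eventually_ge_atTop R] with r hr
  have hr0 : 0 < r := hR0.trans_le hr
  rw [Real.norm_of_nonneg (by linarith [(h.bounds r hr0).2.2.2]),
    Real.norm_of_nonneg (by positivity), one_div]
  have := le_of_tendsto hlim (b := f r + C * r⁻¹) (by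
    filter_upwards [eventually_ge_atTop r] with s hs
    exact hanti2 hr (le_trans hr hs) hs)
  linarith

end

/-! ### The relaxed class and weak limits -/

section

/-- Weak sequential compactness in `L²(0, ∞)`, stated for functions. -/
theorem exists_weak_limit {U : ℕ → ℝ → ℝ} {C : ℝ}
    (hU : ∀ n, MemLp (U n) 2 (volume.restrict (Ioi (0 : ℝ))))
    (hC : ∀ n, ∫ r in Ioi (0 : ℝ), U n r ^ 2 ≤ C) :
    ∃ (V : ℝ → ℝ) (φ : ℕ → ℕ), MemLp V 2 (volume.restrict (Ioi (0 : ℝ))) ∧ StrictMono φ ∧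
      ∀ w : ℝ → ℝ, MemLp w 2 (volume.restrict (Ioi (0 : ℝ))) →
        Tendsto (fun n => ∫ r in Ioi (0 : ℝ), U (φ n) r * w r) atTop
          (𝓝 (∫ r in Ioi (0 : ℝ), V r * w r)) := by
  have : Fact ((2 : ENNReal) ≠ ⊤) := ⟨by simp⟩
  set μ := volume.restrict (Ioi (0 : ℝ)) with hμ
  have hinner : ∀ (x : Lp ℝ 2 μ) (w : ℝ → ℝ) (hw : MemLp w 2 μ),
      inner ℝ x (hw.toLp w) = ∫ r, x r * w r ∂μ := by
    intro x w hw
    rw [L2.inner_def]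
    refine integral_congr_ae ?_
    filter_upwards [hw.coeFn_toLp] with r hr
    rw [hr]
    simp [mul_comm]
  have hinner' : ∀ (v w : ℝ → ℝ) (hv : MemLp v 2 μ) (hw : MemLp w 2 μ),
      inner ℝ (hv.toLp v) (hw.toLp w) = ∫ r, v r * w r ∂μ := by
    intro v w hv hw
    rw [hinner]
    refine integral_congr_ae ?_
    filter_upwards [hv.coeFn_toLp] with r hr
    rw [hr]
  have hnorm : ∀ n, ‖(hU n).toLp (U n)‖ ≤ √C := by
    intro n
    refine Real.le_sqrt_of_sq_le ?_
    rw [← real_inner_self_eq_norm_sq, hinner']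
    refine le_trans (le_of_eq ?_) (hC n)
    refine integral_congr_ae (Eventually.of_forall fun r => ?_)
    simp only; ring
  obtain ⟨y, φ, hφ, hy⟩ := exists_subseq_tendsto_inner hnorm
  refine ⟨y, φ, Lp.memLp y, hφ, fun w hw => ?_⟩
  have := hy (hw.toLp w)
  rw [hinner] at this
  refine this.congr fun n => ?_
  rw [hinner']

theorem memLp_two_of_integrableOn_sq {U : ℝ → ℝ}
    (hm : AEStronglyMeasurable U (volume.restrict (Ioi (0 : ℝ))))
    (hi : IntegrableOn (fun r => U r ^ 2) (Ioi 0)) :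
    MemLp U 2 (volume.restrict (Ioi (0 : ℝ))) :=
  (memLp_two_iff_integrable_sq hm).2 hi

/-- This indicator and the function s⁻¹ cut off to (r, ∞) are the test functions that turn weak
convergence of u' and s f' into pointwise convergence of u and f. -/
theorem memLp_indicator_Ioc (r : ℝ) :
    MemLp ((Ioc 0 r).indicator fun _ => (1 : ℝ)) 2 (volume.restrict (Ioi (0 : ℝ))) := by
  refine memLp_indicator_const 2 measurableSet_Ioc 1 (Or.inr ?_)
  exact ((Measure.restrict_apply_le _ _).trans_lt (by simp)).ne

theorem integrableOn_inv_sq {r : ℝ} (hr : 0 < r) : IntegrableOn (fun s : ℝ => (s ^ 2)⁻¹) (Ioi r) := by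
  refine (integrableOn_Ioi_rpow_of_lt (show (-2 : ℝ) < -1 by norm_num) hr).congr_fun
    (fun s hs => ?_) measurableSet_Ioi
  have : 0 < s := hr.trans hs
  simp only
  rw [Real.rpow_neg this.le]
  norm_num

theorem memLp_indicator_inv {r : ℝ} (hr : 0 < r) :
    MemLp ((Ioi r).indicator fun s => s⁻¹) 2 (volume.restrict (Ioi (0 : ℝ))) := by
  refine memLp_two_of_integrableOn_sq
    ((measurable_inv.indicator measurableSet_Ioi).aestronglyMeasurable) ?_
  have : (fun s => (Ioi r).indicator (fun s : ℝ => s⁻¹) s ^ 2)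
      = (Ioi r).indicator fun s : ℝ => (s ^ 2)⁻¹ := by
    ext s
    by_cases hs : s ∈ Ioi r
    · rw [indicator_of_mem hs, indicator_of_mem hs, inv_pow]
    · rw [indicator_of_notMem hs, indicator_of_notMem hs]; simp
  rw [this]
  exact ((integrable_indicator_iff measurableSet_Ioi).2 (integrableOn_inv_sq hr)).integrableOn

theorem integral_mul_indicator_Ioc (V : ℝ → ℝ) {r : ℝ} (hr : 0 ≤ r) :
    ∫ s in Ioi (0 : ℝ), V s * (Ioc 0 r).indicator (fun _ => (1 : ℝ)) s = ∫ s in (0 : ℝ)..r, V s := by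
  have : (fun s => V s * (Ioc 0 r).indicator (fun _ => (1 : ℝ)) s) = (Ioc 0 r).indicator V := by
    ext s
    by_cases hs : s ∈ Ioc 0 r
    · rw [indicator_of_mem hs, indicator_of_mem hs, mul_one]
    · rw [indicator_of_notMem hs, indicator_of_notMem hs, mul_zero]
  rw [this, setIntegral_indicator measurableSet_Ioc, inter_eq_right.2 Ioc_subset_Ioi_self,
    intervalIntegral.integral_of_le hr]

theorem mul_indicator_inv_eq (G : ℝ → ℝ) (r : ℝ) :
    (fun s => G s * (Ioi r).indicator (fun s => s⁻¹) s) = (Ioi r).indicator fun s => G s * s⁻¹ := by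
  ext s
  by_cases hs : s ∈ Ioi r
  · rw [indicator_of_mem hs, indicator_of_mem hs]
  · rw [indicator_of_notMem hs, indicator_of_notMem hs, mul_zero]

theorem integral_mul_indicator_inv (G : ℝ → ℝ) {r : ℝ} (hr : 0 ≤ r) :
    ∫ s in Ioi (0 : ℝ), G s * (Ioi r).indicator (fun s => s⁻¹) s = ∫ s in Ioi r, G s * s⁻¹ := by
  rw [mul_indicator_inv_eq, setIntegral_indicator measurableSet_Ioi,
    inter_eq_right.2 (Ioi_subset_Ioi hr)]

theorem intervalIntegrable_of_memLp {V : ℝ → ℝ} (hV : MemLp V 2 (volume.restrict (Ioi (0 : ℝ))))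
    {a b : ℝ} (ha : 0 ≤ a) (hab : a ≤ b) : IntervalIntegrable V volume a b := by
  rw [intervalIntegrable_iff_integrableOn_Ioc_of_le hab]
  have h1 : MemLp V 2 (volume.restrict (Ioc a b)) :=
    hV.mono_measure (Measure.restrict_mono (fun x hx => ha.trans_lt hx.1) le_rfl)
  exact h1.integrable (by norm_num)

theorem integrableOn_mul_inv_of_memLp {G : ℝ → ℝ} (hG : MemLp G 2 (volume.restrict (Ioi (0 : ℝ))))
    {r : ℝ} (hr : 0 < r) : IntegrableOn (fun s => G s * s⁻¹) (Ioi r) := by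
  have h1 := hG.integrable_mul (memLp_indicator_inv hr)
  have h2 : Integrable ((Ioi r).indicator fun s => G s * s⁻¹) (volume.restrict (Ioi (0 : ℝ))) := by
    rw [← mul_indicator_inv_eq]; exact h1
  rw [integrable_indicator_iff measurableSet_Ioi, IntegrableOn,
    Measure.restrict_restrict measurableSet_Ioi, inter_eq_left.2 (Ioi_subset_Ioi hr.le)] at h2
  exact h2

/-! ### The relaxed class -/

/-- Pairs of finite energy with the boundary conditions `u(0) = 1` and `f(∞) = 1` only. -/
structure IsRelaxed (α β γ : ℝ) (u f : ℝ → ℝ) : Prop where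
  finite_energy : energy α β γ u f < ⊤
  ac_u : LocallyAC u
  ac_f : LocallyAC f
  u_zero : Tendsto u (𝓝[>] 0) (𝓝 1)
  f_infty : Tendsto f atTop (𝓝 1)

theorem Admissible.isRelaxed {α β γ : ℝ} {u f : ℝ → ℝ} (h : Admissible α β γ u f) :
    IsRelaxed α β γ u f :=
  ⟨h.finite_energy, h.ac_u, h.ac_f, h.boundary.u_zero, h.boundary.f_infty⟩

theorem IsRelaxed.memLp_deriv_u {α β γ : ℝ} {u f : ℝ → ℝ} (hα : 0 < α) (hβ : 0 < β) (hγ : 0 ≤ γ)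
    (h : IsRelaxed α β γ u f) : MemLp (deriv u) 2 (volume.restrict (Ioi (0 : ℝ))) :=
  memLp_two_of_integrableOn_sq (measurable_deriv u).aestronglyMeasurable
    (integrableOn_energy_terms hα hβ hγ h.ac_u.continuousOn h.ac_f.continuousOn
      h.finite_energy).1

theorem IsRelaxed.memLp_mul_deriv_f {α β γ : ℝ} {u f : ℝ → ℝ} (hα : 0 < α) (hβ : 0 < β)
    (hγ : 0 ≤ γ) (h : IsRelaxed α β γ u f) :
    MemLp (fun r => r * deriv f r) 2 (volume.restrict (Ioi (0 : ℝ))) := by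
  refine memLp_two_of_integrableOn_sq
    (measurable_id.mul (measurable_deriv f)).aestronglyMeasurable ?_
  have := (integrableOn_energy_terms hα hβ hγ h.ac_u.continuousOn h.ac_f.continuousOn
      h.finite_energy).2.2.1
  simpa only [mul_pow] using this

/-- Since u' is square integrable up to the origin, the condition u(0) = 1 is encoded in this
formula, which is continuous under weak convergence of u'. -/
theorem IsRelaxed.u_eq {α β γ : ℝ} {u f : ℝ → ℝ} (hα : 0 < α) (hβ : 0 < β) (hγ : 0 ≤ γ)
    (h : IsRelaxed α β γ u f) {r : ℝ} (hr : 0 < r) : u r = 1 + ∫ s in (0 : ℝ)..r, deriv u s := by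
  have hii := intervalIntegrable_of_memLp (h.memLp_deriv_u hα hβ hγ) le_rfl hr.le
  have hc := intervalIntegral.continuousOn_primitive_interval' hii (a := r) right_mem_uIcc
  have h1 : Tendsto (fun a => ∫ s in r..a, deriv u s) (𝓝[>] 0) (𝓝 (∫ s in r..0, deriv u s)) := by
    refine (hc 0 left_mem_uIcc).mono_left ?_
    rw [uIcc_of_le hr.le]
    exact nhdsWithin_le_of_mem (Icc_mem_nhdsGT hr)
  have h2 : Tendsto (fun a => u a - ∫ s in r..a, deriv u s) (𝓝[>] 0) (𝓝 (u r)) := by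
    refine tendsto_const_nhds.congr' ?_
    filter_upwards [Ioc_mem_nhdsGT hr] with a ha
    have := (h.ac_u a r ha.1 ha.2).integral_deriv_eq_sub
    rw [intervalIntegral.integral_symm]
    linarith
  have := tendsto_nhds_unique h2 (h.u_zero.sub h1)
  rw [this, intervalIntegral.integral_symm r 0]
  ring

/-- The integrand is kept as the product of s f', controlled in L² by the energy, and s⁻¹, which is
in L² away from 0. This makes f(r) a weakly continuous functional of s f'. -/
theorem IsRelaxed.f_eq {α β γ : ℝ} {u f : ℝ → ℝ} (hα : 0 < α) (hβ : 0 < β) (hγ : 0 ≤ γ)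
    (h : IsRelaxed α β γ u f) {r : ℝ} (hr : 0 < r) :
    f r = 1 - ∫ s in Ioi r, s * deriv f s * s⁻¹ := by
  have hi := integrableOn_mul_inv_of_memLp (h.memLp_mul_deriv_f hα hβ hγ) hr
  have h1 := intervalIntegral_tendsto_integral_Ioi r hi tendsto_id
  have h2 : Tendsto (fun b => f b - ∫ s in r..b, s * deriv f s * s⁻¹) atTop (𝓝 (f r)) := by
    refine tendsto_const_nhds.congr' ?_
    filter_upwards [eventually_ge_atTop r] with b hb
    have h3 := (h.ac_f r b hr hb).integral_deriv_eq_sub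
    have h4 : ∫ s in r..b, s * deriv f s * s⁻¹ = ∫ s in r..b, deriv f s := by
      refine intervalIntegral.integral_congr fun s hs => ?_
      rw [uIcc_of_le hb] at hs
      have : s ≠ 0 := (hr.trans_le hs.1).ne'
      field_simp
    rw [h4]
    linarith
  exact tendsto_nhds_unique h2 (h.f_infty.sub h1)

/-- The function with derivative `V` and limit `1` at the origin. -/
theorem primitive_from_zero {V : ℝ → ℝ} (hV : MemLp V 2 (volume.restrict (Ioi (0 : ℝ)))) :
    LocallyAC (fun r => 1 + ∫ s in (0 : ℝ)..r, V s) ∧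
    (∀ᵐ r ∂volume.restrict (Ioi (0 : ℝ)), deriv (fun r => 1 + ∫ s in (0 : ℝ)..r, V s) r = V r) ∧
    Tendsto (fun r => 1 + ∫ s in (0 : ℝ)..r, V s) (𝓝[>] 0) (𝓝 1) := by
  have hii := fun (b : ℝ) (hb : 0 ≤ b) => intervalIntegrable_of_memLp hV le_rfl hb
  have hc1 : ∀ c d : ℝ, AbsolutelyContinuousOnInterval (fun _ => (1 : ℝ)) c d := fun c d =>
    (LipschitzWith.const (1 : ℝ)).lipschitzOnWith.absolutelyContinuousOnInterval
  have hac : ∀ b, 0 ≤ b → AbsolutelyContinuousOnInterval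
      (fun r => 1 + ∫ s in (0 : ℝ)..r, V s) 0 b := fun b hb =>
    (hc1 0 b).fun_add
      ((hii b hb).absolutelyContinuousOnInterval_intervalIntegral left_mem_uIcc)
  refine ⟨fun a b ha hab => (hac b (ha.le.trans hab)).mono ?_, ?_, ?_⟩
  · rw [uIcc_of_le hab, uIcc_of_le (ha.le.trans hab)]
    exact Icc_subset_Icc_left ha.le
  · refine ae_restrict_Ioi_of_forall_Icc fun a b ha hab => ?_
    filter_upwards [ae_eq_deriv_primitive (ha.le.trans hab) (left_mem_Icc.2 (ha.le.trans hab))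
      (hii b (ha.le.trans hab))] with r hr hrm
    exact ((hr ⟨ha.le.trans hrm.1, hrm.2⟩).const_add 1).deriv
  · have h1 := (hac 1 zero_le_one).continuousOn 0 left_mem_uIcc
    rw [uIcc_of_le zero_le_one] at h1
    have h2 : Tendsto (fun r => 1 + ∫ s in (0 : ℝ)..r, V s) (𝓝[>] 0)
        (𝓝 (1 + ∫ s in (0 : ℝ)..0, V s)) :=
      h1.mono_left (nhdsWithin_le_of_mem (Icc_mem_nhdsGT one_pos))
    simpa using h2

/-- The function with derivative `K` and limit `1` at infinity. -/
theorem primitive_from_infty {K : ℝ → ℝ} (hK : ∀ r, 0 < r → IntegrableOn K (Ioi r)) :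
    LocallyAC (fun r => 1 - ∫ s in Ioi r, K s) ∧
    (∀ᵐ r ∂volume.restrict (Ioi (0 : ℝ)), deriv (fun r => 1 - ∫ s in Ioi r, K s) r = K r) ∧
    Tendsto (fun r => 1 - ∫ s in Ioi r, K s) atTop (𝓝 1) := by
  have hii : ∀ a b : ℝ, 0 < a → a ≤ b → IntervalIntegrable K volume a b := by
    intro a b ha hab
    rw [intervalIntegrable_iff_integrableOn_Ioc_of_le hab]
    exact (hK a ha).mono_set Ioc_subset_Ioi_self
  have heq : ∀ a r : ℝ, 0 < a → a ≤ r →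
      1 - ∫ s in Ioi r, K s = (1 - ∫ s in Ioi a, K s) + ∫ s in a..r, K s := by
    intro a r ha har
    have := intervalIntegral.integral_Ioi_sub_Ioi (hK a ha) har
    linarith
  have hcst : ∀ (k : ℝ) (c d : ℝ), AbsolutelyContinuousOnInterval (fun _ => k) c d := fun k c d =>
    (LipschitzWith.const k).lipschitzOnWith.absolutelyContinuousOnInterval
  refine ⟨fun a b ha hab => ?_, ?_, ?_⟩
  · refine AbsolutelyContinuousOnInterval_congr ((hcst (1 - ∫ s in Ioi a, K s) a b).fun_add
      ((hii a b ha hab).absolutelyContinuousOnInterval_intervalIntegral left_mem_uIcc)) ?_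
    intro r hr
    rw [uIcc_of_le hab] at hr
    exact (heq a r ha hr.1).symm
  · refine ae_restrict_Ioi_of_forall_Icc fun a b ha hab => ?_
    have ha2 : 0 < a / 2 := by linarith
    filter_upwards [ae_eq_deriv_primitive (show a / 2 ≤ b by linarith)
      (left_mem_Icc.2 (show a / 2 ≤ b by linarith)) (hii (a / 2) b ha2 (by linarith))]
      with r hr hrm
    have h1 := (hr ⟨by linarith [hrm.1], hrm.2⟩).const_add (1 - ∫ s in Ioi (a / 2), K s)
    refine (h1.congr_of_eventuallyEq ?_).deriv
    filter_upwards [lt_mem_nhds (show a / 2 < r by linarith [hrm.1])] with s hs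
    exact heq _ _ ha2 hs.le
  · have h1 := intervalIntegral_tendsto_integral_Ioi 1 (hK 1 one_pos) tendsto_id
    have h2 : Tendsto (fun r => (1 - ∫ s in Ioi (1 : ℝ), K s) + ∫ s in (1 : ℝ)..r, K s) atTop
        (𝓝 ((1 - ∫ s in Ioi (1 : ℝ), K s) + ∫ s in Ioi (1 : ℝ), K s)) := h1.const_add _
    rw [sub_add_cancel] at h2
    refine h2.congr' ?_
    filter_upwards [eventually_ge_atTop 1] with r hr
    exact (heq 1 r one_pos hr).symm

end

/-! ### Existence in the relaxed class -/

section

/-- The part of the energy density without derivatives. -/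
noncomputable def potentialDensity (α β γ : ℝ) (u f : ℝ → ℝ) (r : ℝ) : ℝ :=
  (1 - u r ^ 2) ^ 2 / r ^ 2 + α * (β * f r ^ 2 * u r ^ 2)
    + α * γ / 2 * r ^ 2 * (f r ^ 2 - 1) ^ 2

/-- The two parts are treated differently in the limit: the first is a quadratic form in the weakly
convergent functions U and F, the second involves only pointwise values. -/
theorem energy_eq_kinetic_add_potential {α β γ : ℝ} {u f U F : ℝ → ℝ} (hα : 0 ≤ α) (hβ : 0 ≤ β)
    (hγ : 0 ≤ γ) (hU : MemLp U 2 (volume.restrict (Ioi (0 : ℝ))))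
    (hF : MemLp F 2 (volume.restrict (Ioi (0 : ℝ))))
    (hdu : ∀ᵐ r ∂volume.restrict (Ioi (0 : ℝ)), deriv u r = U r)
    (hdf : ∀ᵐ r ∂volume.restrict (Ioi (0 : ℝ)), r * deriv f r = F r) :
    energy α β γ u f = ENNReal.ofReal (∫ r in Ioi (0 : ℝ), (2 * U r ^ 2 + α * F r ^ 2))
      + ∫⁻ r in Ioi (0 : ℝ), ENNReal.ofReal (potentialDensity α β γ u f r) := by
  have hi : IntegrableOn (fun r => 2 * U r ^ 2 + α * F r ^ 2) (Ioi 0) :=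
    (hU.integrable_sq.const_mul 2).add (hF.integrable_sq.const_mul α)
  rw [ofReal_integral_eq_lintegral_ofReal hi (Eventually.of_forall fun r => by positivity),
    ← lintegral_add_left' hi.aestronglyMeasurable.aemeasurable.ennreal_ofReal]
  refine lintegral_congr_ae ?_
  filter_upwards [hdu, hdf] with r h1 h2
  rw [← ENNReal.ofReal_add (by positivity) (by unfold potentialDensity; positivity), ← h1, ← h2]
  congr 1
  unfold energyDensity potentialDensity
  ring

/-- A competitor showing that the relaxed class is not empty: its density is bounded on (0, 1] and
equals r⁻² beyond. -/
theorem isRelaxed_test (α β γ : ℝ) (hα : 0 ≤ α) (hβ : 0 ≤ β) (hγ : 0 ≤ γ) :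
    IsRelaxed α β γ (fun r => max (1 - r) 0) (fun r => min r 1) := by
  have hLu : LipschitzWith 1 (fun r : ℝ => max (1 - r) 0) := by
    refine LipschitzWith.max_const ?_ 0
    refine LipschitzWith.of_dist_le_mul fun x y => ?_
    rw [dist_sub_left, NNReal.coe_one, one_mul]
  have hLf : LipschitzWith 1 (fun r : ℝ => min r 1) := LipschitzWith.id.min_const 1
  have hu : LocallyAC (fun r : ℝ => max (1 - r) 0) := fun a b _ _ =>
    hLu.lipschitzOnWith.absolutelyContinuousOnInterval
  have hf : LocallyAC (fun r : ℝ => min r 1) := fun a b _ _ =>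
    hLf.lipschitzOnWith.absolutelyContinuousOnInterval
  have hm := aemeasurable_energyDensity (α := α) (β := β) (γ := γ) hu hf
  refine ⟨?_, hu, hf, ?_, ?_⟩
  · have hi : IntegrableOn (energyDensity α β γ (fun r => max (1 - r) 0) (fun r => min r 1))
        (Ioc 0 1 ∪ Ioi 1) := by
      rw [Ioc_union_Ioi_eq_Ioi zero_le_one]
      rw [← Ioc_union_Ioi_eq_Ioi (zero_le_one' ℝ)] at hm ⊢
      refine IntegrableOn.union ?_ ?_
      · refine Integrable.mono' (g := fun _ => 2 + 4 + α * (1 + β) + α * γ / 2)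
          (integrableOn_const (by simp))
          (hm.mono_measure (Measure.restrict_mono subset_union_left le_rfl)).aestronglyMeasurable ?_
        filter_upwards [self_mem_ae_restrict measurableSet_Ioc] with r hr
        rw [Real.norm_of_nonneg (energyDensity_nonneg hα hβ hγ _ _ r)]
        unfold energyDensity
        have d1 : deriv (fun r : ℝ => max (1 - r) 0) r ^ 2 ≤ 1 := by
          have := norm_deriv_le_of_lipschitz hLu (x₀ := r)
          rw [Real.norm_eq_abs, NNReal.coe_one] at this
          rw [← sq_abs]; exact pow_le_one₀ (abs_nonneg _) this
        have d2 : deriv (fun r : ℝ => min r 1) r ^ 2 ≤ 1 := by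
          have := norm_deriv_le_of_lipschitz hLf (x₀ := r)
          rw [Real.norm_eq_abs, NNReal.coe_one] at this
          rw [← sq_abs]; exact pow_le_one₀ (abs_nonneg _) this
        have hr0 : 0 < r := hr.1
        have hr2 : r ^ 2 ≤ 1 := pow_le_one₀ hr0.le hr.2
        have e1 : max (1 - r) 0 = 1 - r := max_eq_left (by linarith [hr.2])
        have e2 : min r 1 = r := min_eq_left hr.2
        simp only [e1, e2]
        have t1 : (1 - (1 - r) ^ 2) ^ 2 / r ^ 2 ≤ 4 := by
          rw [div_le_iff₀ (pow_pos hr0 2)]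
          have : (1 - (1 - r) ^ 2) ^ 2 = r ^ 2 * (2 - r) ^ 2 := by ring
          rw [this]
          nlinarith [hr.2, mul_nonneg (sq_nonneg r) (mul_nonneg hr0.le (by linarith [hr.2] : 0 ≤ 4 - r))]
        have t2 : r ^ 2 * deriv (fun r : ℝ => min r 1) r ^ 2 ≤ 1 :=
          mul_le_one₀ hr2 (sq_nonneg _) d2
        have t3 : β * r ^ 2 * (1 - r) ^ 2 ≤ β := by
          have : (1 - r) ^ 2 ≤ 1 := by nlinarith [hr.2]
          rw [mul_assoc]
          exact mul_le_of_le_one_right hβ (mul_le_one₀ hr2 (sq_nonneg _) this)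
        have t4 : α * γ / 2 * r ^ 2 * (r ^ 2 - 1) ^ 2 ≤ α * γ / 2 := by
          have : (r ^ 2 - 1) ^ 2 ≤ 1 := by nlinarith [sq_nonneg r]
          rw [mul_assoc]
          exact mul_le_of_le_one_right (by positivity) (mul_le_one₀ hr2 (sq_nonneg _) this)
        have t5 := mul_le_mul_of_nonneg_left (add_le_add t2 t3) hα
        linarith
      · refine (integrableOn_inv_sq one_pos).congr_fun (fun r hr => ?_) measurableSet_Ioi
        have d1 : deriv (fun r : ℝ => max (1 - r) 0) r = 0 := by
          have : (fun r : ℝ => max (1 - r) 0) =ᶠ[𝓝 r] fun _ => 0 := by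
            filter_upwards [isOpen_Ioi.mem_nhds hr] with s hs
            exact max_eq_right (by linarith [mem_Ioi.1 hs])
          simpa using this.deriv_eq
        have d2 : deriv (fun r : ℝ => min r 1) r = 0 := by
          have : (fun r : ℝ => min r 1) =ᶠ[𝓝 r] fun _ => 1 := by
            filter_upwards [isOpen_Ioi.mem_nhds hr] with s hs
            exact min_eq_right (le_of_lt hs)
          simpa using this.deriv_eq
        have e1 : max (1 - r) 0 = 0 := max_eq_right (by linarith [mem_Ioi.1 hr])
        have e2 : min r 1 = 1 := min_eq_right (le_of_lt hr)
        unfold energyDensity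
        simp [d1, d2, e1, e2]
    rw [Ioc_union_Ioi_eq_Ioi zero_le_one] at hi
    rw [energy_eq_ofReal_integral hα hβ hγ hi]
    exact ENNReal.ofReal_lt_top
  · have : Tendsto (fun r : ℝ => max (1 - r) 0) (𝓝 0) (𝓝 (max (1 - 0) 0)) :=
      hLu.continuous.tendsto 0
    norm_num at this
    exact this.mono_left nhdsWithin_le_nhds
  · refine tendsto_const_nhds.congr' ?_
    filter_upwards [eventually_ge_atTop 1] with r hr using (min_eq_right hr).symm

theorem IsRelaxed.integral_sq_le {α β γ : ℝ} {u f : ℝ → ℝ} (hα : 0 < α) (hβ : 0 < β)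
    (hγ : 0 ≤ γ) (h : IsRelaxed α β γ u f) {E : ENNReal} (hE : E ≠ ⊤)
    (hle : energy α β γ u f ≤ E) :
    ∫ r in Ioi (0 : ℝ), deriv u r ^ 2 ≤ E.toReal ∧
    ∫ r in Ioi (0 : ℝ), (r * deriv f r) ^ 2 ≤ α⁻¹ * E.toReal := by
  have hi := integrableOn_energyDensity hα.le hβ.le hγ h.ac_u h.ac_f h.finite_energy
  rw [energy_eq_ofReal_integral hα.le hβ.le hγ hi, ENNReal.ofReal_le_iff_le_toReal hE] at hle
  constructor
  · refine le_trans ?_ hle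
    refine integral_mono_of_nonneg (Eventually.of_forall fun r => sq_nonneg _) hi
      (Eventually.of_forall fun r => ?_)
    unfold energyDensity
    have h1 : 0 ≤ (1 - u r ^ 2) ^ 2 / r ^ 2 + α * (r ^ 2 * deriv f r ^ 2 + β * f r ^ 2 * u r ^ 2)
      + α * γ / 2 * r ^ 2 * (f r ^ 2 - 1) ^ 2 := by positivity
    simp only
    linarith [sq_nonneg (deriv u r)]
  · refine le_trans ?_ (mul_le_mul_of_nonneg_left hle (inv_nonneg.2 hα.le))
    rw [← integral_const_mul]
    refine integral_mono_of_nonneg (Eventually.of_forall fun r => sq_nonneg _)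
      (hi.const_mul _) (Eventually.of_forall fun r => ?_)
    simp only
    rw [le_inv_mul_iff₀ hα]
    unfold energyDensity
    have h1 : 0 ≤ 2 * deriv u r ^ 2 + (1 - u r ^ 2) ^ 2 / r ^ 2 + α * (β * f r ^ 2 * u r ^ 2)
      + α * γ / 2 * r ^ 2 * (f r ^ 2 - 1) ^ 2 := by positivity
    linarith

theorem ennreal_liminf_add_le (a b : ℕ → ENNReal) :
    liminf a atTop + liminf b atTop ≤ liminf (fun n => a n + b n) atTop := by
  simp only [liminf_eq_iSup_iInf_of_nat]
  have hmono : ∀ c : ℕ → ENNReal, Monotone fun n => ⨅ i ≥ n, c i := fun c m n hmn =>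
    le_iInf₂ fun i hi => iInf₂_le i (hmn.trans hi)
  rw [ENNReal.iSup_add_iSup_of_monotone (hmono a) (hmono b)]
  exact iSup_mono fun n => le_iInf₂ fun i hi => add_le_add (iInf₂_le i hi) (iInf₂_le i hi)

/-- The direct method in the relaxed class. -/
theorem exists_relaxed_minimizer {α β γ : ℝ} (hα : 0 < α) (hβ : 0 < β) (hγ : 0 ≤ γ) :
    ∃ u f : ℝ → ℝ, IsRelaxed α β γ u f ∧
      ∀ v g : ℝ → ℝ, IsRelaxed α β γ v g → energy α β γ u f ≤ energy α β γ v g := by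
  set S : Set ENNReal := {e | ∃ u f, IsRelaxed α β γ u f ∧ energy α β γ u f = e} with hS
  have hne : S.Nonempty := ⟨_, _, _, isRelaxed_test α β γ hα.le hβ.le hγ, rfl⟩
  obtain ⟨e, he_anti, he_lim, heS⟩ := exists_seq_tendsto_sInf hne (OrderBot.bddBelow S)
  choose u f huf hen using heS
  have he0 : e 0 ≠ ⊤ := by rw [← hen 0]; exact (huf 0).finite_energy.ne
  have hbd := fun n => (huf n).integral_sq_le hα hβ hγ he0
    ((hen n).le.trans (he_anti (Nat.zero_le n)))
  -- The energy bound controls u' and r f' in L². Weak limits are extracted successively, the second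
  -- along the first subsequence.
  obtain ⟨V, φ₁, hV, hφ₁, hVw⟩ := exists_weak_limit
    (fun n => (huf n).memLp_deriv_u hα hβ hγ) (fun n => (hbd n).1)
  obtain ⟨G, φ₂, hG, hφ₂, hGw⟩ := exists_weak_limit
    (fun n => (huf (φ₁ n)).memLp_mul_deriv_f hα hβ hγ) (fun n => (hbd (φ₁ n)).2)
  set φ : ℕ → ℕ := fun n => φ₁ (φ₂ n) with hφ
  have hφm : StrictMono φ := hφ₁.comp hφ₂
  have hVw' : ∀ w : ℝ → ℝ, MemLp w 2 (volume.restrict (Ioi (0 : ℝ))) →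
      Tendsto (fun n => ∫ r in Ioi (0 : ℝ), deriv (u (φ n)) r * w r) atTop
        (𝓝 (∫ r in Ioi (0 : ℝ), V r * w r)) := fun w hw =>
    (hVw w hw).comp hφ₂.tendsto_atTop
  obtain ⟨hac_u, hder_u, hlim_u⟩ := primitive_from_zero hV
  obtain ⟨hac_f, hder_f, hlim_f⟩ := primitive_from_infty
    (fun r hr => integrableOn_mul_inv_of_memLp hG hr)
  set u₀ : ℝ → ℝ := fun r => 1 + ∫ s in (0 : ℝ)..r, V s with hu₀
  set f₀ : ℝ → ℝ := fun r => 1 - ∫ s in Ioi r, G s * s⁻¹ with hf₀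
  have hder_f' : ∀ᵐ r ∂volume.restrict (Ioi (0 : ℝ)), r * deriv f₀ r = G r := by
    filter_upwards [hder_f, self_mem_ae_restrict measurableSet_Ioi] with r hr hr0
    rw [hr, mul_comm (G r), ← mul_assoc, mul_inv_cancel₀ (ne_of_gt hr0), one_mul]
  have hpt_u : ∀ r, 0 < r → Tendsto (fun n => u (φ n) r) atTop (𝓝 (u₀ r)) := by
    intro r hr
    have := (hVw' _ (memLp_indicator_Ioc r)).const_add 1
    simp only [integral_mul_indicator_Ioc _ hr.le] at this
    exact this.congr fun n => ((huf (φ n)).u_eq hα hβ hγ hr).symm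
  have hpt_f : ∀ r, 0 < r → Tendsto (fun n => f (φ n) r) atTop (𝓝 (f₀ r)) := by
    intro r hr
    have := (hGw _ (memLp_indicator_inv hr)).const_sub 1
    simp only [integral_mul_indicator_inv _ hr.le] at this
    exact this.congr fun n => ((huf (φ n)).f_eq hα hβ hγ hr).symm
  set K : ℕ → ℝ := fun n => ∫ r in Ioi (0 : ℝ),
    (2 * deriv (u (φ n)) r ^ 2 + α * (r * deriv (f (φ n)) r) ^ 2) with hK
  set K₀ : ℝ := ∫ r in Ioi (0 : ℝ), (2 * V r ^ 2 + α * G r ^ 2) with hK₀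
  have hkin : ENNReal.ofReal K₀ ≤ liminf (fun n => ENNReal.ofReal (K n)) atTop := by
    -- Weak lower semicontinuity by x² ≥ 2xy - y² with y the weak limit: the resulting lower bound
    -- is affine in the sequence and converges to `K₀`.
    set B : ℕ → ℝ := fun n => 4 * (∫ r in Ioi (0 : ℝ), deriv (u (φ n)) r * V r)
      + 2 * α * (∫ r in Ioi (0 : ℝ), (r * deriv (f (φ n)) r) * G r) - K₀ with hB
    have hBlim : Tendsto B atTop (𝓝 K₀) := by
      have h1 := (((hVw' V hV).const_mul 4).add ((hGw G hG).const_mul (2 * α))).sub_const K₀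
      have e : 4 * (∫ r in Ioi (0 : ℝ), V r * V r) + 2 * α * (∫ r in Ioi (0 : ℝ), G r * G r) - K₀
          = K₀ := by
        have : K₀ = 2 * (∫ r in Ioi (0 : ℝ), V r * V r) + α * ∫ r in Ioi (0 : ℝ), G r * G r := by
          rw [hK₀, integral_add (hV.integrable_sq.const_mul 2) (hG.integrable_sq.const_mul α),
            integral_const_mul, integral_const_mul]
          simp only [pow_two]
        rw [this]; ring
      rw [e] at h1
      exact h1
    have hBK : ∀ n, B n ≤ K n := by
      intro n
      have hU := (huf (φ n)).memLp_deriv_u hα hβ hγ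
      have hF := (huf (φ n)).memLp_mul_deriv_f hα hβ hγ
      have i1 : Integrable (fun r => 4 * (deriv (u (φ n)) r * V r))
          (volume.restrict (Ioi (0 : ℝ))) := (hU.integrable_mul hV).const_mul 4
      have i2 : Integrable (fun r => 2 * α * ((r * deriv (f (φ n)) r) * G r))
          (volume.restrict (Ioi (0 : ℝ))) := (hF.integrable_mul hG).const_mul (2 * α)
      have i12 : Integrable (fun r => 4 * (deriv (u (φ n)) r * V r)
          + 2 * α * ((r * deriv (f (φ n)) r) * G r)) (volume.restrict (Ioi (0 : ℝ))) := i1.add i2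
      have i3 : Integrable (fun r => 2 * V r ^ 2 + α * G r ^ 2)
          (volume.restrict (Ioi (0 : ℝ))) :=
        (hV.integrable_sq.const_mul 2).add (hG.integrable_sq.const_mul α)
      have i4 : Integrable (fun r => 2 * deriv (u (φ n)) r ^ 2
          + α * (r * deriv (f (φ n)) r) ^ 2) (volume.restrict (Ioi (0 : ℝ))) :=
        (hU.integrable_sq.const_mul 2).add (hF.integrable_sq.const_mul α)
      simp only [hB, hK, hK₀]
      rw [← integral_const_mul, ← integral_const_mul, ← integral_add i1 i2,
        ← integral_sub i12 i3]
      refine integral_mono (i12.sub i3) i4 fun r => ?_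
      simp only
      have := mul_nonneg hα.le (sq_nonneg (r * deriv (f (φ n)) r - G r))
      nlinarith [sq_nonneg (deriv (u (φ n)) r - V r)]
    rw [← (ENNReal.tendsto_ofReal hBlim).liminf_eq]
    exact liminf_le_liminf (Eventually.of_forall fun n => ENNReal.ofReal_le_ofReal (hBK n))
  have hpot : ∫⁻ r in Ioi (0 : ℝ), ENNReal.ofReal (potentialDensity α β γ u₀ f₀ r) ≤
      liminf (fun n => ∫⁻ r in Ioi (0 : ℝ),
        ENNReal.ofReal (potentialDensity α β γ (u (φ n)) (f (φ n)) r)) atTop := by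
    refine le_trans (le_of_eq ?_) (lintegral_liminf_le' fun n => ?_)
    · refine setLIntegral_congr_fun measurableSet_Ioi fun r hr => ?_
      have h1 := hpt_u r hr
      have h2 := hpt_f r hr
      refine (ENNReal.tendsto_ofReal ?_).liminf_eq.symm
      unfold potentialDensity
      exact (((((h1.pow 2).const_sub 1).pow 2).div_const _).add
        ((((h2.pow 2).const_mul β).mul (h1.pow 2)).const_mul α)).add
        ((((h2.pow 2).sub_const 1).pow 2).const_mul _)
    · have h1 : AEMeasurable (u (φ n)) (volume.restrict (Ioi 0)) :=
        (huf (φ n)).ac_u.continuousOn.aemeasurable measurableSet_Ioi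
      have h2 : AEMeasurable (f (φ n)) (volume.restrict (Ioi 0)) :=
        (huf (φ n)).ac_f.continuousOn.aemeasurable measurableSet_Ioi
      unfold potentialDensity
      fun_prop
  have hmain : energy α β γ u₀ f₀ ≤ sInf S := by
    rw [energy_eq_kinetic_add_potential hα.le hβ.le hγ hV hG hder_u hder_f']
    refine (add_le_add hkin hpot).trans ((ennreal_liminf_add_le _ _).trans (le_of_eq ?_))
    refine (Tendsto.congr (fun n => ?_) (he_lim.comp hφm.tendsto_atTop)).liminf_eq
    rw [Function.comp_apply, ← hen (φ n)]
    exact energy_eq_kinetic_add_potential hα.le hβ.le hγ ((huf (φ n)).memLp_deriv_u hα hβ hγ)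
      ((huf (φ n)).memLp_mul_deriv_f hα hβ hγ) (Eventually.of_forall fun _ => rfl)
      (Eventually.of_forall fun _ => rfl)
  have hle : ∀ v g : ℝ → ℝ, IsRelaxed α β γ v g → energy α β γ u₀ f₀ ≤ energy α β γ v g :=
    fun v g hvg => hmain.trans (sInf_le ⟨v, g, hvg, rfl⟩)
  exact ⟨u₀, f₀, ⟨(hle _ _ (huf 0)).trans_lt (huf 0).finite_energy, hac_u, hac_f, hlim_u, hlim_f⟩,
    hle⟩

end

/-! ### Existence and regularity of minimizers -/

section

variable {α β γ : ℝ} {u f : ℝ → ℝ}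

/-- Only u(0) = 1 and f(∞) = 1 are assumed; the other two boundary conditions are consequences of
the equations and finite energy. -/
theorem IsCompactlyMinimal.isProfile (hα : 0 < α) (hβ : 0 < β) (hγ : 0 ≤ γ)
    (h : IsCompactlyMinimal α β γ u f) (hu : ∀ r, 0 < r → 0 ≤ u r ∧ u r ≤ 1)
    (hf : ∀ r, 0 < r → 0 ≤ f r ∧ f r ≤ 1) (hu0 : Tendsto u (𝓝[>] 0) (𝓝 1))
    (hfi : Tendsto f atTop (𝓝 1)) : IsProfile α β γ u f := by
  have hel := h.solvesEulerLagrange hα hβ hγ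
  obtain ⟨i1, -, i3, i4⟩ := integrableOn_energy_terms hα hβ hγ h.ac_u.continuousOn
    h.ac_f.continuousOn h.finite_energy
  have hup := hel.u_pos (fun r hr => (hu r hr).1) hu0
  have hfp := hel.f_pos (fun r hr => (hf r hr).1) hfi
  have hu1 := hel.u_lt_one hα hβ (fun r hr => (hu r hr).2) hfp
  have hf1 := hel.f_lt_one hβ (fun r hr => (hf r hr).2) hup
  exact ⟨hel, fun r hr => ⟨hup r hr, hu1 r hr, hfp r hr, hf1 r hr⟩,
    ⟨hel.tendsto_f_zero hβ hγ hu0 (fun r hr => ⟨hfp r hr, hf1 r hr⟩) i3, hu0, hfi,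
      hel.tendsto_u_atTop hfi i1 i4⟩⟩

theorem trunc_zero : trunc 0 = 0 := by simp [trunc]

theorem trunc_one : trunc 1 = 1 := by simp [trunc]

theorem tendsto_trunc {l : Filter ℝ} {v : ℝ → ℝ} {x : ℝ} (h : Tendsto v l (𝓝 x)) :
    Tendsto (fun r => trunc (v r)) l (𝓝 (trunc x)) :=
  (lipschitzWith_trunc.continuous.tendsto x).comp h

/-- Compactly supported perturbations of the truncated relaxed minimizer remain in the relaxed
class, so the truncation solves the equations and acquires the missing boundary conditions. Being
minimal in the larger class, it is minimal among admissible pairs. -/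
theorem exists_isMinimizer (hα : 0 < α) (hβ : 0 < β) (hγ : 0 ≤ γ) :
    ∃ u f : ℝ → ℝ, IsMinimizer α β γ u f := by
  obtain ⟨v, g, hvg, hmin⟩ := exists_relaxed_minimizer hα hβ hγ
  set u : ℝ → ℝ := fun r => trunc (v r) with hu
  set f : ℝ → ℝ := fun r => trunc (g r) with hf
  have hle : energy α β γ u f ≤ energy α β γ v g :=
    energy_trunc_le hα.le hβ.le hγ hvg.ac_u hvg.ac_f
  have hu0 : Tendsto u (𝓝[>] 0) (𝓝 1) := trunc_one ▸ tendsto_trunc hvg.u_zero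
  have hfi : Tendsto f atTop (𝓝 1) := trunc_one ▸ tendsto_trunc hvg.f_infty
  have hac_u : LocallyAC u := hvg.ac_u.lipschitz_comp lipschitzWith_trunc
  have hac_f : LocallyAC f := hvg.ac_f.lipschitz_comp lipschitzWith_trunc
  have hfin := hle.trans_lt hvg.finite_energy
  have hcm : IsCompactlyMinimal α β γ u f := by
    refine ⟨hfin, hac_u, hac_f, ?_⟩
    intro φ ψ a b ha hab hφ0 hψ0 hφ hψ
    by_cases hfin' : energy α β γ (fun r => u r + φ r) (fun r => f r + ψ r) < ⊤
    · exact hle.trans (hmin _ _ ⟨hfin', hac_u.add fun c d _ _ => hφ c d,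
        hac_f.add fun c d _ _ => hψ c d, tendsto_nhdsGT_zero_add_of_support ha hφ0 hu0,
        tendsto_atTop_add_of_support hψ0 hfi⟩)
    · rw [not_lt, top_le_iff] at hfin'
      rw [hfin']
      exact le_top
  have hp := hcm.isProfile hα hβ hγ (fun r _ => ⟨trunc_nonneg _, trunc_le_one _⟩)
    (fun r _ => ⟨trunc_nonneg _, trunc_le_one _⟩) hu0 hfi
  exact ⟨u, f, ⟨hfin, hac_u, hac_f, hp.boundary⟩,
    fun w k hwk => hle.trans (hmin w k hwk.isRelaxed)⟩

theorem pos_of_ne_zero_of_tendsto {v : ℝ → ℝ} {l : Filter ℝ} [l.NeBot] (hl : ∀ᶠ r in l, 0 < r)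
    (hc : ContinuousOn v (Ioi 0)) (h0 : ∀ r, 0 < r → v r ≠ 0) (hv : Tendsto v l (𝓝 1)) :
    ∀ r, 0 < r → 0 < v r := by
  intro r hr
  by_contra! hle
  obtain ⟨s, hs1, hs2⟩ := ((hv.eventually_const_lt one_pos).and hl).exists
  obtain ⟨x, hx, hx0⟩ := isPreconnected_Ioi.intermediate_value (mem_Ioi.2 hr) (mem_Ioi.2 hs2) hc
    ⟨hle, hs1.le⟩
  exact h0 x hx hx0

theorem trunc_mem_Ioo {x : ℝ} (h : 0 < trunc x ∧ trunc x < 1) : x ≠ 0 ∧ |x| < 1 := by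
  refine ⟨fun h0 => ?_, ?_⟩
  · rw [h0, trunc_zero] at h
    exact lt_irrefl _ h.1
  · by_contra! h1
    have : trunc x = 1 := min_eq_right h1
    linarith [h.2]

/-- The truncation of a minimizer is again a minimizer and a profile, with strict bounds. These say
that u and f never vanish and stay below 1 in absolute value; the limits 1 at one end and continuity
then fix the signs. -/
theorem IsMinimizer.isProfile (hα : 0 < α) (hβ : 0 < β) (hγ : 0 ≤ γ)
    (h : IsMinimizer α β γ u f) : IsProfile α β γ u f := by
  have hle := energy_trunc_le hα.le hβ.le hγ h.1.ac_u h.1.ac_f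
  obtain ⟨b1, b2, b3, b4⟩ := h.1.boundary
  have hbc : BoundaryConditions (fun r => trunc (u r)) (fun r => trunc (f r)) :=
    ⟨by simpa only [trunc_zero] using tendsto_trunc b1,
      by simpa only [trunc_one] using tendsto_trunc b2,
      by simpa only [trunc_one] using tendsto_trunc b3,
      by simpa only [trunc_zero] using tendsto_trunc b4⟩
  have hmin : IsMinimizer α β γ (fun r => trunc (u r)) (fun r => trunc (f r)) :=
    ⟨⟨hle.trans_lt h.1.finite_energy, LocallyAC.lipschitz_comp lipschitzWith_trunc h.1.ac_u,
      LocallyAC.lipschitz_comp lipschitzWith_trunc h.1.ac_f, hbc⟩,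
      fun v g hvg => hle.trans (h.2 v g hvg)⟩
  have hp := hmin.isCompactlyMinimal.isProfile hα hβ hγ
    (fun r _ => ⟨trunc_nonneg _, trunc_le_one _⟩)
    (fun r _ => ⟨trunc_nonneg _, trunc_le_one _⟩) hbc.u_zero hbc.f_infty
  have hu := fun r (hr : 0 < r) =>
    trunc_mem_Ioo ⟨(hp.bounds r hr).1, (hp.bounds r hr).2.1⟩
  have hf := fun r (hr : 0 < r) =>
    trunc_mem_Ioo ⟨(hp.bounds r hr).2.2.1, (hp.bounds r hr).2.2.2⟩
  have hupos := pos_of_ne_zero_of_tendsto (l := 𝓝[>] (0 : ℝ)) self_mem_nhdsWithin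
    (LocallyAC.continuousOn h.1.ac_u) (fun r hr => (hu r hr).1) b2
  have hfpos := pos_of_ne_zero_of_tendsto (eventually_gt_atTop 0)
    (LocallyAC.continuousOn h.1.ac_f) (fun r hr => (hf r hr).1) b3
  exact ⟨h.isCompactlyMinimal.solvesEulerLagrange hα hβ hγ, fun r hr =>
    ⟨hupos r hr, (abs_lt.1 (hu r hr).2).2, hfpos r hr, (abs_lt.1 (hf r hr).2).2⟩, h.1.boundary⟩

/-- Decay of a profile at infinity and at the origin. -/
theorem IsProfile.decay (hα : 0 < α) (hβ : 0 < β) (h : IsProfile α β γ u f) {ε : ℝ}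
    (hε0 : 0 < ε) (hε1 : ε < 1) :
    u =O[atTop] (fun r : ℝ => Real.exp (-(√(α * β / 2) * (1 - ε) * r))) ∧
    (0 < γ → (fun r : ℝ => 1 - f r) =O[atTop]
      (fun r : ℝ => Real.exp (-(√2 * min (√γ) (√(α * β)) * (1 - ε) * r)))) ∧
    (fun r : ℝ => 1 - u r) =O[𝓝[>] 0] (fun r : ℝ => r ^ (2 * (1 - ε))) ∧
    f =O[𝓝[>] 0] (fun r : ℝ => r ^ ((√(1 / 4 + β) - 1 / 2) * (1 - ε))) := by
  have hε : 0 < 1 - ε := by linarith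
  have hε2 : (1 - ε) ^ 2 < 1 := by nlinarith
  have hab : 0 < α * β := mul_pos hα hβ
  have hκ0 : 0 < √(α * β / 2) * (1 - ε) := by positivity
  have hκ2 : (√(α * β / 2) * (1 - ε)) ^ 2 < α * β / 2 := by
    rw [mul_pow, Real.sq_sqrt (by positivity)]
    exact mul_lt_of_lt_one_right (by positivity) hε2
  refine ⟨h.u_isBigO_infty hκ0 hκ2, fun hγ => ?_, ?_, ?_⟩
  · have hm : 0 < min (√γ) (√(α * β)) := lt_min (Real.sqrt_pos.2 hγ) (Real.sqrt_pos.2 hab)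
    refine h.one_sub_f_isBigO_infty_exp hβ (by positivity) ?_ hκ0 ?_ hκ2
    · rw [mul_pow, mul_pow, Real.sq_sqrt zero_le_two]
      have h1 : min (√γ) (√(α * β)) ^ 2 ≤ γ :=
        (pow_le_pow_left₀ hm.le (min_le_left _ _) 2).trans_eq (Real.sq_sqrt hγ.le)
      have h2 : 0 < min (√γ) (√(α * β)) ^ 2 := by positivity
      nlinarith
    -- The second entry of the minimum is exactly twice the decay rate of u, as the source u²
    -- requires.
    · have h1 : √2 * √(α * β) = 2 * √(α * β / 2) := by
        rw [← Real.sqrt_mul zero_le_two, show (2 : ℝ) * (α * β) = 2 ^ 2 * (α * β / 2) by ring,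
          Real.sqrt_mul (by positivity), Real.sqrt_sq zero_le_two]
      have h2 : √2 * min (√γ) (√(α * β)) ≤ √2 * √(α * β) :=
        mul_le_mul_of_nonneg_left (min_le_right _ _) (Real.sqrt_nonneg _)
      rw [h1] at h2
      rw [← mul_assoc]
      exact mul_le_mul_of_nonneg_right h2 hε.le
  · exact h.one_sub_u_isBigO_zero hα hβ (by linarith) (by linarith)
  · set σ := √(1 / 4 + β) - 1 / 2 with hσ
    -- σ is the positive root of the exponent equation at the origin, so multiplying it by 1 - ε
    -- gives strict inequality.
    have hσ1 : σ * (σ + 1) = β := by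
      have := Real.sq_sqrt (show 0 ≤ 1 / 4 + β by linarith)
      simp only [hσ]
      linear_combination this
    have hσ0 : 0 < σ := by
      have : √(1 / 4 : ℝ) < √(1 / 4 + β) := Real.sqrt_lt_sqrt (by norm_num) (by linarith)
      rw [show (1 / 4 : ℝ) = (1 / 2) ^ 2 by norm_num, Real.sqrt_sq (by norm_num)] at this
      simp only [hσ]
      norm_num at this ⊢
      linarith
    refine h.f_isBigO_zero (by positivity) ?_
    have h1 : σ * (1 - ε) < σ := mul_lt_of_lt_one_right hσ0 (by linarith)
    have h2 : 0 < σ * (1 - ε) := by positivity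
    nlinarith

end

/-! ### The first-order system -/

section

variable {α β γ : ℝ} {u f : ℝ → ℝ}

theorem SolvesBPS.deriv_u (h : SolvesBPS α u f) {r : ℝ} (hr : 0 < r) :
    deriv u r = -(√α * f r * u r) := by
  linarith [(h r hr).2.2.1]

theorem SolvesBPS.deriv_f (hα : 0 < α) (h : SolvesBPS α u f) {r : ℝ} (hr : 0 < r) :
    deriv f r = (1 - u r ^ 2) / (√α * r ^ 2) := by
  have hs : 0 < √α := Real.sqrt_pos.2 hα
  have h1 := (h r hr).2.2.2
  rw [eq_div_iff (by positivity)]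
  rw [sub_eq_zero, eq_div_iff hr.ne'] at h1
  linarith

theorem SolvesBPS.hasDerivAt_u (h : SolvesBPS α u f) {r : ℝ} (hr : 0 < r) :
    HasDerivAt u (-(√α * f r * u r)) r := h.deriv_u hr ▸ (h r hr).1.hasDerivAt

theorem SolvesBPS.hasDerivAt_f (hα : 0 < α) (h : SolvesBPS α u f) {r : ℝ} (hr : 0 < r) :
    HasDerivAt f ((1 - u r ^ 2) / (√α * r ^ 2)) r := h.deriv_f hα hr ▸ (h r hr).2.1.hasDerivAt

theorem SolvesBPS.solvesEulerLagrange (hα : 0 < α) (h : SolvesBPS α u f) :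
    SolvesEulerLagrange α 2 0 u f := by
  have hs : 0 < √α := Real.sqrt_pos.2 hα
  have hs2 : √α ^ 2 = α := Real.sq_sqrt hα.le
  intro r hr
  have hu := h.hasDerivAt_u hr
  have hf := h.hasDerivAt_f hα hr
  refine ⟨(h r hr).1, (h r hr).2.1, ?_, ?_⟩
  · refine (((hf.const_mul √α).mul hu).neg.congr_of_eventuallyEq ?_).congr_deriv ?_
    · filter_upwards [isOpen_Ioi.mem_nhds hr] with x hx using h.deriv_u hx
    · generalize √α = s at *
      subst hs2
      field_simp
      ring
  · refine ((((hu.pow 2).const_sub 1).div (((hasDerivAt_id r).pow 2).const_mul √α)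
      (by simp [hs.ne', hr.ne'])).congr_of_eventuallyEq ?_).congr_deriv ?_
    · filter_upwards [isOpen_Ioi.mem_nhds hr] with x hx using h.deriv_f hα hx
    · rw [h.deriv_f hα hr]
      simp only [id, Pi.pow_apply]
      field_simp
      ring

/-- A function on `(0, ∞)` that starts from `0` and is strictly convex wherever it is positive
cannot have a positive limit at infinity. -/
theorem limit_nonpos_of_second_deriv_pos {R R₁ R₂ : ℝ → ℝ} {L : ℝ}
    (hRd : ∀ r, 0 < r → HasDerivAt R (R₁ r) r) (hRdd : ∀ r, 0 < r → HasDerivAt R₁ (R₂ r) r)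
    (hconv : ∀ r, 0 < r → 0 < R r → 0 < R₂ r) (hR0 : Tendsto R (𝓝[>] 0) (𝓝 0))
    (hRL : Tendsto R atTop (𝓝 L)) : L ≤ 0 := by
  by_contra! hLpos
  -- Maximum principle between a point near 0 and a far point, where `R` is at most L + m for
  -- arbitrary m > 0.
  have hle : ∀ r, 0 < r → R r ≤ L := by
    intro r hr
    refine le_of_forall_pos_le_add fun m hm => ?_
    obtain ⟨a, ha1, ha2⟩ := ((hR0.eventually_le_const
      (show 0 < L + m by linarith)).and (Ioc_mem_nhdsGT hr)).exists
    obtain ⟨b, hb1, hb2⟩ := ((hRL.eventually_le_const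
      (show L < L + m by linarith)).and (eventually_ge_atTop r)).exists
    have ha0 := ha2.1
    exact le_of_second_deriv_pos (ha2.2.trans hb2)
      (fun y hy => (hRd y (ha0.trans_le hy.1)).continuousAt.continuousWithinAt)
      (fun y hy => hRd y (ha0.trans hy.1))
      (fun y hy hpos _ => ⟨_, hconv y (ha0.trans hy.1) hpos, hRdd y (ha0.trans hy.1)⟩)
      (by linarith) ha1 hb1 r ⟨ha2.2, hb2⟩
  obtain ⟨T₀, hT₀⟩ := eventually_atTop.1 (hRL.eventually_const_lt hLpos)
  set T := max T₀ 1
  have hT : 0 < T := lt_max_of_lt_right one_pos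
  have hTpos : ∀ r, T ≤ r → 0 < r ∧ 0 < R r := fun r hr =>
    ⟨hT.trans_le hr, hT₀ r ((le_max_left _ _).trans hr)⟩
  have hmono : MonotoneOn (fun r => R₁ r) (Ici T) := by
    refine monotoneOn_of_deriv_nonneg (convex_Ici T)
      (fun x hx => (hRdd x (hTpos x hx).1).continuousAt.continuousWithinAt)
      (fun x hx => (hRdd x (hTpos x (interior_subset hx)).1).differentiableAt.differentiableWithinAt)
      fun x hx => ?_
    have hx' := hTpos x (interior_subset hx)
    rw [(hRdd x hx'.1).deriv]
    exact (hconv x hx'.1 hx'.2).le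
  -- Beyond `T` the function is convex, so a positive slope c at t would persist and carry it above
  -- the bound L at the point `b`.
  have hnp : ∀ t, T ≤ t → R₁ t ≤ 0 := by
    intro t ht
    by_contra! hc
    set c := R₁ t with hcdef
    have hm : MonotoneOn (fun r => R r - c * r) (Ici t) := by
      have hd : ∀ x, t ≤ x → HasDerivAt (fun r => R r - c * r) (R₁ x - c * 1) x :=
        fun x hx => (hRd x (hTpos x (ht.trans hx)).1).sub ((hasDerivAt_id x).const_mul c)
      refine monotoneOn_of_deriv_nonneg (convex_Ici t)
        (fun x hx => (hd x hx).continuousAt.continuousWithinAt)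
        (fun x hx => (hd x (interior_subset hx)).differentiableAt.differentiableWithinAt)
        fun x hx => ?_
      have hx' : t ≤ x := interior_subset hx
      rw [(hd x hx').deriv]
      have := hmono (mem_Ici.2 ht) (mem_Ici.2 (ht.trans hx')) hx'
      simp only at this
      linarith
    have hLR : 0 ≤ L - R t := sub_nonneg.2 (hle t (hTpos t ht).1)
    set b := t + (L - R t) / c + 1 with hbdef
    have htb : t ≤ b := by have : 0 ≤ (L - R t) / c := by positivity
                           linarith
    have h1 := hm self_mem_Ici (mem_Ici.2 htb) htb
    have h2 := hle b (hTpos b (ht.trans htb)).1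
    have h3 : c * b = c * t + (L - R t) + c := by
      simp only [hbdef]; field_simp
    simp only at h1
    linarith
  have hanti : AntitoneOn R (Ici T) := by
    refine antitoneOn_of_deriv_nonpos (convex_Ici T)
      (fun x hx => (hRd x (hTpos x hx).1).continuousAt.continuousWithinAt)
      (fun x hx => (hRd x (hTpos x (interior_subset hx)).1).differentiableAt.differentiableWithinAt)
      fun x hx => ?_
    rw [(hRd x (hTpos x (interior_subset hx)).1).deriv]
    exact hnp x (interior_subset hx)
  -- Nonincreasing with limit L means at least L; with the upper bound, `R` is eventually constant,
  -- which contradicts strict convexity.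
  have hRconst : ∀ x, T ≤ x → R x = L := by
    intro x hx
    refine le_antisymm (hle x (hTpos x hx).1) (le_of_tendsto hRL ?_)
    filter_upwards [eventually_ge_atTop x] with y hy
    exact hanti (mem_Ici.2 hx) (mem_Ici.2 (hx.trans hy)) hy
  have hder : ∀ x, T < x → R₁ x = 0 := by
    intro x hx
    have h1 : R =ᶠ[𝓝 x] fun _ => L := by
      filter_upwards [lt_mem_nhds hx] with y hy using hRconst y hy.le
    rw [← (hRd x (hTpos x hx.le).1).deriv, h1.deriv_eq, deriv_const]
  have h2 : (fun r => R₁ r) =ᶠ[𝓝 (T + 1)] fun _ => 0 := by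
    filter_upwards [lt_mem_nhds (show T < T + 1 by linarith)] with y hy using hder y hy
  have h3 := h2.deriv_eq
  have h4 := hTpos (T + 1) (by linarith)
  rw [(hRdd _ h4.1).deriv, deriv_const] at h3
  exact (hconv _ h4.1 h4.2).ne' h3

set_option maxHeartbeats 800000 in
/-- A finite-energy solution of the Euler-Lagrange equations with the boundary conditions solves
the first-order equations. -/
theorem SolvesEulerLagrange.solvesBPS (hα : 0 < α) (h : SolvesEulerLagrange α 2 0 u f)
    (hb : BoundaryConditions u f) (hE : energy α 2 0 u f < ⊤) : SolvesBPS α u f := by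
  have hs : 0 < √α := Real.sqrt_pos.2 hα
  have hs2 : √α ^ 2 = α := Real.sq_sqrt hα.le
  generalize hsdef : √α = s at hs hs2
  obtain ⟨i1, i2, i3, i4⟩ := integrableOn_energy_terms hα two_pos le_rfl h.continuousOn_u
    h.continuousOn_f hE
  have hcu := h.continuousOn_u
  have hcf := h.continuousOn_f
  -- the flux `r² f'`
  have hG : ∀ r, 0 < r → HasDerivAt (fun r => r ^ 2 * deriv f r) (2 * f r * u r ^ 2) r :=
    fun r hr => (h.hasDerivAt_sq_mul_deriv_f hr).congr_deriv (by ring)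
  have hG0 : Tendsto (fun r => r ^ 2 * deriv f r) (𝓝[>] 0) (𝓝 0) :=
    h.tendsto_sq_mul_deriv_f (C := 2)
      (hb.u_zero.abs.eventually_le_const (by norm_num))
      (hb.f_zero.abs.eventually_le_const (by norm_num)) i3
  obtain ⟨C, hC⟩ : ∃ C, Tendsto (fun r => r ^ 2 * deriv f r) atTop (𝓝 C) := by
    obtain ⟨T₀, hT₀⟩ := eventually_atTop.1
      (hb.f_infty.eventually_const_lt (show (1 / 2 : ℝ) < 1 by norm_num))
    set T := max T₀ 1
    have hT : 0 < T := lt_max_of_lt_right one_pos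
    have hsub : Ioi T ⊆ Ioi 0 := Ioi_subset_Ioi hT.le
    refine exists_tendsto_atTop_of_integrable_deriv (a := T) (fun r hr => hG r (hsub hr)) ?_
    refine Integrable.mono' ((i4.mono_set hsub).const_mul 4)
      (ContinuousOn.aestronglyMeasurable (by have := hcu.mono hsub; have := hcf.mono hsub; fun_prop)
        measurableSet_Ioi) ?_
    filter_upwards [self_mem_ae_restrict measurableSet_Ioi] with r hr
    have hf2 := hT₀ r ((le_max_left _ _).trans (le_of_lt hr))
    rw [Real.norm_of_nonneg (by nlinarith [mul_nonneg (by linarith : 0 ≤ f r) (sq_nonneg (u r))])]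
    have : 0 ≤ (4 * f r ^ 2 - 2 * f r) * u r ^ 2 :=
      mul_nonneg (by nlinarith) (sq_nonneg _)
    linarith
  -- the defects of the first-order system
  set P : ℝ → ℝ := fun r => deriv u r + s * f r * u r with hP
  set R : ℝ → ℝ := fun r => s * (r ^ 2 * deriv f r) - (1 - u r ^ 2) with hR
  have hRd : ∀ r, 0 < r → HasDerivAt R (2 * u r * P r) r := by
    intro r hr
    refine (((hG r hr).const_mul s).sub (((h.hasDerivAt_u hr).pow 2).const_sub 1)).congr_deriv ?_
    simp only [hP]; ring
  have hPd : ∀ r, 0 < r → HasDerivAt P (s * f r * P r + u r * R r / r ^ 2) r := by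
    intro r hr
    refine ((h r hr).2.2.1.add (((h.hasDerivAt_f hr).const_mul s).mul
      (h.hasDerivAt_u hr))).congr_deriv ?_
    simp only [hP, hR]
    rw [← hs2]
    field_simp
    ring
  have hRdd : ∀ r, 0 < r → HasDerivAt (fun r => 2 * u r * P r)
      (2 * P r ^ 2 + 2 * u r ^ 2 * R r / r ^ 2) r := by
    intro r hr
    refine (((h.hasDerivAt_u hr).const_mul 2).mul (hPd r hr)).congr_deriv ?_
    have : deriv u r = P r - s * f r * u r := by simp only [hP]; ring
    rw [this]
    field_simp
    ring
  have hR0 : Tendsto R (𝓝[>] 0) (𝓝 0) := by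
    have := (hG0.const_mul s).sub ((hb.u_zero.pow 2).const_sub 1)
    simpa using this
  set L := s * C - 1 with hL
  have hRL : Tendsto R atTop (𝓝 L) := by
    have := (hC.const_mul s).sub ((hb.u_infty.pow 2).const_sub 1)
    simpa [hL] using this
  -- Strictness needs u or P to be nonzero. At a zero of u, P equals u', which does not vanish
  -- because u has no double zeros.
  have hconv : ∀ r, 0 < r → 0 < R r → 0 < 2 * P r ^ 2 + 2 * u r ^ 2 * R r / r ^ 2 := by
    intro r hr hRr
    rcases h.u_ne_zero_or hb.u_zero hr with hu0 | hu0
    · positivity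
    · by_cases hz : u r = 0
      · have : P r ≠ 0 := by simpa only [hP, hz, mul_zero, add_zero] using hu0
        positivity
      · positivity
  have hLle : L ≤ 0 := limit_nonpos_of_second_deriv_pos hRd hRdd hconv hR0 hRL
  -- the virial identity
  have ivir : IntegrableOn (fun r => (2 * deriv u r ^ 2 + (1 - u r ^ 2) ^ 2 / r ^ 2)
      - α * (r ^ 2 * deriv f r ^ 2 + 2 * (f r ^ 2 * u r ^ 2))) (Ioi 0) :=
    ((i1.const_mul 2).add i2).sub ((i3.add (i4.const_mul 2)).const_mul α)
  have ien : IntegrableOn (fun r => (2 * deriv u r ^ 2 + (1 - u r ^ 2) ^ 2 / r ^ 2)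
      + α * (r ^ 2 * deriv f r ^ 2 + 2 * (f r ^ 2 * u r ^ 2))) (Ioi 0) :=
    ((i1.const_mul 2).add i2).add ((i3.add (i4.const_mul 2)).const_mul α)
  -- The primitive is bounded by r times the energy density, so finite energy alone removes the
  -- boundary terms. The result is equality of the two halves of the energy.
  have hvir := integral_Ioi_eq_zero_of_abs_le_mul
    (G := fun r => r * (2 * deriv u r ^ 2 + α * r ^ 2 * deriv f r ^ 2
      - (1 - u r ^ 2) ^ 2 / r ^ 2 - 2 * α * f r ^ 2 * u r ^ 2))
    (fun r hr => by
      have hr0 : r ≠ 0 := ne_of_gt hr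
      have d1 := (h r hr).2.2.1
      have d2 := (h r hr).2.2.2
      have d3 := h.hasDerivAt_u hr
      have d4 := h.hasDerivAt_f hr
      refine ((hasDerivAt_id r).mul (((((d1.pow 2).const_mul 2).add
        ((((hasDerivAt_id r).pow 2).const_mul α).mul (d2.pow 2))).sub
        ((((d3.pow 2).const_sub 1).pow 2).div ((hasDerivAt_id r).pow 2) (by simpa using hr0))).sub
        (((d4.pow 2).const_mul (2 * α)).mul (d3.pow 2)))).congr_deriv ?_
      simp only [id, Pi.pow_apply, Pi.mul_apply, Pi.sub_apply, Pi.add_apply, Pi.div_apply]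
      field_simp
      ring) ivir ien (fun r hr => by
      rw [abs_mul, abs_of_pos hr]
      refine mul_le_mul_of_nonneg_left ?_ hr.le
      have p1 : 0 ≤ 2 * deriv u r ^ 2 := by positivity
      have p2 : 0 ≤ (1 - u r ^ 2) ^ 2 / r ^ 2 := by positivity
      have p3 : 0 ≤ α * r ^ 2 * deriv f r ^ 2 := by positivity
      have p4 : 0 ≤ 2 * α * f r ^ 2 * u r ^ 2 := by positivity
      rw [abs_le]
      constructor <;> linarith)
  -- the energy in terms of the flux
  have hflux : ∫ r in Ioi (0 : ℝ), (r ^ 2 * deriv f r ^ 2 + 2 * (f r ^ 2 * u r ^ 2)) = C := by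
    have := integral_Ioi_zero_of_hasDerivAt (G := fun r => r ^ 2 * deriv f r * f r)
      (g := fun r => r ^ 2 * deriv f r ^ 2 + 2 * (f r ^ 2 * u r ^ 2)) (m := 0 * 0) (n := C * 1)
      (fun r hr => ((hG r hr).mul (h.hasDerivAt_f hr)).congr_deriv (by ring))
      (i3.add (i4.const_mul 2)) (hG0.mul hb.f_zero) (hC.mul hb.f_infty)
    rw [this]; ring
  have iPR : IntegrableOn (fun r => 2 * P r ^ 2 + (R r / r) ^ 2) (Ioi 0) := by
    have hcdu := h.continuousOn_deriv_u
    have hcdf := h.continuousOn_deriv_f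
    refine Integrable.mono' (g := fun r => 2 * ((2 * deriv u r ^ 2 + (1 - u r ^ 2) ^ 2 / r ^ 2)
      + α * (r ^ 2 * deriv f r ^ 2 + 2 * (f r ^ 2 * u r ^ 2)))) (ien.const_mul 2)
      (ContinuousOn.aestronglyMeasurable ?_ measurableSet_Ioi) ?_
    · have : ∀ x ∈ Ioi (0 : ℝ), x ≠ 0 := fun x hx => ne_of_gt hx
      simp only [hP, hR]
      fun_prop (disch := assumption)
    · filter_upwards [self_mem_ae_restrict measurableSet_Ioi] with r hr
      have hr0 : r ≠ 0 := ne_of_gt hr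
      rw [Real.norm_of_nonneg (by positivity)]
      have e1 : R r / r = s * r * deriv f r - (1 - u r ^ 2) / r := by
        simp only [hR]; field_simp
      have e2 : (1 - u r ^ 2) ^ 2 / r ^ 2 = ((1 - u r ^ 2) / r) ^ 2 := by rw [div_pow]
      rw [e1, e2, ← hs2]
      simp only [hP]
      nlinarith [sq_nonneg (deriv u r - s * f r * u r),
        sq_nonneg (s * r * deriv f r + (1 - u r ^ 2) / r)]
  -- Bogomolny's completion of squares: the energy density minus the squares of the defects is the
  -- derivative of 2s f (1 - u²).
  have hbog : ∫ r in Ioi (0 : ℝ), ((((2 * deriv u r ^ 2 + (1 - u r ^ 2) ^ 2 / r ^ 2)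
      + α * (r ^ 2 * deriv f r ^ 2 + 2 * (f r ^ 2 * u r ^ 2))))
      - (2 * P r ^ 2 + (R r / r) ^ 2)) = 2 * s := by
    have := integral_Ioi_zero_of_hasDerivAt (G := fun r => 2 * s * (f r * (1 - u r ^ 2)))
      (g := fun r => (((2 * deriv u r ^ 2 + (1 - u r ^ 2) ^ 2 / r ^ 2)
        + α * (r ^ 2 * deriv f r ^ 2 + 2 * (f r ^ 2 * u r ^ 2))))
        - (2 * P r ^ 2 + (R r / r) ^ 2))
      (m := 2 * s * (0 * (1 - 1 ^ 2))) (n := 2 * s * (1 * (1 - 0 ^ 2)))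
      (fun r hr => by
        have hr0 : r ≠ 0 := ne_of_gt hr
        refine (((h.hasDerivAt_f hr).mul (((h.hasDerivAt_u hr).pow 2).const_sub 1)).const_mul
          (2 * s)).congr_deriv ?_
        simp only [hP, hR]
        rw [← hs2]
        simp only [Pi.pow_apply]
        field_simp
        ring) (ien.sub iPR)
      ((hb.f_zero.mul ((hb.u_zero.pow 2).const_sub 1)).const_mul (2 * s))
      ((hb.f_infty.mul ((hb.u_infty.pow 2).const_sub 1)).const_mul (2 * s))
    rw [this]; ring
  have ikin : IntegrableOn (fun r => 2 * deriv u r ^ 2 + (1 - u r ^ 2) ^ 2 / r ^ 2) (Ioi 0) :=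
    (i1.const_mul 2).add i2
  have ihig : IntegrableOn (fun r => α * (r ^ 2 * deriv f r ^ 2 + 2 * (f r ^ 2 * u r ^ 2)))
      (Ioi 0) := (i3.add (i4.const_mul 2)).const_mul α
  rw [integral_sub ien iPR, integral_add ikin ihig, integral_const_mul, hflux] at hbog
  rw [integral_sub ikin ihig, integral_const_mul, hflux] at hvir
  -- The energy is 2αC by the virial and flux identities, so the integral of the squares is 2αC - 2s
  -- = 2sL.
  have hPR0 : ∫ r in Ioi (0 : ℝ), (2 * P r ^ 2 + (R r / r) ^ 2) ≤ 0 := by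
    have : 2 * s * L ≤ 0 := mul_nonpos_of_nonneg_of_nonpos (by positivity) hLle
    have e : 2 * s * L = 2 * (α * C) - 2 * s := by rw [hL, ← hs2]; ring
    linarith
  have hae : (fun r => 2 * P r ^ 2 + (R r / r) ^ 2) =ᵐ[volume.restrict (Ioi (0 : ℝ))] 0 :=
    (integral_eq_zero_iff_of_nonneg (fun r => by positivity) iPR).1
      (le_antisymm hPR0 (integral_nonneg fun r => by positivity))
  have hcPR : ContinuousOn (fun r => 2 * P r ^ 2 + (R r / r) ^ 2) (Ioi 0) := by
    have hcP : ContinuousOn P (Ioi 0) := fun r hr => (hPd r hr).continuousAt.continuousWithinAt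
    have hcR : ContinuousOn R (Ioi 0) := fun r hr => (hRd r hr).continuousAt.continuousWithinAt
    have : ∀ x ∈ Ioi (0 : ℝ), x ≠ 0 := fun x hx => ne_of_gt hx
    fun_prop (disch := assumption)
  have hall := Measure.eqOn_open_of_ae_eq hae isOpen_Ioi hcPR continuousOn_const
  intro r hr
  have hz : 2 * P r ^ 2 + (R r / r) ^ 2 = 0 := hall hr
  have hP0 : P r = 0 := by
    have : P r ^ 2 = 0 := by nlinarith [sq_nonneg (P r), sq_nonneg (R r / r)]
    simpa using this
  have hR0' : R r / r = 0 := by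
    have : (R r / r) ^ 2 = 0 := by nlinarith [sq_nonneg (P r), sq_nonneg (R r / r)]
    simpa using this
  refine ⟨(h r hr).1, (h r hr).2.1, hsdef ▸ hP0, ?_⟩
  rw [hsdef, ← hR0']
  simp only [hR]
  field_simp

end

/-! ### The explicit solution -/

section

variable {α β γ : ℝ} {u f v g : ℝ → ℝ}

theorem eq_of_hasDerivAt_zero_of_tendsto {l : Filter ℝ} [l.NeBot] {F : ℝ → ℝ} {c : ℝ}
    (hl : ∀ᶠ r in l, 0 < r) (hd : ∀ r, 0 < r → HasDerivAt F 0 r) (hT : Tendsto F l (𝓝 c))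
    {r : ℝ} (hr : 0 < r) : F r = c := by
  refine tendsto_nhds_unique (tendsto_const_nhds.congr' ?_) hT
  filter_upwards [hl] with x hx
  exact isOpen_Ioi.is_const_of_deriv_eq_zero isPreconnected_Ioi
    (fun y hy => (hd y hy).differentiableAt.differentiableWithinAt)
    (fun y hy => (hd y hy).deriv) (mem_Ioi.2 hr) (mem_Ioi.2 hx)

/-- The explicit solution of the first-order system. -/
theorem SolvesBPS.eqOn (hα : 0 < α) (h : SolvesBPS α u f) (hb : BoundaryConditions u f) :
    EqOn u (uBPS α) (Ioi 0) ∧ EqOn f (fBPS α) (Ioi 0) := by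
  have hel := h.solvesEulerLagrange hα
  have hud : ∀ r, 0 < r → HasDerivAt u (-(√α * f r * u r)) r := fun r hr => h.hasDerivAt_u hr
  have hfd : ∀ r, 0 < r → HasDerivAt f ((1 - u r ^ 2) / (√α * r ^ 2)) r :=
    fun r hr => h.hasDerivAt_f hα hr
  have hupos : ∀ r, 0 < r → 0 < u r :=
    pos_of_ne_zero_of_tendsto (l := 𝓝[>] 0) self_mem_nhdsWithin hel.continuousOn_u (fun r hr h0 => by
      rcases hel.u_ne_zero_or hb.u_zero hr with h1 | h1
      · exact h1 h0
      · exact h1 (by rw [h.deriv_u hr, h0]; simp)) hb.u_zero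
  have hs : 0 < √α := Real.sqrt_pos.2 hα
  unfold uBPS fBPS
  generalize √α = s at *
  have hinv : Tendsto (fun r : ℝ => 1 / (s * r)) atTop (𝓝 0) := by
    exact (tendsto_const_nhds (x := (1 : ℝ))).div_atTop (tendsto_id.const_mul_atTop hs)
  -- Adding 1/(sr) cancels the singular part of f', leaving w' = -u²/(s r²).
  have hw : ∀ r, 0 < r → HasDerivAt (fun r => f r + 1 / (s * r)) (-(u r ^ 2) / (s * r ^ 2)) r := by
    intro r hr
    refine ((hfd r hr).add ((((hasDerivAt_id r).const_mul s).inv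
      (by simp [hs.ne', hr.ne'])).congr_of_eventuallyEq
      (.of_forall fun x => one_div _))).congr_deriv ?_
    simp only [id]
    field_simp
    ring
  -- A first integral, evaluated at infinity. It eliminates u and leaves the Riccati equation w' =
  -- s(1 - w²).
  have hfirst : ∀ r, 0 < r → (f r + 1 / (s * r)) ^ 2 - (u r / (s * r)) ^ 2 = 1 := by
    intro r hr
    refine eq_of_hasDerivAt_zero_of_tendsto
      (F := fun r => (f r + 1 / (s * r)) ^ 2 - (u r / (s * r)) ^ 2)
      (eventually_gt_atTop 0) (fun r hr => ?_) ?_ hr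
    · refine (((hw r hr).pow 2).sub (((hud r hr).div ((hasDerivAt_id r).const_mul s)
        (by simp [hs.ne', hr.ne'])).pow 2)).congr_deriv ?_
      simp only [id, Pi.div_apply]
      field_simp
      ring
    · have := ((hb.f_infty.add hinv).pow 2).sub ((hb.u_infty.mul hinv).pow 2)
      simpa [div_eq_mul_inv] using this
  have hcf := hel.continuousOn_f
  have hwpos : ∀ r, 0 < r → 0 < f r + 1 / (s * r) := by
    refine pos_of_ne_zero_of_tendsto (v := fun r => f r + 1 / (s * r)) (eventually_gt_atTop 0)
      (fun r hr => (hw r hr).continuousAt.continuousWithinAt) (fun r hr h0 => ?_)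
      (by simpa using hb.f_infty.add hinv)
    have := hfirst r hr
    rw [h0] at this
    nlinarith [sq_nonneg (u r / (s * r))]
  -- The constant of integration of the Riccati equation: (w - 1)/(w + 1) times e^{2sr}, written so
  -- that its limit at 0 is visible as w → ∞. It yields w = coth(sr).
  have hexp : ∀ r, 0 < r → (1 - 2 / (f r + 1 / (s * r) + 1)) * Real.exp (2 * s * r) = 1 := by
    intro r hr
    refine eq_of_hasDerivAt_zero_of_tendsto
      (F := fun r => (1 - 2 / (f r + 1 / (s * r) + 1)) * Real.exp (2 * s * r))
      (l := 𝓝[>] 0) self_mem_nhdsWithin (fun r hr => ?_) ?_ hr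
    · have hp := hwpos r hr
      have hne : f r + 1 / (s * r) + 1 ≠ 0 := by positivity
      refine (((((hasDerivAt_const r (2 : ℝ)).div ((hw r hr).add_const 1) hne)).const_sub 1).mul
        (((hasDerivAt_id r).const_mul (2 * s)).exp)).congr_deriv ?_
      have h1 : u r ^ 2 = (s * r) ^ 2 * ((f r + 1 / (s * r)) ^ 2 - 1) := by
        have := hfirst r hr
        field_simp at this ⊢
        linarith
      have h2 : -(u r ^ 2) / (s * r ^ 2) = s * (1 - (f r + 1 / (s * r)) ^ 2) := by
        rw [h1]; field_simp; ring
      rw [h2]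
      simp only [id, Pi.div_apply]
      generalize f r + 1 / (s * r) = w at *
      field_simp
      ring
    · have h1 : Tendsto (fun r : ℝ => 1 / (s * r)) (𝓝[>] 0) atTop := by
        have := (tendsto_inv_nhdsGT_zero (𝕜 := ℝ)).const_mul_atTop (inv_pos.2 hs)
        refine this.congr fun r => ?_
        rw [one_div, mul_inv]
      have h2 := tendsto_atTop_add_const_right _ (1 : ℝ) (hb.f_zero.add_atTop h1)
      have h3 := (tendsto_const_nhds (x := (2 : ℝ))).div_atTop h2
      have h4 : Tendsto (fun r => Real.exp (2 * s * r)) (𝓝[>] 0) (𝓝 (Real.exp (2 * s * 0))) :=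
        ((by fun_prop : Continuous fun r => Real.exp (2 * s * r)).tendsto 0).mono_left
          nhdsWithin_le_nhds
      simpa using (h3.const_sub 1).mul h4
  have hfs : ∀ r, 0 < r →
      (f r + 1 / (s * r)) * Real.sinh (s * r) = Real.cosh (s * r) := by
    intro r hr
    have h1 := hexp r hr
    have hp := hwpos r hr
    generalize f r + 1 / (s * r) = w at *
    have hne : w + 1 ≠ 0 := by positivity
    have h2 : Real.exp (2 * s * r) = Real.exp (s * r) * Real.exp (s * r) := by
      rw [← Real.exp_add]; congr 1; ring
    have h3 : Real.exp (s * r) * Real.exp (-(s * r)) = 1 := by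
      rw [← Real.exp_add]; simp
    rw [h2] at h1
    field_simp at h1
    rw [Real.sinh_eq, Real.cosh_eq]
    have h4 : (w - 1) * Real.exp (s * r) = (w + 1) * Real.exp (-(s * r)) := by
      have : (w - 1) * Real.exp (s * r) * (Real.exp (s * r) * Real.exp (-(s * r)))
          = (w + 1) * Real.exp (-(s * r)) := by linear_combination Real.exp (-(s * r)) * h1
      rwa [h3, mul_one] at this
    linarith
  have hsinh : ∀ r, 0 < r → 0 < Real.sinh (s * r) := fun r hr =>
    Real.sinh_pos_iff.2 (mul_pos hs hr)
  refine ⟨fun r hr => ?_, fun r hr => ?_⟩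
  · have hr' : 0 < r := hr
    have hS := hsinh r hr
    have h1 := hfirst r hr
    have h2 := hfs r hr
    have h3 := Real.cosh_sq (s * r)
    rw [← h2] at h3
    have h4 : (u r / (s * r) * Real.sinh (s * r)) ^ 2 = 1 ^ 2 := by
      linear_combination (-(Real.sinh (s * r)) ^ 2) * h1 + h3
    have hu := hupos r hr
    have h5 := (pow_left_inj₀ (by positivity) zero_le_one two_ne_zero).1 h4
    field_simp at h5 ⊢
    linarith
  · have hS := hsinh r hr
    simp only
    rw [← hfs r hr, mul_div_cancel_right₀ _ hS.ne']
    ring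

theorem deriv_eqOn_Ioi (h : EqOn u v (Ioi 0)) : EqOn (deriv u) (deriv v) (Ioi 0) :=
  fun _ hr => (h.eventuallyEq_of_mem (isOpen_Ioi.mem_nhds hr)).deriv_eq

theorem energy_congr (hu : EqOn u v (Ioi 0)) (hf : EqOn f g (Ioi 0)) :
    energy α β γ u f = energy α β γ v g := by
  refine setLIntegral_congr_fun measurableSet_Ioi fun r hr => ?_
  simp only [energyDensity, hu hr, hf hr, deriv_eqOn_Ioi hu hr, deriv_eqOn_Ioi hf hr]

theorem SolvesBPS.congr (h : SolvesBPS α u f) (hu : EqOn u v (Ioi 0)) (hf : EqOn f g (Ioi 0)) :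
    SolvesBPS α v g := by
  intro r hr
  have h0 := h r hr
  have hmem := isOpen_Ioi.mem_nhds (mem_Ioi.2 hr)
  rw [hu hr, hf hr, deriv_eqOn_Ioi hu hr, deriv_eqOn_Ioi hf hr] at h0
  exact ⟨(hu.eventuallyEq_of_mem hmem).differentiableAt_iff.1 h0.1,
    (hf.eventuallyEq_of_mem hmem).differentiableAt_iff.1 h0.2.1, h0.2.2⟩

theorem BoundaryConditions.congr (h : BoundaryConditions u f) (hu : EqOn u v (Ioi 0))
    (hf : EqOn f g (Ioi 0)) : BoundaryConditions v g where
  f_zero := h.f_zero.congr' (hf.eventuallyEq_of_mem self_mem_nhdsWithin)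
  u_zero := h.u_zero.congr' (hu.eventuallyEq_of_mem self_mem_nhdsWithin)
  f_infty := h.f_infty.congr' (hf.eventuallyEq_of_mem (Ioi_mem_atTop 0))
  u_infty := h.u_infty.congr' (hu.eventuallyEq_of_mem (Ioi_mem_atTop 0))

theorem Admissible.congr (h : Admissible α β γ u f) (hu : EqOn u v (Ioi 0))
    (hf : EqOn f g (Ioi 0)) : Admissible α β γ v g where
  finite_energy := energy_congr hu hf ▸ h.finite_energy
  ac_u a b ha hab := AbsolutelyContinuousOnInterval_congr (h.ac_u a b ha hab)
    fun _ hx => hu (ha.trans_le (uIcc_of_le hab ▸ hx).1)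
  ac_f a b ha hab := AbsolutelyContinuousOnInterval_congr (h.ac_f a b ha hab)
    fun _ hx => hf (ha.trans_le (uIcc_of_le hab ▸ hx).1)
  boundary := h.boundary.congr hu hf

/-- No direct verification is needed: a minimizer exists, solves the first-order system, and must
coincide with the explicit pair. Boundary limits, finite energy and the equations for that pair are
inherited from it. -/
theorem isMinimizer_bps (hα : 0 < α) : IsMinimizer α 2 0 (uBPS α) (fBPS α) := by
  obtain ⟨u, f, h⟩ := exists_isMinimizer hα two_pos le_rfl
  have hp := h.isProfile hα two_pos le_rfl
  obtain ⟨hu, hf⟩ := (hp.el.solvesBPS hα hp.boundary h.1.finite_energy).eqOn hα hp.boundary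
  exact ⟨h.1.congr hu hf, fun v g hv => energy_congr (α := α) (β := 2) (γ := 0) hu hf ▸ h.2 v g hv⟩

theorem solvesBPS_bps (hα : 0 < α) : SolvesBPS α (uBPS α) (fBPS α) :=
  have h := isMinimizer_bps hα
  (h.isProfile hα two_pos le_rfl).el.solvesBPS hα h.1.boundary h.1.finite_energy

theorem solvesBPS_and_boundaryConditions_iff (hα : 0 < α) :
    (SolvesBPS α u f ∧ BoundaryConditions u f) ↔
      (EqOn u (uBPS α) (Ioi 0) ∧ EqOn f (fBPS α) (Ioi 0)) :=
  ⟨fun h => h.1.eqOn hα h.2, fun h => ⟨(solvesBPS_bps hα).congr h.1.symm h.2.symm,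
    (isMinimizer_bps hα).1.boundary.congr h.1.symm h.2.symm⟩⟩

theorem Admissible.integrableOn_energyDensity (hα : 0 ≤ α) (hβ : 0 ≤ β) (hγ : 0 ≤ γ)
    (h : Admissible α β γ u f) : IntegrableOn (energyDensity α β γ u f) (Ioi 0) :=
  DarkMonopole.integrableOn_energyDensity hα hβ hγ h.ac_u h.ac_f h.finite_energy

theorem energy_bps (hα : 0 < α) :
    energy α 2 0 (uBPS α) (fBPS α) = ENNReal.ofReal (2 * √α) := by
  have h := solvesBPS_bps hα
  have hA := (isMinimizer_bps hα).1
  have hi := hA.integrableOn_energyDensity hα.le two_pos.le le_rfl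
  have hb := hA.boundary
  rw [energy_eq_ofReal_integral hα.le two_pos.le le_rfl hi]
  generalize uBPS α = u at *
  generalize fBPS α = f at *
  have hs : 0 < √α := Real.sqrt_pos.2 hα
  have hs2 : √α ^ 2 = α := Real.sq_sqrt hα.le
  have := integral_Ioi_zero_of_hasDerivAt (G := fun r => 2 * √α * (f r * (1 - u r ^ 2)))
    (g := energyDensity α 2 0 u f)
    (m := 2 * √α * (0 * (1 - 1 ^ 2))) (n := 2 * √α * (1 * (1 - 0 ^ 2)))
    (fun r hr => by
      have hr0 : r ≠ 0 := ne_of_gt hr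
      refine (((h.hasDerivAt_f hα hr).mul (((h.hasDerivAt_u hr).pow 2).const_sub 1)).const_mul
        (2 * √α)).congr_deriv ?_
      rw [energyDensity, h.deriv_u hr, h.deriv_f hα hr]
      generalize √α = s at *
      subst hs2
      simp only [Pi.pow_apply]
      field_simp
      ring) hi
    ((hb.f_zero.mul ((hb.u_zero.pow 2).const_sub 1)).const_mul (2 * √α))
    ((hb.f_infty.mul ((hb.u_infty.pow 2).const_sub 1)).const_mul (2 * √α))
  rw [this]
  congr 1
  ring

end

/-! ### Monotonicity and the lower energy bound -/

section

variable {α β γ : ℝ} {u f : ℝ → ℝ}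

theorem setIntegral_Ioi_lt {g h : ℝ → ℝ} (hg : IntegrableOn g (Ioi 0))
    (hh : IntegrableOn h (Ioi 0)) (hlt : ∀ r, 0 < r → g r < h r) :
    ∫ r in Ioi (0 : ℝ), g r < ∫ r in Ioi (0 : ℝ), h r := by
  rw [← sub_pos, ← integral_sub hh hg]
  rw [setIntegral_pos_iff_support_of_nonneg_ae (f := fun r => h r - g r) _ (hh.sub hg)]
  · have : (Function.support fun r => h r - g r) ∩ Ioi 0 = Ioi 0 :=
      inter_eq_right.2 fun r hr => (sub_pos.2 (hlt r hr)).ne'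
    rw [this]
    simp
  · filter_upwards [self_mem_ae_restrict measurableSet_Ioi] with r hr
    exact (sub_pos.2 (hlt r hr)).le

/-- For γ = 0 the flux r² f' has positive derivative β f u² and tends to 0 at the origin. -/
theorem IsProfile.deriv_f_pos (h : IsProfile α β 0 u f) (hα : 0 < α) (hβ : 0 < β)
    (hE : energy α β 0 u f < ⊤) {r : ℝ} (hr : 0 < r) : 0 < deriv f r := by
  have hb := h.boundary
  have hG : ∀ r, 0 < r → HasDerivAt (fun r => r ^ 2 * deriv f r) (β * f r * u r ^ 2) r :=
    fun r hr => (h.el.hasDerivAt_sq_mul_deriv_f hr).congr_deriv (by ring)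
  have hG0 : Tendsto (fun r => r ^ 2 * deriv f r) (𝓝[>] 0) (𝓝 0) :=
    h.el.tendsto_sq_mul_deriv_f (C := 2)
      (hb.u_zero.abs.eventually_le_const (by norm_num))
      (hb.f_zero.abs.eventually_le_const (by norm_num))
      (integrableOn_energy_terms hα hβ le_rfl h.el.continuousOn_u h.el.continuousOn_f hE).2.2.1
  have hm : StrictMonoOn (fun r => r ^ 2 * deriv f r) (Ioi 0) := by
    refine strictMonoOn_of_deriv_pos (convex_Ioi 0)
      (fun x hx => (hG x hx).continuousAt.continuousWithinAt) fun x hx => ?_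
    have hx' : 0 < x := interior_subset hx
    obtain ⟨h1, -, h2, -⟩ := h.bounds x hx'
    rw [(hG x hx').deriv]
    positivity
  have h1 : 0 ≤ (r / 2) ^ 2 * deriv f (r / 2) := by
    refine le_of_tendsto hG0 ?_
    filter_upwards [Ioc_mem_nhdsGT (half_pos hr)] with x hx
    exact hm.monotoneOn (mem_Ioi.2 hx.1) (mem_Ioi.2 (half_pos hr)) hx.2
  have h2 := hm (mem_Ioi.2 (half_pos hr)) (mem_Ioi.2 hr) (half_lt_self hr)
  exact pos_of_mul_pos_right (h1.trans_lt h2) (sq_nonneg r)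

theorem IsProfile.strictMonoOn_f (h : IsProfile α β 0 u f) (hα : 0 < α) (hβ : 0 < β)
    (hE : energy α β 0 u f < ⊤) : StrictMonoOn f (Ioi 0) :=
  strictMonoOn_of_deriv_pos (convex_Ioi 0) h.el.continuousOn_f
    fun _ hx => h.deriv_f_pos hα hβ hE (interior_subset hx)

/-- If monotonicity failed, u would have a local minimum z and a later local maximum x with u(z) ≤
u(x). By (EL) the sign of u'' is that of (αβ/2)(r f)² + u² - 1, which must be ≥ 0 at z and ≤ 0 at x.
But r f is strictly increasing, so the expression is larger at x. -/
theorem IsProfile.strictAntiOn_u (h : IsProfile α β 0 u f) (hα : 0 < α) (hβ : 0 < β)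
    (hf : StrictMonoOn f (Ioi 0)) : StrictAntiOn u (Ioi 0) := by
  intro a ha b hb hab
  by_contra! hle
  have ha0 : 0 < a := ha
  have hb0 : 0 < b := hb
  have hcu := h.el.continuousOn_u
  -- `M` is chosen with u(M) < u(b) and `m` with u(m) > u(a), so that the extrema can be taken in
  -- the interior of the intervals considered below.
  obtain ⟨M, hM1, hM2⟩ := ((h.boundary.u_infty.eventually_lt_const (h.bounds b hb0).1).and
    (eventually_gt_atTop b)).exists
  obtain ⟨m, hm1, hm2⟩ := ((h.boundary.u_zero.eventually_const_lt (h.bounds a ha0).2.1).and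
    (Ioo_mem_nhdsGT ha0)).exists
  have hm0 : 0 < m := hm2.1
  have hma : m < a := hm2.2
  obtain ⟨x, hxI, hx⟩ : ∃ x ∈ Ioo a M, ∀ y ∈ Icc a M, u y ≤ u x := by
    obtain ⟨x, hxI, hx⟩ := isCompact_Icc.exists_isMaxOn
      (nonempty_Icc.2 (hab.trans hM2).le) (hcu.mono fun y hy => ha0.trans_le hy.1)
    have hbx : u b ≤ u x := hx ⟨hab.le, hM2.le⟩
    rcases hbx.eq_or_lt with he | hlt
    · exact ⟨b, ⟨hab, hM2⟩, fun y hy => he ▸ hx hy⟩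
    · refine ⟨x, ⟨hxI.1.lt_of_ne fun e => ?_, hxI.2.lt_of_ne fun e => ?_⟩, hx⟩
      · rw [← e] at hlt; linarith
      · rw [e] at hlt; linarith
  have hx0 : 0 < x := ha0.trans hxI.1
  have hax : u a ≤ u x := hx a ⟨le_rfl, (hab.trans hM2).le⟩
  obtain ⟨z, hzI, hz, hza⟩ : ∃ z ∈ Ioo m x, (∀ y ∈ Icc m x, u z ≤ u y) ∧ u z ≤ u a := by
    obtain ⟨z, hzI, hz⟩ := isCompact_Icc.exists_isMinOn
      (nonempty_Icc.2 (hma.trans hxI.1).le) (hcu.mono fun y hy => hm0.trans_le hy.1)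
    have hza : u z ≤ u a := hz ⟨hma.le, hxI.1.le⟩
    rcases hza.eq_or_lt with he | hlt
    · exact ⟨a, ⟨hma, hxI.1⟩, fun y hy => he ▸ hz hy, le_rfl⟩
    · refine ⟨z, ⟨hzI.1.lt_of_ne fun e => ?_, hzI.2.lt_of_ne fun e => ?_⟩, hz, hza⟩
      · rw [← e] at hlt; linarith
      · rw [e] at hlt; linarith
  have hz0 : 0 < z := hm0.trans hzI.1
  have hdiff : ∀ y, 0 < y → ∀ᶠ w in 𝓝 y, DifferentiableAt ℝ u w := fun y hy => by
    filter_upwards [lt_mem_nhds hy] with w hw using (h.el w hw).1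
  have hmax := second_deriv_nonpos_of_isLocalMax (hdiff x hx0)
    (by filter_upwards [Icc_mem_nhds hxI.1 hxI.2] with y hy using hx y hy) (h.el x hx0).2.2.1
  have hmin := second_deriv_nonneg_of_isLocalMin (hdiff z hz0)
    (by filter_upwards [Icc_mem_nhds hzI.1 hzI.2] with y hy using hz y hy) (h.el z hz0).2.2.1
  obtain ⟨hux, -, hfx, -⟩ := h.bounds x hx0
  obtain ⟨huz, -, hfz, -⟩ := h.bounds z hz0
  have hfac : ∀ y, 0 < y → α * β / 2 * f y ^ 2 * u y + u y * (u y ^ 2 - 1) / y ^ 2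
      = u y / y ^ 2 * (α * β / 2 * (y * f y) ^ 2 + u y ^ 2 - 1) := fun y hy => by
    field_simp
    ring
  rw [hfac x hx0] at hmax
  rw [hfac z hz0] at hmin
  have kx := nonpos_of_mul_nonpos_right hmax (by positivity)
  have kz := nonneg_of_mul_nonneg_right hmin (by positivity)
  have hzf : f z < f x := hf (mem_Ioi.2 hz0) (mem_Ioi.2 hx0) hzI.2
  have h1 : z * f z < x * f x := mul_lt_mul hzI.2 hzf.le hfz hx0.le
  have h2 : (z * f z) ^ 2 < (x * f x) ^ 2 := by gcongr
  have h3 : α * β / 2 * (z * f z) ^ 2 < α * β / 2 * (x * f x) ^ 2 := by gcongr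
  have h4 : u z ^ 2 ≤ u x ^ 2 := by
    have := hza.trans hax
    gcongr
  linarith

theorem hasDerivAt_mul_one_sub_sq (h : SolvesEulerLagrange α β γ u f) {r : ℝ} (hr : 0 < r) :
    HasDerivAt (fun r => f r * (1 - u r ^ 2))
      (deriv f r * (1 - u r ^ 2) - 2 * f r * u r * deriv u r) r :=
  ((h.hasDerivAt_f hr).mul (((h.hasDerivAt_u hr).pow 2).const_sub 1)).congr_deriv (by
    simp only [Pi.pow_apply]; push_cast; ring)

/-- The energy density minus a multiple of the derivative of `f (1 - u²)`, as a sum of squares and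
of products of definite sign. -/
theorem energyDensity_sub_eq (hα : 0 ≤ α) (hβ : 0 ≤ β) (m : ℝ) {r : ℝ} (hr : r ≠ 0) :
    energyDensity α β 0 u f r
        - √α * m * (deriv f r * (1 - u r ^ 2) - 2 * f r * u r * deriv u r) =
      2 * (deriv u r + √α * √(2 * β) / 2 * f r * u r) ^ 2
        + ((1 - u r ^ 2) / r - √α * r * deriv f r) ^ 2
        + √α * (2 - m) * (deriv f r * (1 - u r ^ 2))
        + √α * (√(2 * β) - m) * (2 * f r * u r * -deriv u r) := by
  have hs2 : √α ^ 2 = α := Real.sq_sqrt hα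
  have hb2 : √(2 * β) ^ 2 = 2 * β := Real.sq_sqrt (by positivity)
  unfold energyDensity
  generalize √(2 * β) = b at *
  generalize √α = s at *
  have hβ' : β = b ^ 2 / 2 := by linarith
  subst hs2 hβ'
  field_simp
  ring

theorem deriv_nonpos_of_strictAntiOn (hu : StrictAntiOn u (Ioi 0)) {r : ℝ} (hr : 0 < r) : deriv u r ≤ 0 := by
  have := hu.antitoneOn.derivWithin_nonpos (x := r)
  rwa [derivWithin_of_isOpen isOpen_Ioi (mem_Ioi.2 hr)] at this

/-- With m the smaller of √(2β) and 2, both products in the completed square are nonnegative by the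
monotonicity of u and f, and for β ≠ 2 one of their coefficients is strictly positive. -/
theorem IsProfile.le_energyDensity (h : IsProfile α β 0 u f) (hα : 0 < α) (hβ : 0 < β)
    (hE : energy α β 0 u f < ⊤) {r : ℝ} (hr : 0 < r) :
    0 ≤ deriv f r * (1 - u r ^ 2) - 2 * f r * u r * deriv u r ∧
    √α * min (√(2 * β)) 2 * (deriv f r * (1 - u r ^ 2) - 2 * f r * u r * deriv u r)
        ≤ energyDensity α β 0 u f r ∧
      (β ≠ 2 →
        √α * min (√(2 * β)) 2 * (deriv f r * (1 - u r ^ 2) - 2 * f r * u r * deriv u r)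
          < energyDensity α β 0 u f r) := by
  have hf' := h.deriv_f_pos hα hβ hE hr
  have hu' := deriv_nonpos_of_strictAntiOn (h.strictAntiOn_u hα hβ (h.strictMonoOn_f hα hβ hE)) hr
  obtain ⟨hu0, hu1, hf0, -⟩ := h.bounds r hr
  have hu2 : 0 < 1 - u r ^ 2 := by nlinarith
  have hs : 0 < √α := Real.sqrt_pos.2 hα
  have hb : 0 < √(2 * β) := Real.sqrt_pos.2 (by positivity)
  have key := energyDensity_sub_eq (u := u) (f := f) hα.le hβ.le (min (√(2 * β)) 2) hr.ne'
  have hnu : 0 ≤ -deriv u r := by linarith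
  have hm1 : 0 ≤ 2 - min (√(2 * β)) 2 := sub_nonneg.2 (min_le_right _ _)
  have hm2 : 0 ≤ √(2 * β) - min (√(2 * β)) 2 := sub_nonneg.2 (min_le_left _ _)
  have t1 : 0 ≤ 2 * (deriv u r + √α * √(2 * β) / 2 * f r * u r) ^ 2 := by positivity
  have t2 : 0 ≤ ((1 - u r ^ 2) / r - √α * r * deriv f r) ^ 2 := by positivity
  have t3 : 0 ≤ √α * (2 - min (√(2 * β)) 2) * (deriv f r * (1 - u r ^ 2)) := by positivity
  have t4 : 0 ≤ √α * (√(2 * β) - min (√(2 * β)) 2) * (2 * f r * u r * -deriv u r) := by positivity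
  refine ⟨?_, by linarith, fun hβ2 => ?_⟩
  · have : 0 ≤ deriv f r * (1 - u r ^ 2) := by positivity
    have : 0 ≤ 2 * f r * u r * -deriv u r := by positivity
    linarith
  · have hb2 : √(2 * β) ≠ 2 := fun e => hβ2 (by
      have := Real.sq_sqrt (show 0 ≤ 2 * β by positivity)
      rw [e] at this
      linarith)
    rcases hb2.lt_or_gt with hlt | hgt
    · rw [min_eq_left hlt.le] at *
      have : 0 < √α * (2 - √(2 * β)) * (deriv f r * (1 - u r ^ 2)) := by
        have := sub_pos.2 hlt
        positivity
      linarith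
    · rw [min_eq_right hgt.le] at *
      -- Only u' ≤ 0 is available pointwise; where u' vanishes, strictness comes from the first
      -- square instead.
      rcases hnu.eq_or_lt with he | hneg
      · have he' : deriv u r = 0 := by linarith
        have : 0 < 2 * (deriv u r + √α * √(2 * β) / 2 * f r * u r) ^ 2 := by
          rw [he', zero_add]
          positivity
        linarith
      · have : 0 < √α * (√(2 * β) - 2) * (2 * f r * u r * -deriv u r) := by
          have := sub_pos.2 hgt
          positivity
        linarith

theorem IsProfile.le_energy (h : IsProfile α β 0 u f) (hα : 0 < α) (hβ : 0 < β)
    (hA : Admissible α β 0 u f) :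
    ENNReal.ofReal (√α * min (√(2 * β)) 2) ≤ energy α β 0 u f ∧
      (β ≠ 2 → ENNReal.ofReal (√α * min (√(2 * β)) 2) < energy α β 0 u f) := by
  have hi := hA.integrableOn_energyDensity hα.le hβ.le le_rfl
  have hb := h.boundary
  have hle := fun r (hr : 0 < r) => h.le_energyDensity hα hβ hA.finite_energy hr
  set c := √α * min (√(2 * β)) 2
  have hc : 0 ≤ c := by positivity
  have hD : IntegrableOn (fun r => c * (deriv f r * (1 - u r ^ 2) - 2 * f r * u r * deriv u r))
      (Ioi 0) := by
    refine Integrable.mono' hi (ContinuousOn.aestronglyMeasurable ?_ measurableSet_Ioi) ?_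
    · have := h.el.continuousOn_u
      have := h.el.continuousOn_f
      have := h.el.continuousOn_deriv_u
      have := h.el.continuousOn_deriv_f
      fun_prop
    · filter_upwards [self_mem_ae_restrict measurableSet_Ioi] with r hr
      rw [Real.norm_of_nonneg (mul_nonneg hc (hle r hr).1)]
      exact (hle r hr).2.1
  have hDi := integral_Ioi_zero_of_hasDerivAt (G := fun r => c * (f r * (1 - u r ^ 2)))
    (m := c * (0 * (1 - 1 ^ 2))) (n := c * (1 * (1 - 0 ^ 2)))
    (fun r hr => (hasDerivAt_mul_one_sub_sq h.el hr).const_mul c) hD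
    ((hb.f_zero.mul ((hb.u_zero.pow 2).const_sub 1)).const_mul c)
    ((hb.f_infty.mul ((hb.u_infty.pow 2).const_sub 1)).const_mul c)
  have hDc : ∫ r in Ioi (0 : ℝ), c * (deriv f r * (1 - u r ^ 2) - 2 * f r * u r * deriv u r)
      = c := by
    rw [hDi]; ring
  rw [energy_eq_ofReal_integral hα.le hβ.le le_rfl hi, ← hDc]
  refine ⟨ENNReal.ofReal_le_ofReal (setIntegral_mono_on hD hi measurableSet_Ioi
    fun r hr => (hle r hr).2.1), fun hβ2 => ?_⟩
  have hlt := setIntegral_Ioi_lt hD hi fun r hr => (hle r hr).2.2 hβ2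
  refine (ENNReal.ofReal_lt_ofReal_iff (lt_of_le_of_lt ?_ hlt)).2 hlt
  rw [hDc]
  exact hc

end

/-! ### The upper energy bound -/

section

variable {α β γ : ℝ} {u f : ℝ → ℝ}

theorem integral_sq_mul_exp_neg_mul {c : ℝ} (hc : 0 < c) :
    ∫ r in Ioi (0 : ℝ), r ^ 2 * Real.exp (-(c * r)) = 2 / c ^ 3 := by
  have h := Real.integral_rpow_mul_exp_neg_mul_Ioi (a := 3) (by norm_num) hc
  have e : (3 : ℝ) - 1 = (2 : ℕ) := by norm_num
  have e2 : Real.Gamma 3 = 2 := by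
    rw [show (3 : ℝ) = (2 : ℕ) + 1 by norm_num, Real.Gamma_nat_eq_factorial]
    norm_num
  simp only [e, Real.rpow_natCast, e2] at h
  rw [h, show (3 : ℝ) = (3 : ℕ) by norm_num, Real.rpow_natCast]
  field_simp

/-- With x = e^{-2sr} one has 1/sinh²(sr) = 4x/(1 - x)², expanded by the series ∑ n xⁿ = x/(1 - x)².
-/
theorem hasSum_uBPS_sq (hα : 0 < α) {r : ℝ} (hr : 0 < r) :
    HasSum (fun n : ℕ => 4 * √α ^ 2 * n * (r ^ 2 * Real.exp (-(2 * n * √α * r))))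
      (uBPS α r ^ 2) := by
  have hs : 0 < √α := Real.sqrt_pos.2 hα
  unfold uBPS
  generalize √α = s at *
  set x := Real.exp (-(2 * (s * r))) with hx
  have hx0 : 0 < x := Real.exp_pos _
  have hx1 : x < 1 := Real.exp_lt_one_iff.2 (by have := mul_pos hs hr; linarith)
  have h := (hasSum_coe_mul_geometric_of_norm_lt_one (r := x)
    (by rwa [Real.norm_of_nonneg hx0.le])).mul_left (4 * s ^ 2 * r ^ 2)
  have hterm : (fun n : ℕ => 4 * s ^ 2 * n * (r ^ 2 * Real.exp (-(2 * n * s * r))))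
      = fun n : ℕ => 4 * s ^ 2 * r ^ 2 * (n * x ^ n) := by
    funext n
    rw [hx, ← Real.exp_nat_mul]
    ring_nf
  have hval : (s * r / Real.sinh (s * r)) ^ 2 = 4 * s ^ 2 * r ^ 2 * (x / (1 - x) ^ 2) := by
    have hy : 0 < Real.exp (s * r) := Real.exp_pos _
    have e1 : x = (Real.exp (s * r))⁻¹ ^ 2 := by
      rw [hx, ← Real.exp_neg, ← Real.exp_nat_mul]
      congr 1
      push_cast
      ring
    have e2 : Real.exp (s * r) ^ 2 - 1 ≠ 0 := by
      have : 1 < Real.exp (s * r) := Real.one_lt_exp_iff.2 (mul_pos hs hr)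
      nlinarith
    rw [e1, Real.sinh_eq, Real.exp_neg]
    generalize Real.exp (s * r) = y at *
    have e3 : y - y⁻¹ = (y ^ 2 - 1) / y := by field_simp
    have e4 : 1 - y⁻¹ ^ 2 = (y ^ 2 - 1) / y ^ 2 := by field_simp
    rw [e3, e4]
    field_simp
    try ring
  rwa [hterm, hval]

/-- Termwise integration of the exponential series gives 1/(n² √α) for each n, with value 0 at n =
0, and the sum is ζ(2)/√α. -/
theorem integral_uBPS_sq (hα : 0 < α) :
    ∫ r in Ioi (0 : ℝ), uBPS α r ^ 2 = Real.pi ^ 2 / 6 / √α := by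
  have hs : 0 < √α := Real.sqrt_pos.2 hα
  have hsum : ∀ r ∈ Ioi (0 : ℝ), uBPS α r ^ 2
      = ∑' n : ℕ, 4 * √α ^ 2 * n * (r ^ 2 * Real.exp (-(2 * n * √α * r))) :=
    fun r hr => (hasSum_uBPS_sq hα hr).tsum_eq.symm
  rw [setIntegral_congr_fun measurableSet_Ioi hsum]
  generalize √α = s at *
  have hterm : ∀ n : ℕ,
      ∫ r in Ioi (0 : ℝ), 4 * s ^ 2 * n * (r ^ 2 * Real.exp (-(2 * n * s * r)))
        = 1 / (n : ℝ) ^ 2 / s := by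
    intro n
    rw [integral_const_mul]
    rcases n.eq_zero_or_pos with rfl | hn
    · simp
    · have hn' : (0 : ℝ) < n := by exact_mod_cast hn
      rw [integral_sq_mul_exp_neg_mul (by positivity)]
      field_simp
      try ring
  have hint : ∀ n : ℕ, Integrable
      (fun r : ℝ => 4 * s ^ 2 * n * (r ^ 2 * Real.exp (-(2 * n * s * r))))
      (volume.restrict (Ioi 0)) := by
    intro n
    rcases n.eq_zero_or_pos with rfl | hn
    · simp
    · have hn' : (0 : ℝ) < n := by exact_mod_cast hn
      -- The integral of a nonintegrable function is 0 by convention, so a nonzero value proves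
      -- integrability.
      refine Integrable.of_integral_ne_zero ?_
      rw [hterm]
      positivity
  have hz := hasSum_zeta_two.div_const s
  have hsummable : Summable fun n : ℕ =>
      ∫ r in Ioi (0 : ℝ), ‖4 * s ^ 2 * n * (r ^ 2 * Real.exp (-(2 * n * s * r)))‖ := by
    refine hz.summable.congr fun n => ?_
    rw [← hterm n]
    congr 1
    ext r
    rw [Real.norm_of_nonneg (by positivity)]
  have h := hasSum_integral_of_summable_integral_norm hint hsummable
  simp only [hterm] at h
  exact h.unique hz

theorem integrableOn_uBPS_sq (hα : 0 < α) : IntegrableOn (fun r => uBPS α r ^ 2) (Ioi 0) := by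
  refine Integrable.of_integral_ne_zero ?_
  rw [integral_uBPS_sq hα]
  have hs : 0 < √α := Real.sqrt_pos.2 hα
  have := Real.pi_pos
  positivity

/-- This is cosh² - sinh² = 1 in terms of the profiles, equivalently the first integral (f + 1/(√α
r))² - (u/(√α r))² = 1 solved for the term linear in f. -/
theorem fBPS_sq_add (hα : 0 < α) {r : ℝ} (hr : 0 < r) :
    2 * fBPS α r / r
      = √α * (1 - fBPS α r ^ 2) - (1 - uBPS α r ^ 2) / (√α * r ^ 2) := by
  have hs : 0 < √α := Real.sqrt_pos.2 hα
  unfold fBPS uBPS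
  generalize √α = s at *
  have h1 : 0 < Real.sinh (s * r) := Real.sinh_pos_iff.2 (mul_pos hs hr)
  have h2 := Real.cosh_sq (s * r)
  generalize Real.sinh (s * r) = x at *
  generalize Real.cosh (s * r) = y at *
  field_simp
  linear_combination (s ^ 2 * r ^ 2) * h2

/-- The integral reduces to that of u²: by the first-order equations and the preceding identity, s
f² u² - (s/3) u² is the derivative of -[(1 - u²)/(sr) + (1 + u²) f]/3, with s = √α, which goes from
0 to -1/3. -/
theorem integral_fBPS_sq_mul_uBPS_sq (hα : 0 < α) :
    IntegrableOn (fun r => fBPS α r ^ 2 * uBPS α r ^ 2) (Ioi 0) ∧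
      α * ∫ r in Ioi (0 : ℝ), fBPS α r ^ 2 * uBPS α r ^ 2 = √α * (Real.pi ^ 2 / 18 - 1 / 3) := by
  have hmin := isMinimizer_bps hα
  have hp := hmin.isProfile hα two_pos le_rfl
  have h := solvesBPS_bps hα
  have hb := hp.boundary
  have hi1 := integrableOn_uBPS_sq hα
  have hI := integral_uBPS_sq hα
  have hid := fun r (hr : 0 < r) => fBPS_sq_add hα hr
  have hi2 := (integrableOn_energy_terms hα two_pos le_rfl hp.el.continuousOn_u
    hp.el.continuousOn_f hmin.1.finite_energy).2.2.2
  refine ⟨hi2, ?_⟩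
  -- Any exponent strictly between 1 and 2 would do; it makes (1 - u²)/r vanish at the origin.
  have hO := hp.one_sub_u_isBigO_zero hα two_pos (t := 3 / 2) (by norm_num) (by norm_num)
  have hud : ∀ r, 0 < r → HasDerivAt (uBPS α) (-(√α * fBPS α r * uBPS α r)) r :=
    fun r hr => h.hasDerivAt_u hr
  have hfd : ∀ r, 0 < r → HasDerivAt (fBPS α) ((1 - uBPS α r ^ 2) / (√α * r ^ 2)) r :=
    fun r hr => h.hasDerivAt_f hα hr
  have hs : 0 < √α := Real.sqrt_pos.2 hα
  have hs2 : √α ^ 2 = α := Real.sq_sqrt hα.le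
  clear hmin hp h
  generalize uBPS α = u at *
  generalize fBPS α = f at *
  generalize √α = s at *
  have hzero : Tendsto (fun r => (1 - u r ^ 2) / (s * r)) (𝓝[>] 0) (𝓝 0) := by
    have h1 : Tendsto (fun r => (1 - u r) / r) (𝓝[>] 0) (𝓝 0) := by
      have h2 : (fun r => (1 - u r) / r) =O[𝓝[>] 0] fun r => r ^ (1 / 2 : ℝ) := by
        refine (hO.mul (isBigO_refl (fun r : ℝ => r⁻¹) _)).congr'
          (.of_forall fun r => (div_eq_mul_inv _ _).symm) ?_
        filter_upwards [self_mem_nhdsWithin] with r hr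
        rw [← Real.rpow_neg_one, ← Real.rpow_add hr]
        norm_num
      refine h2.trans_tendsto ?_
      have h3 : Tendsto (fun r : ℝ => r ^ (1 / 2 : ℝ)) (𝓝[>] 0) (𝓝 (0 ^ (1 / 2 : ℝ))) :=
        ((Real.continuous_rpow_const (by norm_num)).tendsto 0).mono_left nhdsWithin_le_nhds
      simpa using h3
    have h4 := (h1.mul (hb.u_zero.const_add 1)).div_const s
    simp only [zero_mul, zero_div] at h4
    refine h4.congr fun r => ?_
    rw [mul_comm s r, ← div_div]
    ring
  have hinfty : Tendsto (fun r => (1 - u r ^ 2) / (s * r)) atTop (𝓝 0) :=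
    ((hb.u_infty.pow 2).const_sub 1).div_atTop (tendsto_id.const_mul_atTop hs)
  have hgi : IntegrableOn (fun r => s * (f r ^ 2 * u r ^ 2) - s / 3 * u r ^ 2) (Ioi 0) :=
    (hi2.const_mul s).sub (hi1.const_mul (s / 3))
  have hF := integral_Ioi_zero_of_hasDerivAt
    (G := fun r => -((1 - u r ^ 2) / (s * r) + (1 + u r ^ 2) * f r) / 3)
    (g := fun r => s * (f r ^ 2 * u r ^ 2) - s / 3 * u r ^ 2)
    (m := -(0 + (1 + 1 ^ 2) * 0) / 3) (n := -(0 + (1 + 0 ^ 2) * 1) / 3)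
    (fun r hr => by
      have hr0 : 0 < r := hr
      refine (((((((hud r hr).pow 2).const_sub 1).div ((hasDerivAt_id r).const_mul s)
        (by simp [hs.ne', hr0.ne'])).add ((((hud r hr).pow 2).const_add 1).mul
          (hfd r hr))).neg).div_const 3).congr_deriv ?_
      have e := hid r hr
      simp only [id, Pi.pow_apply]
      field_simp at e ⊢
      linear_combination (-(u r ^ 2)) * e)
    hgi
    ((hzero.add (((hb.u_zero.pow 2).const_add 1).mul hb.f_zero)).neg.div_const 3)
    ((hinfty.add (((hb.u_infty.pow 2).const_add 1).mul hb.f_infty)).neg.div_const 3)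
  rw [integral_sub (hi2.const_mul s) (hi1.const_mul (s / 3)), integral_const_mul,
    integral_const_mul, hI] at hF
  rw [← hs2]
  have : s / 3 * (Real.pi ^ 2 / 6 / s) = Real.pi ^ 2 / 18 := by field_simp; norm_num
  rw [this] at hF
  linear_combination s * hF

/-- The BPS pair does not depend on β, so its energy is affine in β: 2√α at β = 2, with slope α ∫ f²
u². -/
theorem admissible_bps (hα : 0 < α) (hβ : 0 < β) :
    Admissible α β 0 (uBPS α) (fBPS α) ∧ energy α β 0 (uBPS α) (fBPS α) =
      ENNReal.ofReal (√α / 3 * (8 - Real.pi ^ 2 / 3 + (Real.pi ^ 2 / 6 - 1) * β)) := by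
  have hA := (isMinimizer_bps hα).1
  have hi := hA.integrableOn_energyDensity hα.le two_pos.le le_rfl
  obtain ⟨hi2, hI2⟩ := integral_fBPS_sq_mul_uBPS_sq hα
  have hd : energyDensity α β 0 (uBPS α) (fBPS α) = fun r =>
      energyDensity α 2 0 (uBPS α) (fBPS α) r + α * (β - 2) * (fBPS α r ^ 2 * uBPS α r ^ 2) := by
    ext r
    unfold energyDensity
    ring
  have hi3 := hi2.const_mul (α * (β - 2))
  have hint : IntegrableOn (energyDensity α β 0 (uBPS α) (fBPS α)) (Ioi 0) := by
    rw [hd]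
    exact hi.add hi3
  have hval : ∫ r in Ioi (0 : ℝ), energyDensity α 2 0 (uBPS α) (fBPS α) r = 2 * √α := by
    have e := energy_bps hα
    rw [energy_eq_ofReal_integral hα.le two_pos.le le_rfl hi] at e
    exact (ENNReal.ofReal_eq_ofReal_iff (integral_nonneg fun r =>
      energyDensity_nonneg hα.le two_pos.le le_rfl _ _ r) (by positivity)).1 e
  have hE : energy α β 0 (uBPS α) (fBPS α) =
      ENNReal.ofReal (√α / 3 * (8 - Real.pi ^ 2 / 3 + (Real.pi ^ 2 / 6 - 1) * β)) := by
    rw [energy_eq_ofReal_integral hα.le hβ.le le_rfl hint, hd, integral_add hi hi3,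
      integral_const_mul, hval]
    congr 1
    linear_combination (β - 2) * hI2
  exact ⟨⟨hE ▸ ENNReal.ofReal_lt_top, hA.ac_u, hA.ac_f, hA.boundary⟩, hE⟩

/-- If equality held, the BPS pair would be a minimizer for β as well, and its f would satisfy (EL)
with both β and 2. Subtracting the two equations at r = 1 leaves (β - 2) f u² = 0. -/
theorem IsMinimizer.energy_le (hα : 0 < α) (hβ : 0 < β) (h : IsMinimizer α β 0 u f) :
    energy α β 0 u f ≤
        ENNReal.ofReal (√α / 3 * (8 - Real.pi ^ 2 / 3 + (Real.pi ^ 2 / 6 - 1) * β)) ∧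
      (β ≠ 2 → energy α β 0 u f <
        ENNReal.ofReal (√α / 3 * (8 - Real.pi ^ 2 / 3 + (Real.pi ^ 2 / 6 - 1) * β))) := by
  obtain ⟨hA, hE⟩ := admissible_bps hα hβ
  rw [← hE]
  refine ⟨h.2 _ _ hA, fun hβ2 => (h.2 _ _ hA).lt_of_ne fun he => hβ2 ?_⟩
  have hmin : IsMinimizer α β 0 (uBPS α) (fBPS α) := ⟨hA, fun v g hv => he ▸ h.2 v g hv⟩
  have hp := hmin.isProfile hα hβ le_rfl
  have h1 := (hp.el 1 one_pos).2.2.2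
  have h2 := (((isMinimizer_bps hα).isProfile hα two_pos le_rfl).el 1 one_pos).2.2.2
  have h3 := h1.unique h2
  obtain ⟨hu, -, hf, -⟩ := hp.bounds 1 one_pos
  have h4 : (β - 2) * (fBPS α 1 * uBPS α 1 ^ 2) = 0 := by linear_combination h3
  have h5 : fBPS α 1 * uBPS α 1 ^ 2 ≠ 0 := by positivity
  linarith [(mul_eq_zero.1 h4).resolve_right h5]

end

end DarkMonopole

theorem theorem2p1 :
    -- (i) existence of a minimizer, and the properties of every minimizer
    (∀ α β γ : ℝ, 0 < α → 0 < β → 0 ≤ γ →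
      (∃ u f : ℝ → ℝ, DarkMonopole.IsMinimizer α β γ u f) ∧
      ∀ u f : ℝ → ℝ, DarkMonopole.IsMinimizer α β γ u f →
        DarkMonopole.SolvesEulerLagrange α β γ u f ∧
        (∀ r : ℝ, 0 < r → 0 < u r ∧ u r < 1 ∧ 0 < f r ∧ f r < 1) ∧
        (∀ ε : ℝ, 0 < ε → ε < 1 →
          u =O[atTop] (fun r : ℝ => Real.exp (-(√(α * β / 2) * (1 - ε) * r))) ∧
          (0 < γ → (fun r : ℝ => 1 - f r) =O[atTop]
            (fun r : ℝ => Real.exp (-(√2 * min (√γ) (√(α * β)) * (1 - ε) * r)))) ∧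
          (fun r : ℝ => 1 - u r) =O[𝓝[>] 0] (fun r : ℝ => r ^ (2 * (1 - ε))) ∧
          f =O[𝓝[>] 0] (fun r : ℝ => r ^ ((√(1 / 4 + β) - 1 / 2) * (1 - ε)))) ∧
        (γ = 0 → (fun r : ℝ => 1 - f r) =O[atTop] (fun r : ℝ => 1 / r))) ∧
    -- (ii) the BPS case
    (∀ α : ℝ, 0 < α →
      (∀ u f : ℝ → ℝ, DarkMonopole.BoundaryConditions u f →
        DarkMonopole.energy α 2 0 u f < ⊤ →
        (DarkMonopole.SolvesEulerLagrange α 2 0 u f ↔ DarkMonopole.SolvesBPS α u f)) ∧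
      (∀ u f : ℝ → ℝ,
        (DarkMonopole.SolvesBPS α u f ∧ DarkMonopole.BoundaryConditions u f) ↔
          (EqOn u (DarkMonopole.uBPS α) (Ioi 0) ∧ EqOn f (DarkMonopole.fBPS α) (Ioi 0))) ∧
      DarkMonopole.IsMinimizer α 2 0 (DarkMonopole.uBPS α) (DarkMonopole.fBPS α) ∧
      DarkMonopole.energy α 2 0 (DarkMonopole.uBPS α) (DarkMonopole.fBPS α)
        = ENNReal.ofReal (2 * √α)) ∧
    -- (iii) monotonicity and energy bounds for vanishing `γ`, strict away from the BPS case
    (∀ α β : ℝ, 0 < α → 0 < β →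
      ∀ u f : ℝ → ℝ, DarkMonopole.IsMinimizer α β 0 u f →
        StrictAntiOn u (Ioi 0) ∧ StrictMonoOn f (Ioi 0) ∧
        ENNReal.ofReal (√α * min (√(2 * β)) 2) ≤ DarkMonopole.energy α β 0 u f ∧
        DarkMonopole.energy α β 0 u f ≤
          ENNReal.ofReal (√α / 3 * (8 - Real.pi ^ 2 / 3 + (Real.pi ^ 2 / 6 - 1) * β)) ∧
        (β ≠ 2 →
          ENNReal.ofReal (√α * min (√(2 * β)) 2) < DarkMonopole.energy α β 0 u f ∧
          DarkMonopole.energy α β 0 u f <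
            ENNReal.ofReal (√α / 3 * (8 - Real.pi ^ 2 / 3 + (Real.pi ^ 2 / 6 - 1) * β)))) := by
  refine ⟨fun α β γ hα hβ hγ => ⟨DarkMonopole.exists_isMinimizer hα hβ hγ, fun u f h => ?_⟩,
    fun α hα => ⟨fun u f hb hE => ⟨fun h => h.solvesBPS hα hb hE, fun h => h.solvesEulerLagrange hα⟩,
      fun u f => DarkMonopole.solvesBPS_and_boundaryConditions_iff hα,
      DarkMonopole.isMinimizer_bps hα, DarkMonopole.energy_bps hα⟩,
    fun α β hα hβ u f h => ?_⟩
  · have hp := h.isProfile hα hβ hγ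
    refine ⟨hp.el, hp.bounds, fun ε hε0 hε1 => hp.decay hα hβ hε0 hε1, fun h0 => ?_⟩
    subst h0
    exact hp.one_sub_f_isBigO_infty_inv hα hβ
  · have hp := h.isProfile hα hβ le_rfl
    have hf := hp.strictMonoOn_f hα hβ h.1.finite_energy
    have hle := hp.le_energy hα hβ h.1
    have hge := h.energy_le hα hβ
    exact ⟨hp.strictAntiOn_u hα hβ hf, hf, hle.1, hge.1, fun hne => ⟨hle.2 hne, hge.2 hne⟩⟩
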